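/- Let $G$ be a finitely generated group and let $H$ be a normal subgroup of $G$ of finite index (so $H$ and $G/H$ are finitely generated, too). Then, for all finite generating sets $\Sigma$ of $G$, $\Gamma$ of $H$ and $\Delta$ of $G/H$, the compressed word problem $\mathsf{CWP}(G)$ of $G$ with respect to $\Sigma$ is $\mathsf{AC}^0$-reducible to the compressed word problems $\mathsf{CWP}(H)$ (with respect to $\Gamma$) and $\mathsf{CWP}(G/H)$ (with respect to $\Delta$). Here, a straight-line program (SLP) over an alphabet $A$ is a triple $\mathcal{G}=(V,S,\mathrm{rhs})$ with a finite set $V$ of variables, a start variable $S\in V$ and a map $\mathrm{rhs}$ that assigns to every variable either a symbol of $A$ or a word $BC$ with $B,C\in V$, such that for some linear order $<$ on $V$ every variable that occurs in $\mathrm{rhs}(X)$ is smaller than $X$. The word over $A$ derived from $S$ is denoted by $\mathrm{val}(\mathcal{G})$. The compressed word problem of a group $K$ with finite generating set $\Omega$ is the set of all SLPs $\mathcal{G}$ over $\Omega\cup\Omega^{-1}$ such that $\mathrm{val}(\mathcal{G})$ evaluates to $1$ in $K$. An SLP is given as a binary string that lists the rules $X\to\mathrm{rhs}(X)$ along such a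 linear order (the variables being named by bit strings), followed by the name of $S$. A language $A$ is $\mathsf{AC}^0$-reducible to languages $B_1,\dots,B_k$ if $A$ can be solved by a $\mathsf{DLOGTIME}$-uniform family of circuits of polynomial size and constant depth that use NOT-gates, unbounded fan-in AND-gates and OR-gates, and oracle gates for $B_1,\dots,B_k$, where a $B_i$-gate receives an ordered tuple $x_1,\dots,x_m$ of inputs and outputs $1$ if and only if $x_1\cdots x_m\in B_i$. $\mathsf{DLOGTIME}$-uniform means that, given the input length $n$ and gate numbers in binary, a deterministic multitape Turing machine can determine, in time linear in the number of bits it is given, the type of a gate, whether gate $u$ is an input of gate $v$, and, for oracle gates $v$, whether $u$ is the $p$-th input of $v$. -/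

import Mathlib

/-! ## Deterministic multitape Turing machines and linear time -/

/-- A deterministic multitape Turing machine with `k` input tapes and `work` work tapes, over the
tape alphabet `{0, 1, blank}` (`none` is the blank) and with finitely many states. In one step it
reads all its heads; the machine halts where `trans` is `none`, and otherwise it changes its state,
writes a symbol on every tape and moves every head by at most one cell (`none`: no move). -/
structure MultitapeTM (k : ℕ) where
  work : ℕ
  State : Type
  finite_state : Finite State
  start : State
  accept : Set State
  trans : State → (Fin k ⊕ Fin work → Option Bool) →
    Option (State × (Fin k ⊕ Fin work → Option Bool × Option Turing.Dir))

namespace MultitapeTM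

variable {k : ℕ}

/-- A configuration: the state and, for each tape, its content and head position. -/
structure Cfg (M : MultitapeTM k) where
  state : M.State
  tape : Fin k ⊕ Fin M.work → Turing.Tape (Option Bool)

/-- One step; `none` if the machine has halted. -/
def step (M : MultitapeTM k) (c : M.Cfg) : Option M.Cfg :=
  (M.trans c.state fun i => (c.tape i).head).map fun a =>
    { state := a.1
      tape := fun i =>
        match (a.2 i).2 with
        | none => (c.tape i).write (a.2 i).1
        | some dir => ((c.tape i).write (a.2 i).1).move dir }

/-- The initial configuration on a tuple of numbers: the binary digits of `x i` (least significant
digit first) on input tape `i`, head on the first digit, and empty work tapes. -/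
def init (M : MultitapeTM k) (x : Fin k → ℕ) : M.Cfg where
  state := M.start
  tape
    | Sum.inl i => Turing.Tape.mk₁ ((x i).bits.map some)
    | Sum.inr _ => Turing.Tape.mk₁ []

/-- The configuration after `t` steps, a halted machine staying where it is. -/
def run (M : MultitapeTM k) (x : Fin k → ℕ) (t : ℕ) : M.Cfg :=
  (fun c => (M.step c).getD c)^[t] (M.init x)

end MultitapeTM

/-- The relation `R` on `k`-tuples of binary coded numbers is decided by a multitape Turing machine
in time linear in the total number of binary digits of the tuple. -/
def LinearTimeDecidable {k : ℕ} (R : (Fin k → ℕ) → Prop) : Prop :=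
  ∃ (M : MultitapeTM k) (c : ℕ), ∀ x : Fin k → ℕ,
    M.step (M.run x (c * ∑ i, (x i).size + c)) = none ∧
      ((M.run x (c * ∑ i, (x i).size + c)).state ∈ M.accept ↔ R x)

/-! ## Oracle circuits and reducibility -/

/-- The types of gates of a circuit with `k` oracles. -/
inductive GateKind (k : ℕ) where
  /-- the gate of the `i`-th input bit, counting from `0` -/
  | input (i : ℕ)
  | not
  | and
  | or
  /-- a gate for the `j`-th oracle -/
  | oracle (j : Fin k)

/-- A circuit with unbounded fan-in and `k` oracles. Its gates are the numbers below `size`, and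
`inputs v` is the ordered tuple of the gates that feed gate `v`. Values of `kind` and `inputs` at
numbers that are not gates are irrelevant. -/
structure OracleCircuit (k : ℕ) where
  size : ℕ
  kind : ℕ → GateKind k
  inputs : ℕ → List ℕ
  output : ℕ

namespace OracleCircuit

variable {k : ℕ}

/-- `C` is a circuit for inputs of length `n`. -/
structure WellFormed (C : OracleCircuit k) (n : ℕ) : Prop where
  output_lt : C.output < C.size
  inputs_lt : ∀ v < C.size, ∀ u ∈ C.inputs v, u < C.size
  input_gate : ∀ v < C.size, ∀ i, C.kind v = GateKind.input i → i < n ∧ C.inputs v = []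
  not_gate : ∀ v < C.size, C.kind v = GateKind.not → (C.inputs v).length = 1

/-- `C` has no cycles, and its paths have at most `d` edges. -/
def DepthLE (C : OracleCircuit k) (d : ℕ) : Prop :=
  ∃ layer : ℕ → ℕ, ∀ v < C.size, layer v ≤ d ∧ ∀ u ∈ C.inputs v, layer u < layer v

/-- The gate of type `t` has the value true, when the circuit input is `x` and the gate
receives the tuple `w`. -/
def GateTrue (B : Fin k → Language Bool) (x w : List Bool) : GateKind k → Prop
  | GateKind.input i => x[i]? = some true
  | GateKind.not => w = [false]
  | GateKind.and => ∀ b ∈ w, b = true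
  | GateKind.or => ∃ b ∈ w, b = true
  | GateKind.oracle j => w ∈ B j

/-- `val` assigns to all gates their values on input `x` (for a circuit without cycles, there is
exactly one such assignment on the gates). -/
def IsValuation (C : OracleCircuit k) (B : Fin k → Language Bool) (x : List Bool)
    (val : ℕ → Bool) : Prop :=
  ∀ v < C.size, val v = true ↔ GateTrue B x ((C.inputs v).map val) (C.kind v)

/-- The circuit outputs true on input `x`, with oracles `B`. -/
def Accepts (C : OracleCircuit k) (B : Fin k → Language Bool) (x : List Bool) : Prop :=
  ∃ val : ℕ → Bool, C.IsValuation B x val ∧ val C.output = true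

end OracleCircuit

/-- `DLOGTIME`-uniformity: from the binary codings of the input length `n` and of gate numbers,
one can decide in linear time (so in time `O(log n)` on the gates of a family of polynomial size)
the type of a gate, whether it is the output gate, whether gate `u` is an input of gate `v` and,
for oracle gates, whether it is the input number `p` (counting from `0`). -/
structure DLogTimeUniform {k : ℕ} (C : ℕ → OracleCircuit k) : Prop where
  input : LinearTimeDecidable fun a : Fin 3 → ℕ =>
    a 1 < (C (a 0)).size ∧ (C (a 0)).kind (a 1) = GateKind.input (a 2)
  not : LinearTimeDecidable fun a : Fin 2 → ℕ =>
    a 1 < (C (a 0)).size ∧ (C (a 0)).kind (a 1) = GateKind.not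
  and : LinearTimeDecidable fun a : Fin 2 → ℕ =>
    a 1 < (C (a 0)).size ∧ (C (a 0)).kind (a 1) = GateKind.and
  or : LinearTimeDecidable fun a : Fin 2 → ℕ =>
    a 1 < (C (a 0)).size ∧ (C (a 0)).kind (a 1) = GateKind.or
  oracle : ∀ j : Fin k, LinearTimeDecidable fun a : Fin 2 → ℕ =>
    a 1 < (C (a 0)).size ∧ (C (a 0)).kind (a 1) = GateKind.oracle j
  output : LinearTimeDecidable fun a : Fin 2 → ℕ => a 1 = (C (a 0)).output
  wire : LinearTimeDecidable fun a : Fin 3 → ℕ =>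
    a 2 < (C (a 0)).size ∧ a 1 ∈ (C (a 0)).inputs (a 2)
  port : LinearTimeDecidable fun a : Fin 4 → ℕ =>
    a 2 < (C (a 0)).size ∧ (∃ j, (C (a 0)).kind (a 2) = GateKind.oracle j) ∧
      ((C (a 0)).inputs (a 2))[a 3]? = some (a 1)

/-- `A` is `AC⁰`-reducible to `B 0, …, B (k - 1)`: it is solved by a `DLOGTIME`-uniform family of
circuits of polynomial size and constant depth with NOT-gates, unbounded fan-in AND-gates and
OR-gates, and oracle gates for the languages `B j`. -/
def AC0Reducible {k : ℕ} (A : Language Bool) (B : Fin k → Language Bool) : Prop :=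
  ∃ (C : ℕ → OracleCircuit k) (d e : ℕ),
    (∀ n, (C n).WellFormed n ∧ (C n).DepthLE d ∧ (C n).size ≤ n ^ e + e ∧
      ∀ v < (C n).size, ((C n).inputs v).length ≤ n ^ e + e) ∧
    DLogTimeUniform C ∧
    ∀ x : List Bool, (C x.length).Accepts B x ↔ x ∈ A

/-! ## Straight-line programs and the compressed word problem -/

/-- Right-hand sides of a straight-line program whose variables are named by bit strings. -/
inductive SLPRhs (α : Type) where
  | letter (a : α)
  | pair (B C : List Bool)

/-- The data of a straight-line program over the alphabet `α`: the variables with their right-hand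
sides, listed along the linear order of the variables, and the start variable. -/
structure SLP (α : Type) where
  rules : List (List Bool × SLPRhs α)
  start : List Bool

namespace SLP

variable {α : Type}

/-- Every variable has one right-hand side, only smaller variables occur in it, and the start
variable is one of the variables. -/
structure WellFormed (P : SLP α) : Prop where
  nodup : (P.rules.map Prod.fst).Nodup
  smaller : ∀ l₁ l₂ A B C, P.rules = l₁ ++ (A, SLPRhs.pair B C) :: l₂ →
    B ∈ l₁.map Prod.fst ∧ C ∈ l₁.map Prod.fst
  start_mem : P.start ∈ P.rules.map Prod.fst

/-- The words derived from the variables, computed along the list of rules. -/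
def values (P : SLP α) : List Bool → List α :=
  P.rules.foldl
    (fun val r => Function.update val r.1 <|
      match r.2 with
      | SLPRhs.letter a => [a]
      | SLPRhs.pair B C => val B ++ val C)
    fun _ => []

/-- The word that the program produces. -/
def val (P : SLP α) : List α := P.values P.start

/-- In codes, `00` and `01` stand for the symbols `0` and `1`, `10` for a comma and `11` for a
semicolon. -/
def codeString (w : List Bool) : List Bool := w.flatMap fun b => [false, b]

/-- The code of a rule: `A,a;` or `A,B,C;`. -/
def codeRule (code : α → List Bool) : List Bool × SLPRhs α → List Bool
  | (A, SLPRhs.letter a) =>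
      codeString A ++ [true, false] ++ codeString (code a) ++ [true, true]
  | (A, SLPRhs.pair B C) =>
      codeString A ++ [true, false] ++ codeString B ++ [true, false] ++ codeString C ++
        [true, true]

/-- The code of a program: its rules in their order, followed by the name of the start variable.
The letters of the alphabet are coded by `code`. -/
def encode (code : α → List Bool) (P : SLP α) : List Bool :=
  P.rules.flatMap (codeRule code) ++ codeString P.start

end SLP

/-- The letters of `Σ ∪ Σ⁻¹` for a generating set `Σ` with `r` members: `(i, false)` stands for the
`i`-th generator and `(i, true)` for its inverse. -/
abbrev GenLetter (r : ℕ) : Type := Fin r × Bool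

/-- A fixed injective code of the letters by bit strings. -/
def GenLetter.code {r : ℕ} (a : GenLetter r) : List Bool := a.2 :: List.replicate a.1 true

/-- The group element to which a word over `Σ ∪ Σ⁻¹` evaluates. -/
def evalWord {G : Type*} [Group G] {r : ℕ} (σ : Fin r → G) (w : List (GenLetter r)) : G :=
  (w.map fun a => if a.2 then (σ a.1)⁻¹ else σ a.1).prod

/-- The compressed word problem of `G` for the finite generating family `σ`: the codes of the
straight-line programs over `Σ ∪ Σ⁻¹` whose value is `1` in `G`. -/
def CWP {G : Type*} [Group G] {r : ℕ} (σ : Fin r → G) : Language Bool :=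
  { x | ∃ P : SLP (GenLetter r),
      P.WellFormed ∧ x = P.encode GenLetter.code ∧ evalWord σ P.val = 1 }

/-!
The letters of `G` act on the finite group `Q = G ⧸ H`. With a representative `q.out` of each coset,
the elements `q.out * g * (q * g).out⁻¹` of `H` form a cocycle (`cosetCocycle`), that is,
`cosetCocycle q (g * h) = cosetCocycle q g * cosetCocycle (q * g) h`. So a straight-line program for
`g` over `G` becomes one over `H` if each variable is replaced by a variable for each state `q`, and
the state in which the second factor of a rule is read is the coset of the value of the first
factor. These cosets are found with queries to `CWP(Q)`, for all variables in parallel, and then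
`g = 1` holds exactly if the coset of `g` and `cosetCocycle 1 g` are trivial, which takes one more
query to each oracle (`definable_mem_CWP`).

It remains to see that all this can be done by uniform circuits of constant depth. The circuits are
not constructed directly. Instead, membership in `CWP(G)` is expressed by a formula (`Fml`) over the
positions of the input: its variables range over the numbers below a power `N` of two that is
polynomial in the length of the input, its atoms are the bits of the input and linear equations, and
it has, besides connectives and quantifiers, an oracle operator, whose argument is the string of
length `N ^ 2` that consists of the truth values of a subformula. Here `N` may be taken as large as
needed, and predicates that are expressed by formulas are called `Definable`.

* A formula is evaluated by a circuit, whose gates are pairs of a subformula and an assignment to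
  the variables, coded by base-`N` numerals. The relations in the definition of uniformity compare
  digits of numerals of bounded length, and are decided by a finite automaton that reads all digits
  in parallel (`Automatic`). A multitape Turing machine can write each digit on a tape of its own
  and run this automaton in linear time (`Automatic.linearTimeDecidable`). Hence
  `Fml.ac0Reducible`.
* The oracle operator can only ask for strings of a fixed length `N ^ 2`, whose bits are given by a
  formula. Such a string is obtained as the code of a straight-line program in which each variable
  has a block of four rows, its name being a string with a single `1`, and in which dummy variables
  fill the gaps (`Query`, `Definable.query`).
* The transformed program begins with a sequence of products that produces the finitely many group
  elements that are needed (`exists_straightLine`). After that, block `D * i + (c₀ + q)` belongs to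
  the rule at position `i` of the input, in state `q` (`Definable.lift`).
* That a word is the code of a straight-line program, and what the rules at its positions are, is
  expressed by formulas about the segments between commas and semicolons (`SLP.isCode_iff`,
  `Definable.isCode`, `Definable.pairAt`).
-/

/-! ### Multitape machines on tapes given by functions -/

namespace DigitMachine

open Turing

/-- A tape described by its cells, at absolute positions, and the position of its head. -/
def Represents (T : Tape (Option Bool)) (f : ℤ → Option Bool) (p : ℤ) : Prop :=
  ∀ z, T.nth z = f (p + z)

/-- The displacement of a head. -/
def shift : Option Dir → ℤ
  | none => 0
  | some Dir.left => -1
  | some Dir.right => 1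

theorem Represents.act {T : Tape (Option Bool)} {f : ℤ → Option Bool} {p : ℤ}
    (h : Represents T f p) (a : Option Bool) (d : Option Dir) :
    Represents (match d with
      | none => T.write a
      | some dir => (T.write a).move dir) (Function.update f p a) (p + shift d) := by
  intro z
  rcases d with _ | _ | _
  · simp only [shift, Tape.write_nth, Function.update_apply, h z]
    split_ifs <;> first | rfl | omega | simp
  · simp only [shift, Tape.write_nth, Tape.move_left_nth, Function.update_apply, h (z - 1)]
    split_ifs <;> first | rfl | omega | (congr 1; ring)
  · simp only [shift, Tape.write_nth, Tape.move_right_nth, Function.update_apply, h (z + 1)]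
    split_ifs <;> first | rfl | omega | (congr 1; ring)

/-- The cells `0, …, t - 1` hold the lowest `t` binary digits of `y`; all other cells are blank. -/
def digitTape (y t : ℕ) (z : ℤ) : Option Bool :=
  if 0 ≤ z ∧ z < t then some (y.testBit z.toNat) else none

@[simp]
theorem digitTape_natCast (y t i : ℕ) :
    digitTape y t i = if i < t then some (y.testBit i) else none := by
  simp [digitTape]

theorem digitTape_succ (y t : ℕ) :
    Function.update (digitTape y t) t (some (y.testBit t)) = digitTape y (t + 1) := by
  funext z
  rcases eq_or_ne z t with rfl | hz
  · simp
  · rw [Function.update_of_ne hz]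
    simp only [digitTape]
    congr 1
    apply propext
    push_cast
    omega

theorem represents_mk₁ (x : ℕ) :
    Represents (Tape.mk₁ (x.bits.map some)) (digitTape x x.size) 0 := by
  intro z
  rw [zero_add]
  rcases z with z | z
  · simp only [Tape.mk₁, Tape.mk₂, Int.ofNat_eq_natCast, Tape.mk'_nth_nat, ListBlank.nth_mk,
      digitTape_natCast, List.getI_eq_getElem?_getD, List.getElem?_map, Nat.testBit_eq_inth]
    split_ifs with h
    · rw [← Nat.size_eq_bits_len] at h
      simp [h]
    · rw [← Nat.size_eq_bits_len, not_lt] at h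
      simp only [h, List.getElem?_eq_none, Option.map_none, Option.getD_none]
      rfl
  · have : digitTape x x.size (Int.negSucc z) = none := by
      simp [digitTape]
    rw [this]
    simp only [Tape.mk₁, Tape.mk₂, Tape.mk', Tape.nth, ListBlank.nth_mk]
    exact List.getI_nil _

theorem represents_nil (y : ℕ) : Represents (Tape.mk₁ []) (digitTape y 0) 0 := by
  intro z
  have : digitTape y 0 (0 + z) = none := by simp [digitTape]
  rw [this]
  refine (represents_mk₁ 0 z).trans ?_
  simp [digitTape]

/-! ### Splitting numbers into digits on a Turing machine -/

section Machine

variable (k m K : ℕ) (D : Type)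

/-- The tapes of the digit machine: `k + 1` input tapes, the ruler (`none`), and a work tape for
each of the `m` digits of each of the last `k` inputs. -/
abbrev TapeIx : Type := Fin (k + 1) ⊕ Option (Fin k × Fin m)

/-- The states of the digit machine. -/
inductive St where
  /-- copying the first input to the ruler -/
  | copy
  /-- padding the ruler with `c` zeros -/
  | pad (c : Fin (K + 1))
  /-- moving the ruler and the work tapes for digit `e - 1` back to cell `0` -/
  | back (e : Fin (m + 1))
  /-- copying the digit number `e` of the inputs to the work tapes -/
  | fwd (e : Fin m)
  /-- running the automaton on the digits -/
  | scan (q : D)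
  /-- halted; `o` tells which inputs have more than `m` digits -/
  | fin (q : D) (o : Fin k → Bool)

instance [Finite D] : Finite (St k m K D) := by
  let f : Unit ⊕ Fin (K + 1) ⊕ Fin (m + 1) ⊕ Fin m ⊕ D ⊕ (D × (Fin k → Bool)) → St k m K D
    | .inl _ => .copy
    | .inr (.inl c) => .pad c
    | .inr (.inr (.inl e)) => .back e
    | .inr (.inr (.inr (.inl e))) => .fwd e
    | .inr (.inr (.inr (.inr (.inl q)))) => .scan q
    | .inr (.inr (.inr (.inr (.inr (q, o))))) => .fin q o
  refine Finite.of_surjective f ?_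
  rintro (_ | c | e | e | q | ⟨q, o⟩)
  exacts [⟨.inl (), rfl⟩, ⟨.inr (.inl c), rfl⟩, ⟨.inr (.inr (.inl e)), rfl⟩,
    ⟨.inr (.inr (.inr (.inl e))), rfl⟩, ⟨.inr (.inr (.inr (.inr (.inl q)))), rfl⟩,
    ⟨.inr (.inr (.inr (.inr (.inr (q, o))))), rfl⟩]

variable {k m K D}

/-- The transition function of the digit machine. -/
def trans (δ : D → Bool → (Fin k × Fin m → Bool) → D) (q₀ : D) :
    St k m K D → (TapeIx k m → Option Bool) →
      Option (St k m K D × (TapeIx k m → Option Bool × Option Dir))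
  | .copy, h =>
    if h (.inl 0) = none then some (.pad (Fin.last K), fun i => (h i, none))
    else some (.copy, fun i =>
      if i = .inl 0 then (h i, some .right)
      else if i = .inr none then (h (.inl 0), some .right) else (h i, none))
  | .pad c, h =>
    if c = 0 then some (.back 0, fun i => (h i, if i = .inr none then some .left else none))
    else some (.pad ⟨c - 1, by omega⟩, fun i =>
      if i = .inr none then (some false, some .right) else (h i, none))
  | .back e, h =>
    if h (.inr none) = none then
      some (if he : (e : ℕ) < m then .fwd ⟨e, he⟩ else .scan q₀, fun i => (h i,
        match i with
        | .inl _ => none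
        | .inr none => some .right
        | .inr (some d) => if (d.2 : ℕ) + 1 = e then some .right else none))
    else some (.back e, fun i => (h i,
        match i with
        | .inl _ => none
        | .inr none => some .left
        | .inr (some d) => if (d.2 : ℕ) + 1 = e then some .left else none))
  | .fwd e, h =>
    if h (.inr none) = none then
      some (.back e.succ, fun i => (h i,
        match i with
        | .inl _ => none
        | .inr none => some .left
        | .inr (some d) => if d.2 = e then some .left else none))
    else some (.fwd e, fun i =>
        match i with
        | .inl j => (h (.inl j), if j = 0 then none else some .right)
        | .inr none => (h (.inr none), some .right)
        | .inr (some d) =>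
          if d.2 = e then (some ((h (.inl d.1.succ)).getD false), some .right)
          else (h (.inr (some d)), none))
  | .scan q, h =>
    if h (.inr none) = none then
      some (.fin q fun i => (h (.inl i.succ)).isSome, fun i => (h i, none))
    else some (.scan (δ q ((h (.inr none)).getD false) fun d => (h (.inr (some d))).getD false),
      fun i => (h i, if i.isLeft then none else some .right))
  | .fin _ _, _ => none

/-- A configuration of the digit machine, its tapes being given by functions. -/
@[ext]
structure Conf (k m K : ℕ) (D : Type) where
  st : St k m K D
  cell : TapeIx k m → ℤ → Option Bool
  pos : TapeIx k m → ℤ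

/-- One step on configurations given by functions. -/
def adv (δ : D → Bool → (Fin k × Fin m → Bool) → D) (q₀ : D) (c : Conf k m K D) : Conf k m K D :=
  match trans δ q₀ c.st fun i => c.cell i (c.pos i) with
  | none => c
  | some a =>
    { st := a.1
      cell := fun i => Function.update (c.cell i) (c.pos i) (a.2 i).1
      pos := fun i => c.pos i + shift (a.2 i).2 }

/-- A configuration of the shape that occurs in a run on input `x`: input tape `0` is at `p₀`, the
others are at `p₁`, the ruler holds `t` digits and is at `r`, and the work tapes for digit `e` hold
`w e` digits and are at `pw e`; a digit has `l` bits. -/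
def conf (l : ℕ) (x : Fin (k + 1) → ℕ) (s : St k m K D) (p₀ p₁ : ℤ) (t : ℕ) (r : ℤ)
    (w : Fin m → ℕ) (pw : Fin m → ℤ) : Conf k m K D where
  st := s
  cell
    | .inl i => digitTape (x i) (x i).size
    | .inr none => digitTape (x 0) t
    | .inr (some d) => digitTape (x d.1.succ / 2 ^ (d.2 * l)) (w d.2)
  pos
    | .inl i => if i = 0 then p₀ else p₁
    | .inr none => r
    | .inr (some d) => pw d.2

section Run

variable (δ : D → Bool → (Fin k × Fin m → Bool) → D) (q₀ : D) (x : Fin (k + 1) → ℕ)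

theorem getD_digitTape (y : ℕ) (i : ℕ) : (digitTape y y.size i).getD false = y.testBit i := by
  rw [digitTape_natCast]
  split_ifs with h
  · rfl
  · have : y < 2 ^ i := Nat.size_le.1 (not_lt.1 h)
    simp [Nat.testBit_lt_two_pow this]

theorem isSome_digitTape (y : ℕ) (i : ℕ) : (digitTape y y.size i).isSome = decide (2 ^ i ≤ y) := by
  rw [digitTape_natCast]
  split_ifs with h
  · simp [Nat.lt_size.1 h]
  · simp only [Option.isSome_none]
    have : y < 2 ^ i := Nat.size_le.1 (not_lt.1 h)
    simp [this]

theorem adv_copy {l t : ℕ} (ht : t < (x 0).size) :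
    adv δ q₀ (conf (K := K) l x .copy t 0 t t (fun _ => 0) fun _ => 0) =
      conf l x .copy (t + 1 : ℕ) 0 (t + 1) (t + 1 : ℕ) (fun _ => 0) fun _ => 0 := by
  have h : digitTape (x 0) (x 0).size t = some ((x 0).testBit t) := by simp [ht]
  simp only [adv, trans, conf, if_true, h, reduceCtorEq, if_false]
  ext1
  · rfl
  · funext i
    rcases i with i | _ | d
    · rcases eq_or_ne i 0 with rfl | hi
      · simp only [if_true, ← h, Function.update_eq_self]
      · simp [hi]
    · simp [digitTape_succ]
    · simp
  · funext i
    rcases i with i | _ | d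
    · rcases eq_or_ne i 0 with rfl | hi
      · simp [shift]
      · simp [hi, shift]
    · simp [shift]
    · simp [shift]

theorem adv_copy_end {l : ℕ} :
    adv δ q₀ (conf (K := K) l x .copy (x 0).size 0 (x 0).size (x 0).size (fun _ => 0) fun _ => 0) =
      conf l x (.pad (Fin.last K)) (x 0).size 0 (x 0).size (x 0).size (fun _ => 0) fun _ => 0 := by
  have h : digitTape (x 0) (x 0).size (x 0).size = none := by simp
  simp only [adv, trans, conf, if_true, h]
  ext1
  · rfl
  · funext i
    simp
  · funext i
    simp [shift]

theorem adv_pad {l t : ℕ} (ht : (x 0).size ≤ t) (c : ℕ) (hc : c + 1 < K + 1) :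
    adv δ q₀ (conf l x (.pad (⟨c + 1, hc⟩ : Fin (K + 1))) (x 0).size 0 t t (fun _ => 0)
        fun _ => 0) =
      conf l x (.pad ⟨c, by omega⟩) (x 0).size 0 (t + 1) (t + 1 : ℕ) (fun _ => 0) fun _ => 0 := by
  have h : (x 0).testBit t = false := Nat.testBit_lt_two_pow (Nat.size_le.1 ht)
  simp only [adv, trans, conf, Fin.mk_eq_zero, Nat.add_eq_zero_iff, one_ne_zero, and_false,
    if_false]
  ext1
  · rfl
  · funext i
    rcases i with i | _ | d
    · simp
    · simp [← h, digitTape_succ]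
    · simp
  · funext i
    rcases i with i | _ | d <;> simp [shift]

theorem adv_pad_end {l t : ℕ} :
    adv δ q₀ (conf (K := K) l x (.pad 0) (x 0).size 0 t t (fun _ => 0) fun _ => 0) =
      conf l x (.back 0) (x 0).size 0 t (t - 1 : ℤ) (fun _ => 0) fun _ => 0 := by
  simp only [adv, trans, conf, if_true]
  ext1
  · rfl
  · funext i
    simp
  · funext i
    rcases i with i | _ | d <;> simp [shift, sub_eq_add_neg]

/-- The head positions of the work tapes while those for digit `e - 1` are moved back. -/
def backPos (e : ℕ) (z : ℤ) (d : Fin m) : ℤ := if (d : ℕ) + 1 = e then z else 0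

/-- The number of digits on the work tapes when `e` digits of each input have been copied. -/
def filled (l e : ℕ) (d : Fin m) : ℕ := if (d : ℕ) < e then l else 0

theorem adv_back {l : ℕ} (e : Fin (m + 1)) {p₁ : ℤ} {z : ℕ} (hz : z < l) (w : Fin m → ℕ) :
    adv δ q₀ (conf (K := K) l x (.back e) (x 0).size p₁ l z w (backPos e z)) =
      conf l x (.back e) (x 0).size p₁ l (z - 1 : ℤ) w (backPos e (z - 1)) := by
  have h : digitTape (x 0) l z ≠ none := by simp [hz]
  simp only [adv, trans, conf, h, if_false]
  ext1
  · rfl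
  · funext i
    simp
  · funext i
    rcases i with i | _ | d
    · simp [shift]
    · simp [shift, sub_eq_add_neg]
    · simp only [backPos]
      split_ifs <;> simp [shift, sub_eq_add_neg]

theorem adv_back_end {l : ℕ} (e : Fin (m + 1)) {p₁ : ℤ} (w : Fin m → ℕ) :
    adv δ q₀ (conf (K := K) l x (.back e) (x 0).size p₁ l (-1) w (backPos e (-1))) =
      conf l x (if he : (e : ℕ) < m then .fwd ⟨e, he⟩ else .scan q₀) (x 0).size p₁ l 0 w
        (fun _ => 0) := by
  have h : digitTape (x 0) l (-1) = none := by simp [digitTape]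
  simp only [adv, trans, conf, h, if_true]
  ext1
  · rfl
  · funext i
    simp
  · funext i
    rcases i with i | _ | d
    · simp [shift]
    · simp [shift]
    · simp only [backPos]
      split_ifs <;> simp [shift]

/-- The number of digits on the work tapes when `e` digits of each input and `t` bits of the next
one have been copied. -/
def partly (l e t : ℕ) (d : Fin m) : ℕ := if (d : ℕ) < e then l else if (d : ℕ) = e then t else 0

theorem adv_fwd {l : ℕ} (e : Fin m) {t : ℕ} (ht : t < l) :
    adv δ q₀ (conf (K := K) l x (.fwd e) (x 0).size (e * l + t : ℕ) l t (partly l e t)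
        fun d => if d = e then t else 0) =
      conf l x (.fwd e) (x 0).size (e * l + (t + 1) : ℕ) l (t + 1 : ℕ) (partly l e (t + 1))
        fun d => if d = e then (t + 1 : ℕ) else 0 := by
  have h : digitTape (x 0) l t ≠ none := by simp [ht]
  simp only [adv, trans, conf, h, if_false]
  ext1
  · rfl
  · funext i
    rcases i with i | _ | d
    · simp
    · simp
    · by_cases hd : d.2 = e
      · have h1 : (digitTape (x d.1.succ) (x d.1.succ).size ((e * l + t : ℕ) : ℤ)).getD false
            = (x d.1.succ / 2 ^ ((e : ℕ) * l)).testBit t := by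
          rw [getD_digitTape, Nat.testBit_div_two_pow, add_comm]
        simp only [hd, partly, lt_irrefl, if_false, if_true, Fin.succ_ne_zero]
        rw [h1, digitTape_succ]
      · have hd' : (d.2 : ℕ) ≠ e := fun h => hd (Fin.ext h)
        simp [hd, hd', partly]
  · funext i
    rcases i with i | _ | d
    · rcases eq_or_ne i 0 with rfl | hi
      · simp [shift]
      · simp [hi, shift, add_assoc]
    · simp [shift]
    · by_cases hd : d.2 = e <;> simp [hd, shift]

theorem adv_fwd_end {l : ℕ} (e : Fin m) {p₁ : ℤ} (w : Fin m → ℕ) :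
    adv δ q₀ (conf (K := K) l x (.fwd e) (x 0).size p₁ l l w fun d => if d = e then l else 0) =
      conf l x (.back e.succ) (x 0).size p₁ l (l - 1 : ℤ) w (backPos e.succ (l - 1)) := by
  have h : digitTape (x 0) l l = none := by simp
  simp only [adv, trans, conf, h, if_true]
  ext1
  · rfl
  · funext i
    simp
  · funext i
    rcases i with i | _ | d
    · simp [shift]
    · simp [shift, sub_eq_add_neg]
    · by_cases hd : d.2 = e
      · simp [hd, backPos, shift, sub_eq_add_neg]
      · have hd' : (d.2 : ℕ) ≠ e := fun h => hd (Fin.ext h)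
        simp [hd, hd', backPos, shift]

theorem adv_scan {l : ℕ} (q : D) {p₁ : ℤ} {t : ℕ} (ht : t < l) :
    adv δ q₀ (conf (K := K) l x (.scan q) (x 0).size p₁ l t (fun _ => l) fun _ => t) =
      conf l x (.scan (δ q ((x 0).testBit t) fun d => (x d.1.succ / 2 ^ (d.2 * l)).testBit t))
        (x 0).size p₁ l (t + 1 : ℕ) (fun _ => l) fun _ => (t + 1 : ℕ) := by
  have h : digitTape (x 0) l t ≠ none := by simp [ht]
  simp only [adv, trans, conf, h, if_false]
  ext1
  · simp [ht]
  · funext i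
    simp
  · funext i
    rcases i with i | _ | d <;> simp [shift]

theorem adv_scan_end {l p : ℕ} (q : D) :
    adv δ q₀ (conf (K := K) l x (.scan q) (x 0).size p l l (fun _ => l) fun _ => l) =
      conf l x (.fin q fun i => decide (2 ^ p ≤ x i.succ)) (x 0).size p l l (fun _ => l)
        fun _ => l := by
  have h : digitTape (x 0) l l = none := by simp
  simp only [adv, trans, conf, h, if_true]
  ext1
  · simp [isSome_digitTape, -digitTape_natCast]
  · funext i
    simp
  · funext i
    simp [shift]

theorem adv_fin {l p : ℕ} (q : D) (o) (w pw) (t r) :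
    adv δ q₀ (conf (K := K) l x (.fin q o) (x 0).size p t r w pw) =
      conf l x (.fin q o) (x 0).size p t r w pw := by
  simp [adv, trans, conf]

end Run
end Machine
end DigitMachine

namespace DigitMachine

open Turing

section Run

variable {k m K : ℕ} {D : Type} (δ : D → Bool → (Fin k × Fin m → Bool) → D) (q₀ : D)
  (x : Fin (k + 1) → ℕ)

theorem iterate_eq_of_forall_lt {α : Type*} {f : α → α} (c : ℕ → α) (n : ℕ)
    (h : ∀ t < n, f (c t) = c (t + 1)) : f^[n] (c 0) = c n := by
  induction n with
  | zero => rfl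
  | succ n ih =>
    rw [Function.iterate_succ_apply', ih fun t ht => h t (by omega), h n (by omega)]

theorem iterate_trans {α : Type*} {f : α → α} {a b c : α} {s t : ℕ} (h₁ : f^[s] a = b)
    (h₂ : f^[t] b = c) : f^[s + t] a = c := by
  rw [add_comm, Function.iterate_add_apply, h₁, h₂]

theorem iterate_trans_one {α : Type*} {f : α → α} {a b c : α} {s : ℕ} (h₁ : f^[s] a = b)
    (h₂ : f b = c) : f^[s + 1] a = c := by
  rw [Function.iterate_succ_apply', h₁, h₂]

theorem iterate_copy (l : ℕ) :
    (adv δ q₀)^[(x 0).size + 1] (conf (K := K) l x .copy 0 0 0 0 (fun _ => 0) fun _ => 0) =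
      conf l x (.pad (Fin.last K)) (x 0).size 0 (x 0).size (x 0).size (fun _ => 0) fun _ => 0 := by
  refine iterate_trans_one ?_ (adv_copy_end δ q₀ x)
  exact iterate_eq_of_forall_lt
    (fun t => conf (K := K) l x .copy t 0 t t (fun _ => 0) fun _ => 0) _
    fun t ht => adv_copy δ q₀ x ht

theorem iterate_pad (l : ℕ) :
    (adv δ q₀)^[K + 1] (conf (K := K) l x (.pad (Fin.last K)) (x 0).size 0 (x 0).size (x 0).size
        (fun _ => 0) fun _ => 0) =
      conf l x (.back 0) (x 0).size 0 ((x 0).size + K) (((x 0).size + K : ℕ) - 1 : ℤ)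
        (fun _ => 0) fun _ => 0 := by
  refine iterate_trans_one ?_ (adv_pad_end δ q₀ x)
  have := iterate_eq_of_forall_lt (f := adv δ q₀)
    (fun t => conf l x (.pad (⟨K - t, by omega⟩ : Fin (K + 1))) (x 0).size 0 ((x 0).size + t)
      ((x 0).size + t : ℕ) (fun _ => 0) fun _ => 0) K fun t ht => by
    obtain ⟨c, hc⟩ : ∃ c, K - t = c + 1 := ⟨K - t - 1, by omega⟩
    have hc' : K - (t + 1) = c := by omega
    simp only [hc, hc']
    exact adv_pad δ q₀ x (Nat.le_add_right _ t) c (by omega)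
  simp only [Nat.sub_self] at this
  exact this

theorem iterate_back (l : ℕ) (e : Fin (m + 1)) (p₁ : ℤ) (w : Fin m → ℕ) :
    (adv δ q₀)^[l + 1] (conf (K := K) l x (.back e) (x 0).size p₁ l (l - 1 : ℤ) w
        (backPos e (l - 1 : ℤ))) =
      conf l x (if he : (e : ℕ) < m then .fwd ⟨e, he⟩ else .scan q₀) (x 0).size p₁ l 0 w
        (fun _ => 0) := by
  refine iterate_trans_one ?_ (adv_back_end δ q₀ x e w)
  have := iterate_eq_of_forall_lt (f := adv δ q₀)
    (fun t => conf (K := K) l x (.back e) (x 0).size p₁ l (l - 1 - t : ℤ) w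
      (backPos e (l - 1 - t : ℤ))) l fun t ht => by
    obtain ⟨c, hc⟩ : ∃ c : ℕ, (l - 1 - t : ℤ) = c := ⟨l - 1 - t, by omega⟩
    have hc' : (l - 1 - (t + 1 : ℕ) : ℤ) = c - 1 := by push_cast; omega
    simp only [hc, hc']
    exact adv_back δ q₀ x e (by omega) w
  have h1 : (l - 1 - l : ℤ) = -1 := by ring
  simpa only [h1, Nat.cast_zero, sub_zero] using this

theorem partly_zero (l e : ℕ) : partly (m := m) l e 0 = filled l e := by
  funext d
  simp [partly, filled]

theorem partly_full (l e : ℕ) : partly (m := m) l e l = filled l (e + 1) := by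
  funext d
  simp only [partly, filled]
  split_ifs <;> omega

theorem iterate_fwd (l : ℕ) (e : Fin m) :
    (adv δ q₀)^[l + 1] (conf (K := K) l x (.fwd e) (x 0).size (e * l : ℕ) l 0 (filled l e)
        (fun _ => 0)) =
      conf l x (.back e.succ) (x 0).size ((e + 1) * l : ℕ) l (l - 1 : ℤ) (filled l (e + 1))
        (backPos e.succ (l - 1)) := by
  rw [add_one_mul, ← partly_full]
  refine iterate_trans_one ?_ (adv_fwd_end δ q₀ x e _)
  have := iterate_eq_of_forall_lt (f := adv δ q₀)
    (fun t => conf (K := K) l x (.fwd e) (x 0).size (e * l + t : ℕ) l t (partly l e t)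
      fun d => if d = e then (t : ℤ) else 0) l fun t ht => adv_fwd δ q₀ x e ht
  simpa only [partly_zero, Nat.cast_zero, ite_self, add_zero] using this

theorem iterate_split (l e : ℕ) (he : e ≤ m) :
    (adv δ q₀)^[e * (2 * (l + 1))] (conf (K := K) l x
        (if he : 0 < m then .fwd ⟨0, he⟩ else .scan q₀) (x 0).size (0 : ℕ) l 0 (filled l 0)
        (fun _ => 0)) =
      conf l x (if he : e < m then .fwd ⟨e, he⟩ else .scan q₀) (x 0).size (e * l : ℕ) l 0
        (filled l e) (fun _ => 0) := by
  induction e with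
  | zero => simp
  | succ e ih =>
    rw [add_one_mul]
    refine iterate_trans (ih (by omega)) ?_
    rw [dif_pos (by omega : e < m), two_mul]
    exact iterate_trans (iterate_fwd δ q₀ x l ⟨e, by omega⟩) (iterate_back δ q₀ x l _ _ _)

/-- The state of the automaton after it has read the lowest `t` bits of `x 0` and of all digits. -/
def autRun (l : ℕ) : ℕ → D
  | 0 => q₀
  | t + 1 => δ (autRun l t) ((x 0).testBit t) fun d => (x d.1.succ / 2 ^ (d.2 * l)).testBit t

theorem iterate_scan (l : ℕ) (p : ℕ) :
    (adv δ q₀)^[l + 1] (conf (K := K) l x (.scan q₀) (x 0).size p l 0 (fun _ => l)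
        (fun _ => 0)) =
      conf l x (.fin (autRun δ q₀ x l l) fun i => decide (2 ^ p ≤ x i.succ)) (x 0).size p l l
        (fun _ => l) fun _ => l := by
  refine iterate_trans_one ?_ (adv_scan_end δ q₀ x _)
  exact iterate_eq_of_forall_lt (f := adv δ q₀)
    (fun t => conf (K := K) l x (.scan (autRun δ q₀ x l t)) (x 0).size p l t (fun _ => l)
      fun _ => t) l fun t ht => adv_scan δ q₀ x _ ht

theorem iterate_all {l : ℕ} (hl : l = (x 0).size + K) :
    (adv δ q₀)^[(x 0).size + 1 + (K + 1) + (l + 1) + m * (2 * (l + 1)) + (l + 1)]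
        (conf (K := K) l x .copy 0 0 0 0 (fun _ => 0) fun _ => 0) =
      conf l x (.fin (autRun δ q₀ x l l) fun i => decide (2 ^ (m * l) ≤ x i.succ)) (x 0).size
        (m * l : ℕ) l l (fun _ => l) fun _ => l := by
  have h0 : (fun _ : Fin m => (0 : ℤ)) = backPos ((0 : Fin (m + 1)) : ℕ) (l - 1 : ℤ) := by
    funext d
    simp [backPos]
  refine iterate_trans (iterate_trans (iterate_trans (iterate_trans (iterate_copy δ q₀ x l)
    (iterate_pad δ q₀ x l)) ?_) (iterate_split δ q₀ x l m le_rfl)) ?_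
  · rw [h0, ← hl]
    have hf : (fun _ : Fin m => 0) = filled l 0 := by
      funext d
      simp [filled]
    rw [hf]
    exact iterate_back δ q₀ x l 0 0 _
  · rw [dif_neg (lt_irrefl m)]
    have hf : (filled l m : Fin m → ℕ) = fun _ => l := by
      funext d
      simp [filled]
    rw [hf]
    exact iterate_scan δ q₀ x l (m * l)

end Run

section Simulation

variable {k m K : ℕ} {D : Type} (δ : D → Bool → (Fin k × Fin m → Bool) → D) (q₀ : D)

/-- The numbering of the tapes of the digit machine. -/
noncomputable def tapeEquiv (k m : ℕ) :
    Fin (k + 1) ⊕ Fin (Fintype.card (Option (Fin k × Fin m))) ≃ TapeIx k m :=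
  Equiv.sumCongr (Equiv.refl _) (Fintype.equivFin _).symm

/-- The multitape Turing machine that splits its inputs into digits and runs an automaton. -/
noncomputable abbrev machine [Finite D] (K : ℕ) (acc : Set (D × (Fin k → Bool))) :
    MultitapeTM (k + 1) where
  work := Fintype.card (Option (Fin k × Fin m))
  State := St k m K D
  finite_state := inferInstance
  start := .copy
  accept := {s | ∃ q o, s = .fin q o ∧ (q, o) ∈ acc}
  trans s h := (trans δ q₀ s (h ∘ (tapeEquiv k m).symm)).map fun a => (a.1, a.2 ∘ tapeEquiv k m)

variable [Finite D] (acc : Set (D × (Fin k → Bool)))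

/-- A configuration of the machine and one given by functions that describes it. -/
structure Simulates (c : (machine δ q₀ K acc).Cfg) (C : Conf k m K D) : Prop where
  st : c.state = C.st
  tape : ∀ i, Represents (c.tape i) (C.cell (tapeEquiv k m i)) (C.pos (tapeEquiv k m i))

variable {δ q₀ acc}

theorem Simulates.step_eq {c : (machine δ q₀ K acc).Cfg} {C : Conf k m K D}
    (h : Simulates δ q₀ acc c C) :
    (machine δ q₀ K acc).step c =
      (trans δ q₀ C.st fun i => C.cell i (C.pos i)).map fun a =>
        { state := a.1
          tape := fun i =>
            match (a.2 (tapeEquiv k m i)).2 with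
            | none => (c.tape i).write (a.2 (tapeEquiv k m i)).1
            | some dir => ((c.tape i).write (a.2 (tapeEquiv k m i)).1).move dir } := by
  have h1 : ((fun i => (c.tape i).head) ∘ (tapeEquiv k m).symm) =
      fun i => C.cell i (C.pos i) := by
    funext i
    have := h.tape ((tapeEquiv k m).symm i) 0
    rw [Equiv.apply_symm_apply] at this
    simpa using this
  change ((trans δ q₀ c.state _).map _).map _ = _
  rw [h1, h.st, Option.map_map]
  rfl

theorem Simulates.adv {c : (machine δ q₀ K acc).Cfg} {C : Conf k m K D}
    (h : Simulates δ q₀ acc c C) :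
    Simulates δ q₀ acc (((machine δ q₀ K acc).step c).getD c) (adv δ q₀ C) := by
  rw [h.step_eq, DigitMachine.adv]
  rcases trans δ q₀ C.st fun i => C.cell i (C.pos i) with _ | a
  · exact h
  · exact ⟨rfl, fun i => (h.tape i).act _ _⟩

theorem Simulates.iterate {c : (machine δ q₀ K acc).Cfg} {C : Conf k m K D}
    (h : Simulates δ q₀ acc c C) (t : ℕ) :
    Simulates δ q₀ acc ((fun c => ((machine δ q₀ K acc).step c).getD c)^[t] c)
      ((DigitMachine.adv δ q₀)^[t] C) := by
  induction t with
  | zero => exact h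
  | succ t ih =>
    rw [Function.iterate_succ_apply', Function.iterate_succ_apply']
    exact ih.adv

theorem simulates_init (x : Fin (k + 1) → ℕ) (l : ℕ) :
    Simulates δ q₀ acc ((machine δ q₀ K acc).init x)
      (conf l x .copy 0 0 0 0 (fun _ => 0) fun _ => 0) := by
  refine ⟨rfl, ?_⟩
  rintro (i | i)
  · have : (conf (m := m) (K := K) (D := D) l x .copy 0 0 0 0 (fun _ => 0) fun _ => 0).pos
        (tapeEquiv k m (.inl i)) = 0 := by
      simp [conf, tapeEquiv]
    rw [this]
    exact represents_mk₁ (x i)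
  · obtain ⟨j, hj⟩ : ∃ j, tapeEquiv k m (.inr i) = .inr j := ⟨_, rfl⟩
    rw [hj]
    rcases j with _ | d
    exacts [represents_nil _, represents_nil _]

end Simulation
end DigitMachine

/-- The relation `R` on `k + 1` numbers is recognized by a finite automaton as follows. Let `l` be
the number of binary digits of the first number plus `K`. The automaton reads synchronously, lowest
bits first, the `l` bits of the first number and of each of the `m` lowest base-`2 ^ l` digits of
each other number. At the end, it is told which numbers have more than `m` digits. -/
def Automatic {k : ℕ} (m K : ℕ) (R : (Fin (k + 1) → ℕ) → Prop) : Prop :=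
  ∃ (D : Type) (_ : Finite D) (δ : D → Bool → (Fin k × Fin m → Bool) → D) (q₀ : D)
    (acc : Set (D × (Fin k → Bool))), ∀ x, R x ↔
      (DigitMachine.autRun δ q₀ x ((x 0).size + K) ((x 0).size + K),
        fun i => decide (2 ^ (m * ((x 0).size + K)) ≤ x (Fin.succ i))) ∈ acc

open DigitMachine in
/-- A multitape machine has time to split its inputs into digits, each on a tape of its own, since
there are constantly many of them; then all heads can be moved in step with the automaton. -/
theorem Automatic.linearTimeDecidable {k m K : ℕ} {R : (Fin (k + 1) → ℕ) → Prop}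
    (h : Automatic m K R) : LinearTimeDecidable R := by
  obtain ⟨D, _, δ, q₀, acc, hR⟩ := h
  refine ⟨machine δ q₀ K acc, (2 * m + 4) * (K + 2), fun x => ?_⟩
  set l := (x 0).size + K with hl
  obtain ⟨s, hs⟩ : ∃ s, (2 * m + 4) * (K + 2) * ∑ i, (x i).size + (2 * m + 4) * (K + 2) =
      (x 0).size + 1 + (K + 1) + (l + 1) + m * (2 * (l + 1)) + (l + 1) + s := by
    apply Nat.exists_eq_add_of_le
    have h1 : (x 0).size ≤ ∑ i, (x i).size :=
      Finset.single_le_sum (f := fun i => (x i).size) (fun _ _ => Nat.zero_le _)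
        (Finset.mem_univ 0)
    have h2 : l + 1 ≤ (K + 2) * (∑ i, (x i).size) + (K + 2) := by
      rw [hl]; nlinarith
    calc _ = l + 2 + 2 * ((m + 1) * (l + 1)) := by rw [hl]; ring
      _ ≤ (2 * m + 4) * (l + 1) := by nlinarith
      _ ≤ (2 * m + 4) * ((K + 2) * (∑ i, (x i).size) + (K + 2)) := Nat.mul_le_mul_left _ h2
      _ = _ := by ring
  have hsim := (simulates_init (δ := δ) (q₀ := q₀) (K := K) (acc := acc) x l).iterate
    ((2 * m + 4) * (K + 2) * ∑ i, (x i).size + (2 * m + 4) * (K + 2))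
  rw [hs, iterate_trans (iterate_all δ q₀ x hl)
      (Function.iterate_fixed (adv_fin δ q₀ x _ _ _ _ _ _) s),
    ← hs] at hsim
  constructor
  · exact hsim.step_eq
  · rw [MultitapeTM.run, hsim.st, hR]
    constructor
    · rintro ⟨q, o, hqo, hacc⟩
      cases hqo
      exact hacc
    · intro hacc
      exact ⟨_, _, rfl, hacc⟩

/-! ### Relations recognized by automata -/

namespace DigitMachine

/-- The numbers that an automaton sees: the first number (`none`), and the base-`2 ^ l` digits of
the others, where `l` is the number of binary digits of the first number plus `K`. -/
def term {k m : ℕ} (K : ℕ) (x : Fin (k + 1) → ℕ) : Option (Fin k × Fin m) → ℕ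
  | none => x 0
  | some d => x d.1.succ / 2 ^ (d.2 * ((x 0).size + K)) % 2 ^ ((x 0).size + K)

theorem term_lt {k m : ℕ} (K : ℕ) (x : Fin (k + 1) → ℕ) (p : Option (Fin k × Fin m)) :
    term K x p < 2 ^ ((x 0).size + K) := by
  rcases p with _ | d
  · exact (Nat.lt_size_self _).trans_le (Nat.pow_le_pow_right (by norm_num) (Nat.le_add_right _ _))
  · exact Nat.mod_lt _ (by positivity)

/-- The state of an automaton that has read the letters `f 0, …, f (t - 1)`. -/
def letterRun {D A : Type*} (δ : D → A → D) (q₀ : D) (f : ℕ → A) : ℕ → D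
  | 0 => q₀
  | t + 1 => δ (letterRun δ q₀ f t) (f t)

theorem autRun_eq_letterRun {k m K : ℕ} {D : Type} (δ : D → (Option (Fin k × Fin m) → Bool) → D)
    (q₀ : D) (x : Fin (k + 1) → ℕ) {t : ℕ} (ht : t ≤ (x 0).size + K) :
    autRun (fun q b h => δ q fun p => p.elim b h) q₀ x ((x 0).size + K) t =
      letterRun δ q₀ (fun t p => (term K x p).testBit t) t := by
  induction t with
  | zero => rfl
  | succ t ih =>
    simp only [autRun, letterRun]
    rw [ih (by omega)]
    congr 1
    funext p
    rcases p with _ | d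
    · rfl
    · simp only [Option.elim_some, term, Nat.testBit_mod_two_pow]
      rw [decide_eq_true (by omega : t < (x 0).size + K), Bool.true_and]

end DigitMachine

open DigitMachine

namespace Automatic

variable {k m K : ℕ}

theorem of_letterRun {R : (Fin (k + 1) → ℕ) → Prop} {D : Type} [Finite D]
    (δ : D → (Option (Fin k × Fin m) → Bool) → D) (q₀ : D) (acc : Set D)
    (h : ∀ x, R x ↔ letterRun δ q₀ (fun t p => (term K x p).testBit t) ((x 0).size + K) ∈ acc) :
    Automatic m K R := by
  refine ⟨D, inferInstance, fun q b h => δ q fun p => p.elim b h, q₀, {a | a.1 ∈ acc}, fun x => ?_⟩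
  rw [h, Set.mem_ofPred_eq, autRun_eq_letterRun δ q₀ x le_rfl]

/-- Boolean combinations of automatic relations are automatic: the automata run in parallel. -/
theorem combine {ι : Type} [Finite ι] {R : ι → (Fin (k + 1) → ℕ) → Prop}
    (h : ∀ i, Automatic m K (R i)) (Φ : (ι → Prop) → Prop) :
    Automatic m K fun x => Φ fun i => R i x := by
  choose D _ δ q₀ acc h using h
  refine ⟨∀ i, D i, inferInstance, fun q b f i => δ i (q i) b f, q₀,
    {a | Φ fun i => (a.1 i, a.2) ∈ acc i}, fun x => ?_⟩
  have hrun : ∀ l t, autRun (fun (q : ∀ i, D i) b f i => δ i (q i) b f) q₀ x l t =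
      fun i => autRun (δ i) (q₀ i) x l t := by
    intro l t
    induction t with
    | zero => rfl
    | succ t ih => simp only [autRun, ih]
  simp only [Set.mem_ofPred_eq, hrun]
  simp only [h]

theorem const (p : Prop) : Automatic m K fun _ : Fin (k + 1) → ℕ => p :=
  combine (ι := Empty) (R := fun i => i.elim) (fun i => i.elim) fun _ => p

theorem not {R : (Fin (k + 1) → ℕ) → Prop} (h : Automatic m K R) :
    Automatic m K fun x => ¬ R x :=
  combine (ι := Unit) (fun _ => h) fun p => ¬ p ()

theorem and {R S : (Fin (k + 1) → ℕ) → Prop} (hR : Automatic m K R) (hS : Automatic m K S) :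
    Automatic m K fun x => R x ∧ S x :=
  combine (ι := Bool) (R := fun b => if b then R else S) (fun b => by cases b <;> simpa)
    fun p => p true ∧ p false

theorem or {R S : (Fin (k + 1) → ℕ) → Prop} (hR : Automatic m K R) (hS : Automatic m K S) :
    Automatic m K fun x => R x ∨ S x :=
  combine (ι := Bool) (R := fun b => if b then R else S) (fun b => by cases b <;> simpa)
    fun p => p true ∨ p false

theorem exists_fin {ι : Type} [Finite ι] {R : ι → (Fin (k + 1) → ℕ) → Prop}
    (h : ∀ i, Automatic m K (R i)) : Automatic m K fun x => ∃ i, R i x :=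
  combine h fun p => ∃ i, p i

theorem forall_fin {ι : Type} [Finite ι] {R : ι → (Fin (k + 1) → ℕ) → Prop}
    (h : ∀ i, Automatic m K (R i)) : Automatic m K fun x => ∀ i, R i x :=
  combine h fun p => ∀ i, p i

theorem le_of_carry {c c' d : ℕ} {A B C : ℕ} {t : ℕ} {a : ℤ}
    (h : (c * (A % 2 ^ t : ℕ) + c' * (B % 2 ^ t : ℕ) + d : ℤ) = (C % 2 ^ t : ℕ) + a * 2 ^ t) :
    a ≤ c + c' + d := by
  have hA : ((A % 2 ^ t : ℕ) : ℤ) ≤ 2 ^ t := by exact_mod_cast (Nat.mod_lt A (by positivity)).le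
  have hB : ((B % 2 ^ t : ℕ) : ℤ) ≤ 2 ^ t := by exact_mod_cast (Nat.mod_lt B (by positivity)).le
  have hC : (0 : ℤ) ≤ (C % 2 ^ t : ℕ) := by positivity
  have h1 : (1 : ℤ) ≤ 2 ^ t := by exact_mod_cast Nat.one_le_two_pow
  have h2 : (0 : ℤ) < 2 ^ t := by positivity
  refine le_of_mul_le_mul_right ?_ h2
  have e1 := mul_le_mul_of_nonneg_left hA (Int.natCast_nonneg c)
  have e2 := mul_le_mul_of_nonneg_left hB (Int.natCast_nonneg c')
  have e3 := mul_le_mul_of_nonneg_left h1 (Int.natCast_nonneg d)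
  nlinarith

theorem mod_two_pow_succ (A t : ℕ) :
    A % 2 ^ (t + 1) = A % 2 ^ t + 2 ^ t * (A.testBit t).toNat := by
  rw [Nat.mod_pow_succ, Nat.toNat_testBit]

theorem mod_two_pow_succ' (A t : ℕ) :
    ((A % 2 ^ (t + 1) : ℕ) : ℤ) = (A % 2 ^ t : ℕ) + 2 ^ t * ((A.testBit t).toNat : ℕ) := by
  rw [mod_two_pow_succ]
  push_cast
  ring

/-- Linear equations are automatic. The state of the automaton is the carry, or `none` if the
equation has failed at an earlier bit. -/
theorem linear (c c' d : ℕ) (p p' p'' : Option (Fin k × Fin m)) :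
    Automatic m K fun x => c * term K x p + c' * term K x p' + d = term K x p'' := by
  let δ : Option (Fin (c + c' + d + 1)) → (Option (Fin k × Fin m) → Bool) →
      Option (Fin (c + c' + d + 1)) := fun q h => q.bind fun a =>
    if (c * (h p).toNat + c' * (h p').toNat + a) % 2 = (h p'').toNat then
      some ⟨min ((c * (h p).toNat + c' * (h p').toNat + a) / 2) (c + c' + d), by omega⟩ else none
  refine of_letterRun δ (some ⟨d, by omega⟩) {some 0} fun x => ?_
  set f : ℕ → Option (Fin k × Fin m) → Bool := fun t p => (term K x p).testBit t with hf
  set A := term K x p with hA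
  set B := term K x p' with hB
  set C := term K x p'' with hC
  have inv : ∀ t, (∃ a, letterRun δ (some ⟨d, by omega⟩) f t = some a ∧
      (c * (A % 2 ^ t : ℕ) + c' * (B % 2 ^ t : ℕ) + d : ℤ) = (C % 2 ^ t : ℕ) + a * 2 ^ t) ∨
      (letterRun δ (some ⟨d, by omega⟩) f t = none ∧ ∀ a : ℤ,
      (c * (A % 2 ^ t : ℕ) + c' * (B % 2 ^ t : ℕ) + d : ℤ) ≠ (C % 2 ^ t : ℕ) + a * 2 ^ t) := by
    intro t
    induction t with
    | zero => exact .inl ⟨_, rfl, by simp [Nat.mod_one]⟩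
    | succ t ih =>
      simp only [mod_two_pow_succ']
      rcases ih with ⟨a, h, e⟩ | ⟨h, e⟩
      · have hs : letterRun δ (some ⟨d, by omega⟩) f (t + 1) =
            if (c * (A.testBit t).toNat + c' * (B.testBit t).toNat + a) % 2 = (C.testBit t).toNat
            then some ⟨min ((c * (A.testBit t).toNat + c' * (B.testBit t).toNat + a) / 2)
              (c + c' + d), by omega⟩ else none := by
          rw [letterRun, h]
          rfl
        rw [hs]
        split_ifs with hmod
        · left
          have e' : (c * ((A % 2 ^ t : ℕ) + 2 ^ t * ((A.testBit t).toNat : ℕ)) +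
              c' * ((B % 2 ^ t : ℕ) + 2 ^ t * ((B.testBit t).toNat : ℕ)) + d : ℤ) =
              (C % 2 ^ t : ℕ) + 2 ^ t * ((C.testBit t).toNat : ℕ) +
              ((c * (A.testBit t).toNat + c' * (B.testBit t).toNat + a) / 2 : ℕ) * 2 ^ (t + 1) := by
            have := Nat.div_add_mod (c * (A.testBit t).toNat + c' * (B.testBit t).toNat + a) 2
            rw [hmod] at this
            zify at this
            push_cast at e ⊢
            linear_combination e - 2 ^ t * this
          refine ⟨_, rfl, ?_⟩
          rw [e']
          simp only [← mod_two_pow_succ'] at e'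
          have := le_of_carry e'
          have hle : (c * (A.testBit t).toNat + c' * (B.testBit t).toNat + a) / 2 ≤ c + c' + d := by
            exact_mod_cast this
          simp only [min_eq_left hle]
        · right
          refine ⟨rfl, fun b hb => hmod ?_⟩
          have : (2 ^ t : ℤ) * (c * (A.testBit t).toNat + c' * (B.testBit t).toNat + a) =
              2 ^ t * ((C.testBit t).toNat + 2 * b) := by
            push_cast at hb e ⊢
            linear_combination hb - e
          have h2 := mul_left_cancel₀ (by positivity) this
          have h3 : (C.testBit t).toNat < 2 := Bool.toNat_lt _
          zify
          rw [h2, Int.add_mul_emod_self_left]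
          omega
      · right
        refine ⟨by rw [letterRun, h]; rfl, fun b hb => e (b * 2 + (C.testBit t).toNat -
          (c * (A.testBit t).toNat + c' * (B.testBit t).toNat)) ?_⟩
        push_cast at hb e ⊢
        linear_combination hb
  have hmod : ∀ q : Option (Fin k × Fin m), term K x q % 2 ^ ((x 0).size + K) = term K x q :=
    fun q => Nat.mod_eq_of_lt (term_lt K x q)
  have := inv ((x 0).size + K)
  rw [hA, hB, hC, hmod, hmod, hmod, ← hA, ← hB, ← hC] at this
  rcases this with ⟨a, h, e⟩ | ⟨h, e⟩
  · rw [h, Set.mem_singleton_iff, Option.some_inj]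
    constructor
    · intro hl
      zify at hl
      rw [hl] at e
      have : (a : ℤ) * 2 ^ ((x 0).size + K) = 0 := by linarith
      rcases mul_eq_zero.1 this with h0 | h0
      · ext
        simpa using h0
      · exact absurd h0 (by positivity)
    · rintro rfl
      zify
      simpa using e
  · rw [h]
    constructor
    · intro hl
      exact absurd (by zify at hl; rw [hl]; ring) (e 0)
    · simp

/-- The state of the automaton is the order of the bits read so far. -/
theorem lt (p p' : Option (Fin k × Fin m)) :
    Automatic m K fun x => term K x p < term K x p' := by
  let δ : Bool → (Option (Fin k × Fin m) → Bool) → Bool := fun q h =>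
    if h p = h p' then q else h p'
  refine of_letterRun δ false {true} fun x => ?_
  set f : ℕ → Option (Fin k × Fin m) → Bool := fun t p => (term K x p).testBit t with hf
  have inv : ∀ t, letterRun δ false f t =
      decide (term K x p % 2 ^ t < term K x p' % 2 ^ t) := by
    intro t
    induction t with
    | zero => simp [letterRun, Nat.mod_one]
    | succ t ih =>
      simp only [letterRun, ih, mod_two_pow_succ]
      have h1 := Nat.mod_lt (term K x p) (y := 2 ^ t) (by positivity)
      have h2 := Nat.mod_lt (term K x p') (y := 2 ^ t) (by positivity)
      simp only [δ, hf]
      generalize term K x p % 2 ^ t = a at *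
      generalize term K x p' % 2 ^ t = b at *
      rcases (term K x p).testBit t <;> rcases (term K x p').testBit t <;> simp <;> omega
  have hmod : ∀ q : Option (Fin k × Fin m), term K x q % 2 ^ ((x 0).size + K) = term K x q :=
    fun q => Nat.mod_eq_of_lt (term_lt K x q)
  rw [inv, hmod, hmod]
  simp

theorem term_eq (p p' : Option (Fin k × Fin m)) :
    Automatic m K fun x => term K x p = term K x p' := by
  simpa using linear (K := K) 1 0 0 p p p'

theorem term_eq_const (p : Option (Fin k × Fin m)) (d : ℕ) :
    Automatic m K fun x => term K x p = d := by
  simpa [eq_comm] using linear (K := K) 0 0 d p p p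

/-- Having at most `m` digits is automatic. -/
theorem lt_pow (i : Fin k) :
    Automatic m K fun x => x i.succ < 2 ^ (m * ((x 0).size + K)) := by
  refine ⟨Unit, inferInstance, fun _ _ _ => (), (), {a | a.2 i = false}, fun x => ?_⟩
  simp

end Automatic

/-! ### Formulas over the positions of a word -/

/-- Formulas that describe a set of words over `{0, 1}`, with `κ` oracles. The variables are de
Bruijn indices; they range over the numbers below a power of two that exceeds the length of the
word. -/
inductive Fml (κ : ℕ) where
  /-- the linear equation `c * i + c' * j + d = l` between variables -/
  | lin (c c' d i j l : ℕ)
  /-- variable `i` is the length of the word -/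
  | len (i : ℕ)
  /-- the letter at position `i` is `1` -/
  | inp (i : ℕ)
  | and (φ ψ : Fml κ)
  | neg (φ : Fml κ)
  | ex (φ : Fml κ)
  /-- The word whose letters are the truth values of `φ`, for all values of its first two variables
  in the order of their value as base-`N` numerals, belongs to the oracle. -/
  | orc (o : Fin κ) (φ : Fml κ)

/-- The number of values of the variables of formulas, for words of length `n`. -/
def univ (K n : ℕ) : ℕ := 2 ^ (n.size + K)

theorem univ_pos (K n : ℕ) : 0 < univ K n := by
  unfold univ
  positivity

/-- The digit number `e` of `v` in base `N`. -/
def dig (N v e : ℕ) : ℕ := v / N ^ e % N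

theorem dig_lt {N : ℕ} (hN : 0 < N) (v e : ℕ) : dig N v e < N := Nat.mod_lt _ hN

/-- The number with digits `a 0, …, a (m - 1)` in base `N`. -/
def ofDig (N : ℕ) : ℕ → (ℕ → ℕ) → ℕ
  | 0, _ => 0
  | m + 1, a => a 0 + N * ofDig N m fun e => a (e + 1)

theorem ofDig_lt {N m : ℕ} {a : ℕ → ℕ} (h : ∀ e < m, a e < N) : ofDig N m a < N ^ m := by
  induction m generalizing a with
  | zero => simp [ofDig]
  | succ m ih =>
    have h0 := h 0 (by omega)
    have := ih (a := fun e => a (e + 1)) fun e he => h _ (by omega)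
    rw [ofDig, pow_succ']
    calc _ < N * (ofDig N m fun e => a (e + 1)) + N := by omega
      _ = N * ((ofDig N m fun e => a (e + 1)) + 1) := by ring
      _ ≤ _ := Nat.mul_le_mul_left _ this

theorem dig_succ (N v e : ℕ) : dig N v (e + 1) = dig N (v / N) e := by
  rw [dig, dig, pow_succ', Nat.div_div_eq_div_mul]

theorem dig_zero (N v : ℕ) : dig N v 0 = v % N := by simp [dig]

theorem dig_ofDig {N m : ℕ} {a : ℕ → ℕ} (h : ∀ e < m, a e < N) {e : ℕ} (he : e < m) :
    dig N (ofDig N m a) e = a e := by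
  induction m generalizing a e with
  | zero => omega
  | succ m ih =>
    have h0 := h 0 (by omega)
    rcases e with _ | e
    · rw [dig_zero, ofDig, Nat.add_mul_mod_self_left, Nat.mod_eq_of_lt h0]
    · rw [dig_succ, ofDig, Nat.add_mul_div_left _ _ (by omega), Nat.div_eq_of_lt h0, zero_add]
      exact ih (a := fun e => a (e + 1)) (fun e he => h _ (by omega)) (by omega)

theorem ofDig_dig {N m v : ℕ} (hv : v < N ^ m) : ofDig N m (dig N v) = v := by
  induction m generalizing v with
  | zero =>
    have : v = 0 := by simpa using hv
    simp [ofDig, this]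
  | succ m ih =>
    rw [ofDig]
    simp only [dig_succ, dig_zero]
    change v % N + N * ofDig N m (dig N (v / N)) = v
    rw [ih, Nat.mod_add_div]
    rw [pow_succ'] at hv
    exact Nat.div_lt_of_lt_mul hv

theorem ofDig_congr {N m : ℕ} {a b : ℕ → ℕ} (h : ∀ e < m, a e = b e) :
    ofDig N m a = ofDig N m b := by
  induction m generalizing a b with
  | zero => rfl
  | succ m ih =>
    rw [ofDig, ofDig, h 0 (by omega), ih fun e he => h (e + 1) (by omega)]

theorem eq_of_dig_eq {N m u v : ℕ} (hu : u < N ^ m) (hv : v < N ^ m)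
    (h : ∀ e < m, dig N u e = dig N v e) : u = v := by
  rw [← ofDig_dig hu, ← ofDig_dig hv, ofDig_congr h]

/-- The assignment `e`, with the `r` lowest base-`N` digits of `p` in front. -/
def push (r N p : ℕ) (e : ℕ → ℕ) (i : ℕ) : ℕ := if i < r then dig N p i else e (i - r)

theorem push_lt {r N p : ℕ} (hN : 0 < N) {e : ℕ → ℕ} (he : ∀ i, e i < N) (i : ℕ) :
    push r N p e i < N := by
  unfold push
  split_ifs
  exacts [dig_lt hN _ _, he _]

namespace Fml

variable {κ : ℕ}

open Classical in
/-- The truth of a formula on a word, with given oracles and values of the variables. -/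
def Eval (K : ℕ) (B : Fin κ → Language Bool) (x : List Bool) : Fml κ → (ℕ → ℕ) → Prop
  | lin c c' d i j l, e => c * e i + c' * e j + d = e l
  | len i, e => e i = x.length
  | inp i, e => x[e i]? = some true
  | and φ ψ, e => φ.Eval K B x e ∧ ψ.Eval K B x e
  | neg φ, e => ¬ φ.Eval K B x e
  | ex φ, e => ∃ b < univ K x.length, φ.Eval K B x (push 1 (univ K x.length) b e)
  | orc o φ, e => ((List.range (univ K x.length ^ 2)).map fun p =>
      decide (φ.Eval K B x (push 2 (univ K x.length) p e))) ∈ B o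

/-- The formulas that feed the gates for a formula, with the number of variables they add. -/
def kids : Fml κ → List (Fml κ × ℕ)
  | and φ ψ => [(φ, 0), (ψ, 0)]
  | neg φ => [(φ, 0)]
  | ex φ => [(φ, 1)]
  | orc _ φ => [(φ, 2)]
  | _ => []

open Classical in
/-- The type of the gate for a formula and an assignment. An atomic formula other than `inp` is
evaluated by the choice of an AND-gate or an OR-gate without inputs. -/
noncomputable def kind (n : ℕ) : Fml κ → (ℕ → ℕ) → GateKind κ
  | lin c c' d i j l, e => if c * e i + c' * e j + d = e l then .and else .or
  | len i, e => if e i = n then .and else .or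
  | inp i, e => if e i < n then .input (e i) else .or
  | and _ _, _ => .and
  | neg _, _ => .not
  | ex _, _ => .or
  | orc o _, _ => .oracle o

open Classical in
theorem eval_iff_gateTrue (K : ℕ) (B : Fin κ → Language Bool) (x : List Bool) (φ : Fml κ)
    (e : ℕ → ℕ) :
    φ.Eval K B x e ↔ OracleCircuit.GateTrue B x (φ.kids.flatMap fun k =>
      (List.range (univ K x.length ^ k.2)).map fun p =>
        decide (k.1.Eval K B x (push k.2 (univ K x.length) p e))) (φ.kind x.length e) := by
  have h0 : ∀ p, push 0 (univ K x.length) p e = e := fun p => by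
    funext i
    simp [push]
  rcases φ with _ | i | i | _ | _ | _ | _
  · simp only [Eval, kind, kids, List.flatMap_nil]
    split_ifs with h <;> simp [h, OracleCircuit.GateTrue]
  · simp only [Eval, kind, kids, List.flatMap_nil]
    split_ifs with h <;> simp [h, OracleCircuit.GateTrue]
  · simp only [Eval, kind, kids, List.flatMap_nil]
    split_ifs with h
    · simp [OracleCircuit.GateTrue]
    · simp [OracleCircuit.GateTrue, List.getElem?_eq_none (not_lt.1 h)]
  · simp [Eval, kind, kids, OracleCircuit.GateTrue, h0, -List.mem_range, List.range_one]
  · simp [Eval, kind, kids, OracleCircuit.GateTrue, h0, List.range_one]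
  · simp [Eval, kind, kids, OracleCircuit.GateTrue]
  · simp [Eval, kind, kids, OracleCircuit.GateTrue]

/-- All variables that occur in atomic formulas are smaller than `m`. -/
def Below (m : ℕ) : Fml κ → Prop
  | lin _ _ _ i j l => i < m ∧ j < m ∧ l < m
  | len i => i < m
  | inp i => i < m
  | and φ ψ => φ.Below m ∧ ψ.Below m
  | neg φ => φ.Below m
  | ex φ => φ.Below m
  | orc _ φ => φ.Below m

theorem Below.mono {m m' : ℕ} (h : m ≤ m') {φ : Fml κ} (hφ : φ.Below m) : φ.Below m' := by
  induction φ with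
  | lin => exact ⟨hφ.1.trans_le h, hφ.2.1.trans_le h, hφ.2.2.trans_le h⟩
  | len => exact lt_of_lt_of_le hφ h
  | inp => exact lt_of_lt_of_le hφ h
  | and φ ψ ih ih' => exact ⟨ih hφ.1, ih' hφ.2⟩
  | neg φ ih | ex φ ih | orc o φ ih => exact ih hφ

theorem exists_below : ∀ φ : Fml κ, ∃ m, φ.Below m
  | lin _ _ _ i j l => ⟨i + j + l + 1, by omega, by omega, by omega⟩
  | len i => ⟨i + 1, by simp [Below]⟩
  | inp i => ⟨i + 1, by simp [Below]⟩
  | and φ ψ => by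
    obtain ⟨m, h⟩ := exists_below φ
    obtain ⟨m', h'⟩ := exists_below ψ
    exact ⟨max m m', h.mono (le_max_left _ _), h'.mono (le_max_right _ _)⟩
  | neg φ => exists_below φ
  | ex φ => exists_below φ
  | orc _ φ => exists_below φ

theorem push_congr {r N p m : ℕ} {e e' : ℕ → ℕ} (h : ∀ i < m, e i = e' i) :
    ∀ i < m, push r N p e i = push r N p e' i := by
  intro i hi
  unfold push
  split_ifs
  · rfl
  · exact h _ (by omega)

theorem eval_congr {K : ℕ} {B : Fin κ → Language Bool} {x : List Bool} {m : ℕ} {φ : Fml κ}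
    (hφ : φ.Below m) {e e' : ℕ → ℕ} (h : ∀ i < m, e i = e' i) :
    φ.Eval K B x e ↔ φ.Eval K B x e' := by
  induction φ generalizing e e' with
  | lin => simp only [Eval]; rw [h _ hφ.1, h _ hφ.2.1, h _ hφ.2.2]
  | len => simp only [Eval]; rw [h _ hφ]
  | inp => simp only [Eval]; rw [h _ hφ]
  | and φ ψ ih ih' => simp only [Eval]; rw [ih hφ.1 h, ih' hφ.2 h]
  | neg φ ih => simp only [Eval]; rw [ih hφ h]
  | ex φ ih => exact exists_congr fun b => and_congr_right fun _ => ih hφ (push_congr h)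
  | orc o φ ih =>
    have : ∀ p, φ.Eval K B x (push 2 (univ K x.length) p e) ↔
        φ.Eval K B x (push 2 (univ K x.length) p e') := fun p => ih hφ (push_congr h)
    exact iff_of_eq (congrArg (· ∈ B o)
      (List.map_congr_left fun p _ => decide_eq_decide.2 (this p)))

/-- The subformulas of a formula. -/
def subs : Fml κ → List (Fml κ)
  | and φ ψ => and φ ψ :: (φ.subs ++ ψ.subs)
  | neg φ => neg φ :: φ.subs
  | ex φ => ex φ :: φ.subs
  | orc o φ => orc o φ :: φ.subs
  | φ => [φ]

theorem subs_eq_cons (φ : Fml κ) : ∃ l, φ.subs = φ :: l := by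
  cases φ <;> exact ⟨_, rfl⟩

theorem mem_subs_self (φ : Fml κ) : φ ∈ φ.subs := by
  obtain ⟨l, hl⟩ := φ.subs_eq_cons
  simp [hl]

theorem subs_subset {φ ψ : Fml κ} (h : ψ ∈ φ.subs) : ψ.subs ⊆ φ.subs := by
  induction φ with
  | and φ₁ φ₂ ih₁ ih₂ =>
    simp only [subs, List.mem_cons, List.mem_append] at h
    rcases h with rfl | h | h
    · exact fun _ h => h
    · exact fun χ hχ => by simp [subs, ih₁ h hχ]
    · exact fun χ hχ => by simp [subs, ih₂ h hχ]
  | neg φ ih | ex φ ih | orc o φ ih =>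
    simp only [subs, List.mem_cons] at h
    rcases h with rfl | h
    · exact fun _ h => h
    · exact fun χ hχ => by simp [subs, ih h hχ]
  | _ =>
    simp only [subs, List.mem_singleton] at h
    subst h
    exact fun _ h => h

theorem mem_subs_of_mem_kids {φ ψ : Fml κ} (h : ψ ∈ φ.subs) {k : Fml κ × ℕ} (hk : k ∈ ψ.kids) :
    k.1 ∈ φ.subs := by
  refine subs_subset h ?_
  cases ψ <;> simp only [kids, List.mem_cons, List.not_mem_nil, or_false] at hk
  · rcases hk with rfl | rfl <;> simp [subs, mem_subs_self]
  all_goals subst hk; simp [subs, mem_subs_self]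

theorem Below.of_mem_subs {m : ℕ} {φ ψ : Fml κ} (hφ : φ.Below m) (h : ψ ∈ φ.subs) :
    ψ.Below m := by
  induction φ with
  | and φ₁ φ₂ ih₁ ih₂ =>
    simp only [subs, List.mem_cons, List.mem_append] at h
    rcases h with rfl | h | h
    exacts [hφ, ih₁ hφ.1 h, ih₂ hφ.2 h]
  | neg φ ih | ex φ ih | orc o φ ih =>
    simp only [subs, List.mem_cons] at h
    rcases h with rfl | h
    exacts [hφ, ih hφ h]
  | _ =>
    simp only [subs, List.mem_singleton] at h
    subst h
    exact hφ

/-- The height of a formula. -/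
def height : Fml κ → ℕ
  | and φ ψ => max φ.height ψ.height + 1
  | neg φ => φ.height + 1
  | ex φ => φ.height + 1
  | orc _ φ => φ.height + 1
  | _ => 0

theorem height_lt_of_mem_kids {ψ : Fml κ} {k : Fml κ × ℕ} (hk : k ∈ ψ.kids) :
    k.1.height < ψ.height := by
  cases ψ <;> simp only [kids, List.mem_cons, List.not_mem_nil, or_false] at hk
  · rcases hk with rfl | rfl <;> simp [height]
  all_goals subst hk; simp [height]

theorem height_le_of_mem_subs {φ ψ : Fml κ} (h : ψ ∈ φ.subs) : ψ.height ≤ φ.height := by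
  induction φ with
  | and φ₁ φ₂ ih₁ ih₂ =>
    simp only [subs, List.mem_cons, List.mem_append] at h
    rcases h with rfl | h | h
    · rfl
    · exact (ih₁ h).trans (by simp [height]; omega)
    · exact (ih₂ h).trans (by simp [height]; omega)
  | neg φ ih | ex φ ih | orc o φ ih =>
    simp only [subs, List.mem_cons] at h
    rcases h with rfl | h
    · rfl
    · exact (ih h).trans (by simp [height])
  | _ =>
    simp only [subs, List.mem_singleton] at h
    subst h
    rfl

theorem snd_le_of_mem_kids {ψ : Fml κ} {k : Fml κ × ℕ} (hk : k ∈ ψ.kids) : k.2 ≤ 2 := by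
  cases ψ <;> simp only [kids, List.mem_cons, List.not_mem_nil, or_false] at hk
  · rcases hk with rfl | rfl <;> simp
  all_goals subst hk; simp

theorem kids_induction {P : Fml κ → Prop} (h : ∀ φ, (∀ k ∈ φ.kids, P k.1) → P φ) (φ : Fml κ) :
    P φ := by
  induction hn : φ.height using Nat.strong_induction_on generalizing φ with
  | _ n ih =>
    subst hn
    exact h φ fun k hk => ih _ (height_lt_of_mem_kids hk) _ rfl

/-! ### The circuit of a formula -/

section Circuit

variable (K m n : ℕ) (φ : Fml κ)

open Classical in
/-- The gate of a subformula and an assignment to the first `m` variables: its lowest digits are the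
values of the variables, and digit `m` is the number of the subformula. -/
noncomputable def gate (ψ : Fml κ) (e : ℕ → ℕ) : ℕ :=
  ofDig (univ K n) (m + 1) fun i => if i < m then e i else φ.subs.idxOf ψ

/-- The subformula of a gate. -/
def gateFml (v : ℕ) : Option (Fml κ) := φ.subs[dig (univ K n) v m]?

/-- The circuit that evaluates a formula on words of length `n`. -/
noncomputable def circuit : OracleCircuit κ where
  size := univ K n ^ (m + 1)
  kind v := (gateFml K m n φ v).elim .and fun ψ => ψ.kind n (dig (univ K n) v)
  inputs v := (gateFml K m n φ v).elim [] fun ψ =>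
    ψ.kids.flatMap fun k => (List.range (univ K n ^ k.2)).map fun p =>
      gate K m n φ k.1 (push k.2 (univ K n) p (dig (univ K n) v))
  output := 0

variable {K m n φ}

/-- What the parameters of the circuit of a formula must satisfy. -/
structure Fits (K m : ℕ) (φ : Fml κ) : Prop where
  below : φ.Below m
  two_le : 2 ≤ m
  length_le : φ.subs.length ≤ 2 ^ K
  pos : 0 < K

variable (hφ : Fits K m φ)

theorem _root_.two_le_univ (hK : 0 < K) (n : ℕ) : 2 ≤ univ K n := by
  unfold univ
  calc 2 = 2 ^ 1 := rfl
    _ ≤ _ := Nat.pow_le_pow_right (by norm_num) (by omega)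

theorem _root_.pow_le_univ (K n : ℕ) : 2 ^ K ≤ univ K n :=
  Nat.pow_le_pow_right (by norm_num) (by omega)

theorem _root_.lt_univ (K n : ℕ) : n < univ K n :=
  (Nat.lt_size_self n).trans_le (Nat.pow_le_pow_right (by norm_num) (by omega))

include hφ

open Classical in
theorem idxOf_lt_univ {ψ : Fml κ} (hψ : ψ ∈ φ.subs) : φ.subs.idxOf ψ < univ K n :=
  (List.idxOf_lt_length_of_mem hψ).trans_le (hφ.length_le.trans (pow_le_univ K n))

open Classical in
theorem gate_digits {ψ : Fml κ} (hψ : ψ ∈ φ.subs) {e : ℕ → ℕ} (he : ∀ i, e i < univ K n) :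
    ∀ i < m + 1, (if i < m then e i else φ.subs.idxOf ψ) < univ K n := by
  intro i _
  split_ifs
  exacts [he i, idxOf_lt_univ hφ hψ]

theorem gate_lt {ψ : Fml κ} (hψ : ψ ∈ φ.subs) {e : ℕ → ℕ} (he : ∀ i, e i < univ K n) :
    gate K m n φ ψ e < univ K n ^ (m + 1) :=
  ofDig_lt (gate_digits hφ hψ he)

theorem dig_gate {ψ : Fml κ} (hψ : ψ ∈ φ.subs) {e : ℕ → ℕ} (he : ∀ i, e i < univ K n) {i : ℕ}
    (hi : i < m) : dig (univ K n) (gate K m n φ ψ e) i = e i := by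
  rw [gate, dig_ofDig (gate_digits hφ hψ he) (by omega), if_pos hi]

open Classical in
theorem dig_gate_self {ψ : Fml κ} (hψ : ψ ∈ φ.subs) {e : ℕ → ℕ} (he : ∀ i, e i < univ K n) :
    dig (univ K n) (gate K m n φ ψ e) m = φ.subs.idxOf ψ := by
  rw [gate, dig_ofDig (gate_digits hφ hψ he) (by omega), if_neg (lt_irrefl m)]

theorem gateFml_gate {ψ : Fml κ} (hψ : ψ ∈ φ.subs) {e : ℕ → ℕ} (he : ∀ i, e i < univ K n) :
    gateFml K m n φ (gate K m n φ ψ e) = some ψ := by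
  classical
  rw [gateFml, dig_gate_self hφ hψ he, List.getElem?_eq_getElem (List.idxOf_lt_length_of_mem hψ)]
  simp

open Classical in
theorem eq_gate_iff {ψ : Fml κ} (hψ : ψ ∈ φ.subs) {e : ℕ → ℕ} (he : ∀ i, e i < univ K n) (u : ℕ) :
    u = gate K m n φ ψ e ↔ u < univ K n ^ (m + 1) ∧
      dig (univ K n) u m = φ.subs.idxOf ψ ∧ ∀ i < m, dig (univ K n) u i = e i := by
  constructor
  · rintro rfl
    exact ⟨gate_lt hφ hψ he, dig_gate_self hφ hψ he, fun i hi => dig_gate hφ hψ he hi⟩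
  · rintro ⟨h1, h2, h3⟩
    refine eq_of_dig_eq h1 (gate_lt hφ hψ he) fun i hi => ?_
    rcases (Nat.lt_succ_iff_lt_or_eq.1 hi) with hi | rfl
    · rw [h3 i hi, dig_gate hφ hψ he hi]
    · rw [h2, dig_gate_self hφ hψ he]

omit hφ in
theorem mem_subs_of_gateFml {v : ℕ} {ψ : Fml κ} (h : gateFml K m n φ v = some ψ) : ψ ∈ φ.subs :=
  List.mem_of_getElem? h

omit hφ in
theorem push_dig_lt (r p v : ℕ) (i : ℕ) :
    push r (univ K n) p (dig (univ K n) v) i < univ K n :=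
  push_lt (univ_pos K n) (fun _ => dig_lt (univ_pos K n) _ _) i

theorem circuit_wellFormed : (circuit K m n φ).WellFormed n where
  output_lt := by
    have := univ_pos K n
    simp only [circuit]
    positivity
  inputs_lt v _ u hu := by
    simp only [circuit] at hu ⊢
    rcases h : gateFml K m n φ v with _ | ψ
    · simp [h] at hu
    · simp only [h, Option.elim_some, List.mem_flatMap, List.mem_map, List.mem_range] at hu
      obtain ⟨k, hk, p, hp, rfl⟩ := hu
      exact gate_lt hφ (mem_subs_of_mem_kids (mem_subs_of_gateFml h) hk) (push_dig_lt _ _ _)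
  input_gate v _ i hi := by
    simp only [circuit] at hi ⊢
    rcases h : gateFml K m n φ v with _ | ψ
    · simp [h] at hi
    · simp only [h, Option.elim_some] at hi ⊢
      cases ψ <;> simp only [kind, kids, List.flatMap_nil, and_true] at hi ⊢ <;>
        first
        | (split_ifs at hi; cases hi; assumption)
        | (split_ifs at hi)
        | cases hi
  not_gate v _ hv := by
    simp only [circuit] at hv ⊢
    rcases h : gateFml K m n φ v with _ | ψ
    · simp [h] at hv
    · simp only [h, Option.elim_some] at hv ⊢
      cases ψ <;> simp only [kind] at hv <;>
        first
        | (cases hv; done)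
        | (split_ifs at hv)
        | simp [kids]

theorem circuit_depthLE : (circuit K m n φ).DepthLE φ.height := by
  refine ⟨fun v => ((gateFml K m n φ v).map height).getD 0, fun v _ => ?_⟩
  simp only [circuit]
  rcases h : gateFml K m n φ v with _ | ψ
  · simp
  · have hψ := mem_subs_of_gateFml h
    refine ⟨by simpa using height_le_of_mem_subs hψ, fun u hu => ?_⟩
    simp only [Option.elim_some, List.mem_flatMap, List.mem_map, List.mem_range] at hu
    obtain ⟨k, hk, p, hp, rfl⟩ := hu
    rw [gateFml_gate hφ (mem_subs_of_mem_kids hψ hk) (push_dig_lt _ _ _)]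
    simpa using height_lt_of_mem_kids hk

theorem length_inputs_le (v : ℕ) : ((circuit K m n φ).inputs v).length ≤ univ K n ^ (m + 1) := by
  have hN := two_le_univ hφ.pos n
  have h1 : univ K n ^ 1 ≤ univ K n ^ (m + 1) :=
    Nat.pow_le_pow_right (by omega) (by omega)
  have h2 : univ K n ^ 2 ≤ univ K n ^ (m + 1) :=
    Nat.pow_le_pow_right (by omega) (by have := hφ.two_le; omega)
  simp only [circuit]
  rcases h : gateFml K m n φ v with _ | ψ
  · simp
  · simp only [Option.elim_some]
    rw [pow_one] at h1
    cases ψ <;> simp [kids] <;> omega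

omit hφ in
open Classical in
theorem map_inputs {v : ℕ} {ψ : Fml κ} (h : gateFml K m n φ v = some ψ) {val : ℕ → Bool}
    {f : Fml κ → (ℕ → ℕ) → Bool}
    (hval : ∀ k ∈ ψ.kids, ∀ e : ℕ → ℕ, (∀ i, e i < univ K n) →
      val (gate K m n φ k.1 e) = f k.1 e) :
    ((circuit K m n φ).inputs v).map val = ψ.kids.flatMap fun k =>
      (List.range (univ K n ^ k.2)).map fun p =>
        f k.1 (push k.2 (univ K n) p (dig (univ K n) v)) := by
  simp only [circuit, h, Option.elim_some, List.map_flatMap, List.map_map]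
  refine List.flatMap_congr fun k hk => List.map_congr_left fun p _ => ?_
  exact hval k hk _ (push_dig_lt _ _ _)

/-- The valuation of the circuit is the truth of the formulas. -/
theorem circuit_accepts_iff (B : Fin κ → Language Bool) (x : List Bool) (hx : x.length = n) :
    (circuit K m n φ).Accepts B x ↔ φ.Eval K B x fun _ => 0 := by
  classical
  subst hx
  set n := x.length with hn
  have hzero : (0 : ℕ) = gate K m n φ φ fun _ => 0 := by
    rw [eq_gate_iff hφ φ.mem_subs_self fun _ => univ_pos K n]
    obtain ⟨l, hl⟩ := φ.subs_eq_cons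
    have := univ_pos K n
    exact ⟨by positivity, by simp [dig, hl], by simp [dig]⟩
  constructor
  · rintro ⟨val, hval, hout⟩
    have key : ∀ ψ : Fml κ, ψ ∈ φ.subs → ∀ e : ℕ → ℕ, (∀ i, e i < univ K n) →
        val (gate K m n φ ψ e) = decide (ψ.Eval K B x e) := by
      intro ψ
      induction ψ using kids_induction with
      | _ ψ ih =>
        intro hψ e he
        have h := gateFml_gate hφ hψ he
        have hv := hval (gate K m n φ ψ e) (gate_lt hφ hψ he)
        rw [map_inputs h (f := fun ψ e => decide (ψ.Eval K B x e)) fun k hk e he =>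
          ih k hk (mem_subs_of_mem_kids hψ hk) e he] at hv
        have hk : (circuit K m n φ).kind (gate K m n φ ψ e) =
            ψ.kind n (dig (univ K n) (gate K m n φ ψ e)) := by simp [circuit, h]
        rw [hk, hn, ← eval_iff_gateTrue K B x, ← hn, eval_congr (hφ.below.of_mem_subs hψ)
          fun i hi => dig_gate hφ hψ he hi] at hv
        rw [Bool.eq_iff_iff, hv, decide_eq_true_iff]
    have := key φ φ.mem_subs_self (fun _ => 0) fun _ => univ_pos K n
    rw [← hzero] at this
    rwa [show (circuit K m n φ).output = 0 from rfl, this, decide_eq_true_iff] at hout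
  · intro h
    let val : ℕ → Bool := fun v => match gateFml K m n φ v with
      | none => true
      | some ψ => decide (ψ.Eval K B x (dig (univ K n) v))
    have hgate : ∀ ψ : Fml κ, ψ ∈ φ.subs → ∀ e : ℕ → ℕ, (∀ i, e i < univ K n) →
        val (gate K m n φ ψ e) = decide (ψ.Eval K B x e) := by
      intro ψ hψ e he
      simp only [val, gateFml_gate hφ hψ he]
      rw [decide_eq_decide, eval_congr (hφ.below.of_mem_subs hψ) fun i hi => dig_gate hφ hψ he hi]
    refine ⟨val, fun v hv => ?_, ?_⟩
    · rcases h : gateFml K m n φ v with _ | ψ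
      · simp [circuit, val, h, OracleCircuit.GateTrue]
      · have hψ := mem_subs_of_gateFml h
        rw [map_inputs h (f := fun ψ e => decide (ψ.Eval K B x e)) fun k hk e he =>
          hgate k.1 (mem_subs_of_mem_kids hψ hk) e he]
        have hk : (circuit K m n φ).kind v = ψ.kind n (dig (univ K n) v) := by simp [circuit, h]
        rw [hk, hn, ← eval_iff_gateTrue K B x, ← hn]
        simp [val, h]
    · change val 0 = true
      rw [hzero, hgate φ φ.mem_subs_self _ fun _ => univ_pos K n]
      simpa using h

end Circuit
end Fml

/-! ### Uniformity of the circuits of formulas -/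

namespace Automatic

variable {k m K : ℕ}

theorem congr {R S : (Fin (k + 1) → ℕ) → Prop} (hR : Automatic m K R) (h : ∀ x, S x ↔ R x) :
    Automatic m K S := by
  rwa [show S = R from funext fun x => propext (h x)]

theorem term_none (x : Fin (k + 1) → ℕ) : term (m := m) K x none = x 0 := rfl

theorem term_some (x : Fin (k + 1) → ℕ) (i : Fin k) {e : ℕ} (he : e < m) :
    term K x (some (i, (⟨e, he⟩ : Fin m))) = dig (univ K (x 0)) (x i.succ) e := by
  rw [term, dig, univ, ← pow_mul, mul_comm _ e]

theorem dig_eq_dig (i j : Fin k) {e e' : ℕ} (he : e < m) (he' : e' < m) :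
    Automatic m K fun x =>
      dig (univ K (x 0)) (x i.succ) e = dig (univ K (x 0)) (x j.succ) e' := by
  simpa only [term_some] using term_eq (K := K) (some (i, ⟨e, he⟩)) (some (j, ⟨e', he'⟩))

theorem dig_eq_const (i : Fin k) {e : ℕ} (he : e < m) (d : ℕ) :
    Automatic m K fun x => dig (univ K (x 0)) (x i.succ) e = d := by
  simpa only [term_some] using term_eq_const (K := K) (some (i, ⟨e, he⟩)) d

theorem dig_linear (c c' d : ℕ) (i : Fin k) {e e' e'' : ℕ} (he : e < m) (he' : e' < m)
    (he'' : e'' < m) : Automatic m K fun x =>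
      c * dig (univ K (x 0)) (x i.succ) e + c' * dig (univ K (x 0)) (x i.succ) e' + d =
        dig (univ K (x 0)) (x i.succ) e'' := by
  simpa only [term_some] using linear (K := K) c c' d (some (i, ⟨e, he⟩)) (some (i, ⟨e', he'⟩))
    (some (i, ⟨e'', he''⟩))

theorem dig_eq_zero (i : Fin k) {e : ℕ} (he : e < m) :
    Automatic m K fun x => dig (univ K (x 0)) (x i.succ) e = x 0 := by
  simpa only [term_some, term_none] using term_eq (K := K) (some (i, ⟨e, he⟩)) none

theorem dig_lt_zero (i : Fin k) {e : ℕ} (he : e < m) :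
    Automatic m K fun x => dig (univ K (x 0)) (x i.succ) e < x 0 := by
  simpa only [term_some, term_none] using lt (K := K) (some (i, ⟨e, he⟩)) none

theorem lt_univ_pow (i : Fin k) : Automatic m K fun x => x i.succ < univ K (x 0) ^ m :=
  (lt_pow i).congr fun x => by rw [univ, ← pow_mul, mul_comm m]

/-- Numbers with at most `r` digits form an automatic set. -/
theorem lt_univ_pow_of_le (i : Fin k) {r : ℕ} (hr : r ≤ m) :
    Automatic m K fun x => x i.succ < univ K (x 0) ^ r := by
  have h : Automatic m K fun x => ∀ e : Fin (m - r), dig (univ K (x 0)) (x i.succ) (r + e) = 0 :=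
    forall_fin fun e => dig_eq_const i (by omega) 0
  refine ((lt_univ_pow i).and h).congr fun x => ?_
  have hN := univ_pos K (x 0)
  constructor
  · intro hx
    refine ⟨hx.trans_le (Nat.pow_le_pow_right hN hr), fun e => ?_⟩
    rw [dig, Nat.div_eq_of_lt (hx.trans_le (Nat.pow_le_pow_right hN (by omega))), Nat.zero_mod]
  · rintro ⟨h1, h2⟩
    have h3 : x i.succ % univ K (x 0) ^ r < univ K (x 0) ^ r := Nat.mod_lt _ (by positivity)
    suffices x i.succ = x i.succ % univ K (x 0) ^ r by rwa [← this] at h3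
    refine eq_of_dig_eq h1 (h3.trans_le (Nat.pow_le_pow_right hN hr)) fun e he => ?_
    rcases lt_or_ge e r with her | her
    · obtain ⟨s, rfl⟩ := Nat.exists_eq_add_of_lt her
      rw [dig, dig, show univ K (x 0) ^ (e + s + 1) = univ K (x 0) ^ e * univ K (x 0) ^ (s + 1) by
        ring, Nat.mod_mul_right_div_self, pow_succ', Nat.mod_mul_right_mod]
    · have := h2 ⟨e - r, by omega⟩
      rw [show r + (e - r) = e by omega] at this
      rw [this, dig, Nat.div_eq_of_lt (h3.trans_le (Nat.pow_le_pow_right hN her)), Nat.zero_mod]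

theorem eq_dig (i j : Fin k) {e : ℕ} (he : e < m) :
    Automatic m K fun x => x i.succ = dig (univ K (x 0)) (x j.succ) e := by
  refine ((lt_univ_pow_of_le (r := 1) i (by omega)).and
    (dig_eq_dig i j (by omega : 0 < m) he)).congr fun x => ?_
  have h : dig (univ K (x 0)) (x j.succ) e < univ K (x 0) := dig_lt (univ_pos _ _) _ _
  rw [pow_one, dig_zero]
  constructor
  · intro h'
    rw [h']
    exact ⟨h, Nat.mod_eq_of_lt h⟩
  · rintro ⟨h1, h2⟩
    rwa [Nat.mod_eq_of_lt h1] at h2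

end Automatic

namespace Fml

open Automatic

variable {κ K m k : ℕ} {φ : Fml κ}

/-- A relation that depends on the formula of a gate is automatic if it is so for each formula. -/
theorem automatic_gateFml (i : Fin k) {R : Option (Fml κ) → (Fin (k + 1) → ℕ) → Prop}
    (h0 : Automatic (m + 1) K (R none))
    (h1 : ∀ ψ ∈ φ.subs, Automatic (m + 1) K (R (some ψ))) :
    Automatic (m + 1) K fun x => R (gateFml K m (x 0) φ (x i.succ)) x := by
  have hs : Automatic (m + 1) K fun x => ∃ s : Fin φ.subs.length,
      dig (univ K (x 0)) (x i.succ) m = s ∧ R (some φ.subs[s]) x :=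
    exists_fin fun s => (dig_eq_const i (by omega) _).and (h1 _ (List.getElem_mem _))
  have hn : Automatic (m + 1) K fun x => ∀ s : Fin φ.subs.length,
      ¬ dig (univ K (x 0)) (x i.succ) m = s :=
    forall_fin fun s => (dig_eq_const i (by omega) _).not
  refine (hs.or (hn.and h0)).congr fun x => ?_
  rcases lt_or_ge (dig (univ K (x 0)) (x i.succ) m) φ.subs.length with h | h
  · rw [gateFml, List.getElem?_eq_getElem h]
    constructor
    · intro hR
      exact .inl ⟨⟨_, h⟩, rfl, hR⟩
    · rintro (⟨s, hs, hR⟩ | ⟨hn, -⟩)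
      · simpa only [hs, Fin.getElem_fin] using hR
      · exact absurd rfl (hn ⟨_, h⟩)
  · rw [gateFml, List.getElem?_eq_none h]
    constructor
    · intro hR
      exact .inr ⟨fun s => by omega, hR⟩
    · rintro (⟨s, hs, hR⟩ | ⟨-, hR⟩)
      · omega
      · exact hR

theorem automatic_ite_kind {P : (Fin (k + 1) → ℕ) → Prop} [∀ x, Decidable (P x)]
    (hP : Automatic m K P) {g₁ : (Fin (k + 1) → ℕ) → GateKind κ} {g g₂ : GateKind κ}
    (hg₁ : Automatic m K fun x => g₁ x = g) :
    Automatic m K fun x => (if P x then g₁ x else g₂) = g := by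
  refine ((hP.and hg₁).or (hP.not.and (const (g₂ = g)))).congr fun x => ?_
  split_ifs with h <;> simp [h]

theorem automatic_kind {ψ : Fml κ} (hψ : ψ.Below m) (i : Fin k) {g : GateKind κ}
    (hg : ∀ t, g ≠ .input t) :
    Automatic (m + 1) K fun x => ψ.kind (x 0) (dig (univ K (x 0)) (x i.succ)) = g := by
  classical
  cases ψ with
  | lin c c' d a b e =>
    simp only [kind]
    exact automatic_ite_kind (dig_linear c c' d i (hψ.1.trans_le (by omega))
      (hψ.2.1.trans_le (by omega)) (hψ.2.2.trans_le (by omega))) (const _)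
  | len a => exact automatic_ite_kind (dig_eq_zero i (lt_of_lt_of_le hψ (by omega))) (const _)
  | inp a =>
    refine automatic_ite_kind (dig_lt_zero i (lt_of_lt_of_le hψ (by omega)))
      ((const False).congr fun x => ?_)
    simpa using (hg _).symm
  | _ =>
    simp only [kind]
    exact const _

theorem automatic_kind_input {ψ : Fml κ} (hψ : ψ.Below m) (i j : Fin k) :
    Automatic (m + 1) K fun x =>
      ψ.kind (x 0) (dig (univ K (x 0)) (x i.succ)) = .input (x j.succ) := by
  classical
  cases ψ with
  | inp a =>
    refine ((dig_lt_zero i (lt_of_lt_of_le hψ (by omega))).and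
      (eq_dig j i (lt_of_lt_of_le hψ (by omega)))).congr fun x => ?_
    simp only [kind]
    split_ifs with h <;> simp [h, eq_comm]
  | _ =>
    refine (const False).congr fun x => ?_
    simp only [kind]
    first
    | (split_ifs <;> simp)
    | simp

/-- The wires that come from one formula are automatic: the assignment of the lower gate is the
assignment of the upper gate with new values in front. -/
theorem automatic_wire (hφ : Fits K m φ) {ψ : Fml κ} (hψ : ψ ∈ φ.subs) (i j : Fin k) :
    Automatic (m + 1) K fun x => x i.succ ∈ ψ.kids.flatMap fun c =>
      (List.range (univ K (x 0) ^ c.2)).map fun p =>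
        gate K m (x 0) φ c.1 (push c.2 (univ K (x 0)) p (dig (univ K (x 0)) (x j.succ))) := by
  classical
  have h : Automatic (m + 1) K fun x => ∃ c : {c // c ∈ ψ.kids}, x i.succ < univ K (x 0) ^ (m + 1) ∧
      dig (univ K (x 0)) (x i.succ) m = φ.subs.idxOf c.1.1 ∧
      ∀ e : Fin (m - c.1.2), dig (univ K (x 0)) (x i.succ) (c.1.2 + e) =
        dig (univ K (x 0)) (x j.succ) e := by
    have : Finite {c // c ∈ ψ.kids} := List.finite_toSet ψ.kids
    exact exists_fin fun c => (lt_univ_pow i).and ((dig_eq_const i (by omega) _).and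
      (forall_fin fun e => dig_eq_dig i j (by omega) (by omega)))
  refine h.congr fun x => ?_
  have hN := univ_pos K (x 0)
  simp only [List.mem_flatMap, List.mem_map, List.mem_range, Subtype.exists]
  refine exists_congr fun c => ?_
  rw [exists_prop]
  refine and_congr_right fun hc => ?_
  have hc2 : c.2 ≤ m := (snd_le_of_mem_kids hc).trans hφ.two_le
  constructor
  · rintro ⟨p, hp, hu⟩
    obtain ⟨h1, h2, h3⟩ := (eq_gate_iff hφ (mem_subs_of_mem_kids hψ hc) (push_dig_lt _ _ _) _).1
      hu.symm
    refine ⟨h1, h2, fun e => ?_⟩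
    rw [h3 _ (by omega), push, if_neg (by omega), Nat.add_sub_cancel_left]
  · rintro ⟨h1, h2, h3⟩
    have hd : ∀ e < c.2, dig (univ K (x 0)) (x i.succ) e < univ K (x 0) := fun e _ => dig_lt hN _ _
    refine ⟨ofDig (univ K (x 0)) c.2 (dig (univ K (x 0)) (x i.succ)), ofDig_lt hd, Eq.symm ?_⟩
    rw [eq_gate_iff hφ (mem_subs_of_mem_kids hψ hc) (push_dig_lt _ _ _)]
    refine ⟨h1, h2, fun e he => ?_⟩
    rw [push]
    split_ifs with hec
    · rw [dig_ofDig hd hec]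
    · have := h3 ⟨e - c.2, by omega⟩
      rwa [show c.2 + (e - c.2) = e by omega] at this

theorem automatic_port (hφ : Fits K m φ) {ψ : Fml κ} (hψ : ψ ∈ φ.subs) (i j q : Fin k) :
    Automatic (m + 1) K fun x =>
      (∃ o, ψ.kind (x 0) (dig (univ K (x 0)) (x j.succ)) = .oracle o) ∧
      (ψ.kids.flatMap fun c => (List.range (univ K (x 0) ^ c.2)).map fun p =>
        gate K m (x 0) φ c.1
          (push c.2 (univ K (x 0)) p (dig (univ K (x 0)) (x j.succ))))[x q.succ]? =
          some (x i.succ) := by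
  classical
  cases ψ with
  | orc o χ =>
    have hm := hφ.two_le
    have h : Automatic (m + 1) K fun x => x q.succ < univ K (x 0) ^ 2 ∧
        x i.succ < univ K (x 0) ^ (m + 1) ∧
        dig (univ K (x 0)) (x i.succ) m = φ.subs.idxOf χ ∧
        (∀ e : Fin 2, dig (univ K (x 0)) (x i.succ) e = dig (univ K (x 0)) (x q.succ) e) ∧
        ∀ e : Fin (m - 2), dig (univ K (x 0)) (x i.succ) (2 + e) =
          dig (univ K (x 0)) (x j.succ) e :=
      (lt_univ_pow_of_le q (by omega)).and ((lt_univ_pow i).and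
        ((dig_eq_const i (by omega) _).and ((forall_fin fun e => dig_eq_dig i q (by omega)
          (by omega)).and (forall_fin fun e => dig_eq_dig i j (by omega) (by omega)))))
    refine h.congr fun x => ?_
    simp only [kind, GateKind.oracle.injEq, exists_eq', true_and, kids, List.flatMap_cons,
      List.flatMap_nil, List.append_nil]
    rcases lt_or_ge (x q.succ) (univ K (x 0) ^ 2) with hq | hq
    · rw [List.getElem?_eq_getElem (by simpa using hq)]
      simp only [List.getElem_map, List.getElem_range, Option.some_inj]
      rw [eq_comm, eq_gate_iff hφ (mem_subs_of_mem_kids hψ (k := (χ, 2)) (by simp [kids]))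
        (push_dig_lt _ _ _)]
      constructor
      · rintro ⟨h1, h2, h3⟩
        refine ⟨hq, h1, h2, fun e => ?_, fun e => ?_⟩
        · rw [h3 e (by omega), push, if_pos (by omega)]
        · rw [h3 _ (by omega), push, if_neg (by omega), Nat.add_sub_cancel_left]
      · rintro ⟨-, h1, h2, h3, h4⟩
        refine ⟨h1, h2, fun e he => ?_⟩
        rw [push]
        split_ifs with he2
        · exact h3 ⟨e, he2⟩
        · have := h4 ⟨e - 2, by omega⟩
          rwa [show 2 + (e - 2) = e by omega] at this
    · rw [List.getElem?_eq_none (by simpa using hq)]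
      simp only [reduceCtorEq, false_iff]
      exact fun h => absurd h.1 (by omega)
  | _ =>
    refine (const False).congr fun x => ?_
    simp only [iff_false, not_and, kind, forall_exists_index]
    intro o ho
    first
    | cases ho
    | (split_ifs at ho)

theorem circuit_dLogTimeUniform (hφ : Fits K m φ) :
    DLogTimeUniform fun n => circuit K m n φ := by
  have hkind : ∀ g : GateKind κ, (∀ t, g ≠ .input t) → LinearTimeDecidable fun a : Fin 2 → ℕ =>
      a 1 < (circuit K m (a 0) φ).size ∧ (circuit K m (a 0) φ).kind (a 1) = g := by
    intro g hg
    refine Automatic.linearTimeDecidable (K := K) (m := m + 1) ((lt_univ_pow (0 : Fin 1)).and ?_)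
    exact automatic_gateFml (φ := φ) (0 : Fin 1) (R := fun (o : Option (Fml κ)) x =>
      (o.elim GateKind.and
      fun ψ => ψ.kind (x 0) (dig (univ K (x 0)) (x (Fin.succ 0)))) = g)
      (const (GateKind.and = g)) fun ψ hψ => automatic_kind (hφ.below.of_mem_subs hψ) _ hg
  refine ⟨?_, hkind _ nofun, hkind _ nofun, hkind _ nofun, fun j => hkind _ nofun, ?_, ?_, ?_⟩
  · refine Automatic.linearTimeDecidable (K := K) (m := m + 1) ((lt_univ_pow (0 : Fin 2)).and ?_)
    exact automatic_gateFml (φ := φ) (0 : Fin 2) (R := fun (o : Option (Fml κ)) x =>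
      (o.elim GateKind.and
      fun ψ => ψ.kind (x 0) (dig (univ K (x 0)) (x (Fin.succ 0)))) = .input (x (Fin.succ 1)))
      ((const False).congr fun x => by simp)
      fun ψ hψ => automatic_kind_input (hφ.below.of_mem_subs hψ) _ _
  · refine Automatic.linearTimeDecidable (K := K) (m := m + 1)
      ((lt_univ_pow_of_le (r := 0) (0 : Fin 1) (by omega)).congr fun x => ?_)
    rw [pow_zero, Nat.lt_one_iff]
    rfl
  · refine Automatic.linearTimeDecidable (K := K) (m := m + 1) ((lt_univ_pow (1 : Fin 2)).and ?_)
    exact automatic_gateFml (φ := φ) (1 : Fin 2) (R := fun (o : Option (Fml κ)) x =>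
      x (Fin.succ 0) ∈ (o.elim ([] : List ℕ)
      fun ψ => ψ.kids.flatMap fun (c : Fml κ × ℕ) => (List.range (univ K (x 0) ^ c.2)).map fun p =>
        gate K m (x 0) φ c.1 (push c.2 (univ K (x 0)) p (dig (univ K (x 0)) (x (Fin.succ 1))))))
      ((const False).congr fun x => by simp)
      fun ψ hψ => automatic_wire hφ hψ _ _
  · refine Automatic.linearTimeDecidable (K := K) (m := m + 1) ((lt_univ_pow (1 : Fin 3)).and ?_)
    exact automatic_gateFml (φ := φ) (1 : Fin 3) (R := fun (o : Option (Fml κ)) x =>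
      (∃ j, o.elim GateKind.and (fun ψ => ψ.kind (x 0) (dig (univ K (x 0)) (x (Fin.succ 1)))) =
        GateKind.oracle j) ∧
      (o.elim ([] : List ℕ)
      fun ψ => ψ.kids.flatMap fun (c : Fml κ × ℕ) => (List.range (univ K (x 0) ^ c.2)).map fun p =>
        gate K m (x 0) φ c.1
          (push c.2 (univ K (x 0)) p (dig (univ K (x 0)) (x (Fin.succ 1)))))[x (Fin.succ 2)]? =
            some (x (Fin.succ 0)))
      ((const False).congr fun x => by simp)
      fun ψ hψ => automatic_port hφ hψ _ _ _

theorem univ_pow_le (K m : ℕ) : ∃ e, ∀ n, univ K n ^ m ≤ n ^ e + e := by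
  refine ⟨(K + 2) * m + univ K 0 ^ m + univ K 1 ^ m, fun n => ?_⟩
  rcases n with _ | _ | n
  · exact Nat.le_add_left_of_le (Nat.le_add_right_of_le (Nat.le_add_left _ _))
  · exact Nat.le_add_left_of_le (Nat.le_add_left _ _)
  · have h1 : univ K (n + 2) ≤ (n + 2) ^ (K + 2) := by
      rw [univ, pow_add, add_comm K 2, pow_add]
      refine Nat.mul_le_mul ?_ (Nat.pow_le_pow_left (by omega) K)
      have h2 : (n + 2).size ≠ 0 := by rw [Ne, Nat.size_eq_zero]; omega
      obtain ⟨s, hs⟩ := Nat.exists_eq_succ_of_ne_zero h2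
      have h3 : 2 ^ s ≤ n + 2 := Nat.lt_size.1 (by omega)
      rw [hs, pow_succ, pow_two]
      exact Nat.mul_le_mul h3 (by omega)
    calc _ ≤ ((n + 2) ^ (K + 2)) ^ m := Nat.pow_le_pow_left h1 m
      _ = (n + 2) ^ ((K + 2) * m) := by rw [pow_mul]
      _ ≤ (n + 2) ^ ((K + 2) * m + univ K 0 ^ m + univ K 1 ^ m) :=
        Nat.pow_le_pow_right (by omega) (by omega)
      _ ≤ _ := Nat.le_add_right _ _

/-- A language that is described by a formula is `AC⁰`-reducible to the oracles of the formula. -/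
theorem ac0Reducible {A : Language Bool} {B : Fin κ → Language Bool} (φ : Fml κ) (K₀ : ℕ)
    (h : ∀ K ≥ K₀, ∀ x, φ.Eval K B x (fun _ => 0) ↔ x ∈ A) : AC0Reducible A B := by
  obtain ⟨m, hm⟩ := φ.exists_below
  have hφ : Fits (K₀ + φ.subs.length + 1) (m + 2) φ :=
    { below := hm.mono (by omega)
      two_le := by omega
      length_le := (Nat.lt_two_pow_self).le.trans (Nat.pow_le_pow_right (by norm_num) (by omega))
      pos := by omega }
  obtain ⟨e, he⟩ := univ_pow_le (K₀ + φ.subs.length + 1) (m + 2 + 1)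
  refine ⟨fun n => circuit (K₀ + φ.subs.length + 1) (m + 2) n φ, φ.height, e,
    fun n => ⟨circuit_wellFormed hφ, circuit_depthLE hφ, he n, fun v _ =>
      (length_inputs_le hφ v).trans (he n)⟩, circuit_dLogTimeUniform hφ, fun x => ?_⟩
  rw [circuit_accepts_iff hφ B x rfl, h _ (by omega)]

end Fml

/-! ### Definable predicates -/

/-- The assignment `e` with `b` in front. -/
def scons (b : ℕ) (e : ℕ → ℕ) : ℕ → ℕ
  | 0 => b
  | i + 1 => e i

theorem push_one {N b : ℕ} (hb : b < N) (e : ℕ → ℕ) : push 1 N b e = scons b e := by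
  funext i
  rcases i with _ | i
  · simp [push, scons, dig_zero, Nat.mod_eq_of_lt hb]
  · simp [push, scons]

theorem push_two {N p : ℕ} (hp : p < N ^ 2) (e : ℕ → ℕ) :
    push 2 N p e = scons (p % N) (scons (p / N) e) := by
  have : p / N < N := Nat.div_lt_of_lt_mul (by rwa [pow_two] at hp)
  funext i
  rcases i with _ | _ | i
  · simp [push, scons, dig_zero]
  · simp [push, scons, dig, Nat.mod_eq_of_lt this]
  · simp [push, scons]

namespace Fml

variable {κ : ℕ}

/-- A renaming of variables below a binder. -/
def lift (ρ : ℕ → ℕ) : ℕ → ℕ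
  | 0 => 0
  | i + 1 => ρ i + 1

/-- Renaming of the variables of a formula. -/
def rename : (ℕ → ℕ) → Fml κ → Fml κ
  | ρ, lin c c' d i j l => lin c c' d (ρ i) (ρ j) (ρ l)
  | ρ, len i => len (ρ i)
  | ρ, inp i => inp (ρ i)
  | ρ, and φ ψ => and (φ.rename ρ) (ψ.rename ρ)
  | ρ, neg φ => neg (φ.rename ρ)
  | ρ, ex φ => ex (φ.rename (lift ρ))
  | ρ, orc o φ => orc o (φ.rename (lift (lift ρ)))

theorem scons_lift (ρ : ℕ → ℕ) (b : ℕ) (e : ℕ → ℕ) :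
    (fun i => scons b e (lift ρ i)) = scons b fun i => e (ρ i) := by
  funext i
  rcases i with _ | i <;> rfl

theorem eval_rename {K : ℕ} {B : Fin κ → Language Bool} {x : List Bool} (φ : Fml κ) (ρ : ℕ → ℕ)
    (e : ℕ → ℕ) : (φ.rename ρ).Eval K B x e ↔ φ.Eval K B x fun i => e (ρ i) := by
  induction φ generalizing ρ e with
  | lin | len | inp => rfl
  | and φ ψ ih ih' => exact and_congr (ih ρ e) (ih' ρ e)
  | neg φ ih => exact not_congr (ih ρ e)
  | ex φ ih =>
    refine exists_congr fun b => and_congr_right fun hb => ?_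
    rw [ih, push_one hb, push_one hb, scons_lift]
  | orc o φ ih =>
    refine iff_of_eq (congrArg (· ∈ B o) (List.map_congr_left fun p hp => decide_eq_decide.2 ?_))
    rw [List.mem_range] at hp
    rw [ih, push_two hp, push_two hp, scons_lift, scons_lift]

end Fml

/-- A predicate of words and assignments is definable if a formula describes it for all large
universes. It may depend on the parameter `K` that determines the universe. -/
def Definable {κ : ℕ} (B : Fin κ → Language Bool) (P : ℕ → List Bool → (ℕ → ℕ) → Prop) : Prop :=
  ∃ (φ : Fml κ) (K₀ : ℕ), ∀ K ≥ K₀, ∀ x e, (∀ i, e i < univ K x.length) →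
    (φ.Eval K B x e ↔ P K x e)

namespace Definable

variable {κ : ℕ} {B : Fin κ → Language Bool} {P Q : ℕ → List Bool → (ℕ → ℕ) → Prop}

theorem ac0Reducible {A : Language Bool} (h : Definable B fun _ x _ => x ∈ A) :
    AC0Reducible A B := by
  obtain ⟨φ, K₀, h⟩ := h
  exact φ.ac0Reducible K₀ fun K hK x => h K hK x _ fun _ => univ_pos _ _

theorem congr_of_ge (hP : Definable B P) (K₁ : ℕ) (h : ∀ K ≥ K₁, ∀ x e,
    (∀ i, e i < univ K x.length) → (Q K x e ↔ P K x e)) : Definable B Q := by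
  obtain ⟨φ, K₀, hφ⟩ := hP
  refine ⟨φ, max K₀ K₁, fun K hK x e he => ?_⟩
  rw [hφ K ((le_max_left _ _).trans hK) x e he, h K ((le_max_right _ _).trans hK) x e he]

theorem congr (hP : Definable B P) (h : ∀ K x e, (∀ i, e i < univ K x.length) →
    (Q K x e ↔ P K x e)) : Definable B Q :=
  hP.congr_of_ge 0 fun K _ => h K

theorem and (hP : Definable B P) (hQ : Definable B Q) :
    Definable B fun K x e => P K x e ∧ Q K x e := by
  obtain ⟨φ, K₀, hφ⟩ := hP
  obtain ⟨ψ, K₁, hψ⟩ := hQ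
  refine ⟨.and φ ψ, max K₀ K₁, fun K hK x e he => ?_⟩
  rw [Fml.Eval, hφ K ((le_max_left _ _).trans hK) x e he, hψ K ((le_max_right _ _).trans hK) x e he]

theorem not (hP : Definable B P) : Definable B fun K x e => ¬ P K x e := by
  obtain ⟨φ, K₀, hφ⟩ := hP
  exact ⟨.neg φ, K₀, fun K hK x e he => not_congr (hφ K hK x e he)⟩

theorem or (hP : Definable B P) (hQ : Definable B Q) :
    Definable B fun K x e => P K x e ∨ Q K x e :=
  (hP.not.and hQ.not).not.congr fun _ _ _ _ => by tauto

theorem imp (hP : Definable B P) (hQ : Definable B Q) :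
    Definable B fun K x e => P K x e → Q K x e :=
  (hP.not.or hQ).congr fun _ _ _ _ => by tauto

theorem ex {P : ℕ → List Bool → ℕ → (ℕ → ℕ) → Prop}
    (h : Definable B fun K x e => P K x (e 0) fun i => e (i + 1)) :
    Definable B fun K x e => ∃ b < univ K x.length, P K x b e := by
  obtain ⟨φ, K₀, hφ⟩ := h
  refine ⟨.ex φ, K₀, fun K hK x e he => exists_congr fun b => and_congr_right fun hb => ?_⟩
  rw [push_one hb, hφ K hK]
  · rfl
  · rintro (_ | i)
    exacts [hb, he i]

theorem all {P : ℕ → List Bool → ℕ → (ℕ → ℕ) → Prop}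
    (h : Definable B fun K x e => P K x (e 0) fun i => e (i + 1)) :
    Definable B fun K x e => ∀ b < univ K x.length, P K x b e :=
  (ex (P := fun K x b e => ¬ P K x b e) h.not).not.congr fun _ _ _ _ => by push Not; rfl

open Classical in
theorem orc (o : Fin κ) {P : ℕ → List Bool → ℕ → ℕ → (ℕ → ℕ) → Prop}
    (h : Definable B fun K x e => P K x (e 0) (e 1) fun i => e (i + 2)) :
    Definable B fun K x e => ((List.range (univ K x.length ^ 2)).map fun p =>
      decide (P K x (p % univ K x.length) (p / univ K x.length) e)) ∈ B o := by
  obtain ⟨φ, K₀, hφ⟩ := h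
  refine ⟨.orc o φ, K₀, fun K hK x e he => iff_of_eq (congrArg (· ∈ B o)
    (List.map_congr_left fun p hp => decide_eq_decide.2 ?_))⟩
  rw [List.mem_range] at hp
  rw [push_two hp, hφ K hK]
  · rfl
  · rintro (_ | _ | i)
    exacts [Nat.mod_lt _ (univ_pos _ _), Nat.div_lt_of_lt_mul (by rwa [pow_two] at hp), he i]

theorem rename (hP : Definable B P) (ρ : ℕ → ℕ) :
    Definable B fun K x e => P K x fun i => e (ρ i) := by
  obtain ⟨φ, K₀, hφ⟩ := hP
  exact ⟨φ.rename ρ, K₀, fun K hK x e he => by rw [φ.eval_rename, hφ K hK x _ fun i => he _]⟩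

theorem at₁ {Q : ℕ → List Bool → ℕ → Prop} (h : Definable B fun K x e => Q K x (e 0)) (i : ℕ) :
    Definable B fun K x e => Q K x (e i) :=
  h.rename fun _ => i

theorem at₂ {Q : ℕ → List Bool → ℕ → ℕ → Prop}
    (h : Definable B fun K x e => Q K x (e 0) (e 1)) (i j : ℕ) :
    Definable B fun K x e => Q K x (e i) (e j) :=
  h.rename fun a => if a = 0 then i else j

theorem at₃ {Q : ℕ → List Bool → ℕ → ℕ → ℕ → Prop}
    (h : Definable B fun K x e => Q K x (e 0) (e 1) (e 2)) (i j l : ℕ) :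
    Definable B fun K x e => Q K x (e i) (e j) (e l) :=
  h.rename fun a => if a = 0 then i else if a = 1 then j else l

theorem lin (c c' d i j l : ℕ) : Definable B fun _ _ e => c * e i + c' * e j + d = e l :=
  ⟨.lin c c' d i j l, 0, fun _ _ _ _ _ => Iff.rfl⟩

theorem len (i : ℕ) : Definable B fun _ x e => e i = x.length :=
  ⟨.len i, 0, fun _ _ _ _ _ => Iff.rfl⟩

theorem inp (i : ℕ) : Definable B fun _ x e => x[e i]? = some true :=
  ⟨.inp i, 0, fun _ _ _ _ _ => Iff.rfl⟩

theorem affine (c d i j : ℕ) : Definable B fun _ _ e => c * e i + d = e j :=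
  (lin c 0 d i i j).congr fun _ _ _ _ => by simp

theorem eq_var (i j : ℕ) : Definable B fun _ _ e => e i = e j :=
  (affine 1 0 i j).congr fun _ _ _ _ => by simp

theorem eq_const (i d : ℕ) : Definable B fun _ _ e => e i = d :=
  (affine 0 d i i).congr fun _ _ _ _ => by simp [eq_comm]

theorem add_const (i d j : ℕ) : Definable B fun _ _ e => e i + d = e j :=
  (affine 1 d i j).congr fun _ _ _ _ => by simp

theorem lt (i j : ℕ) : Definable B fun _ _ e => e i < e j := by
  refine (ex (P := fun _ _ b e => 1 * b + 1 * e i + 1 = e j) (lin 1 1 1 0 (i + 1) (j + 1))).congr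
    fun K x e he => ⟨fun h => ⟨e j - e i - 1, ?_, by omega⟩, ?_⟩
  · have := he j
    omega
  · rintro ⟨b, -, hb⟩
    omega

theorem le (i j : ℕ) : Definable B fun _ _ e => e i ≤ e j :=
  (lt j i).not.congr fun _ _ _ _ => not_lt.symm

theorem const (p : Prop) : Definable B fun _ _ _ => p := by
  have h : Definable B fun _ _ (e : ℕ → ℕ) => e 0 = e 0 := eq_var 0 0
  by_cases hp : p
  · exact h.congr fun _ _ _ _ => by simp [hp]
  · exact h.not.congr fun _ _ _ _ => by simp [hp]

theorem exists_fin {ι : Type} [Finite ι] {P : ι → ℕ → List Bool → (ℕ → ℕ) → Prop}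
    (h : ∀ i, Definable B (P i)) : Definable B fun K x e => ∃ i, P i K x e := by
  have := Fintype.ofFinite ι
  classical
  suffices ∀ s : Finset ι, Definable B fun K x e => ∃ i ∈ s, P i K x e by simpa using this .univ
  intro s
  induction s using Finset.induction_on with
  | empty => simpa using const False
  | insert a s _ ih => exact ((h a).or ih).congr fun _ _ _ _ => by simp

theorem lt_const (i d : ℕ) : Definable B fun _ _ e => e i < d :=
  (exists_fin (fun a : Fin d => eq_const i a)).congr fun _ _ e _ =>
    ⟨fun h => ⟨⟨e i, h⟩, rfl⟩, by rintro ⟨a, ha⟩; omega⟩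

theorem le_len (i : ℕ) : Definable B fun _ x e => e i ≤ x.length :=
  (ex (P := fun _ x b e => b = x.length ∧ e i ≤ b) ((len 0).and (le (i + 1) 0))).congr
    fun _ x _ _ => ⟨fun h => ⟨_, lt_univ _ _, rfl, h⟩, by rintro ⟨_, -, rfl, h⟩; exact h⟩

theorem inp_const (i : ℕ) (b : Bool) : Definable B fun _ x e => x[e i]? = some b := by
  cases b
  · have h : Definable B fun _ x e => ¬ x[e i]? = some true ∧ e i ≤ x.length ∧
        ¬ e i = x.length := (inp i).not.and ((le_len i).and (len i).not)
    refine h.congr fun K x e _ => ?_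
    rcases lt_trichotomy (e i) x.length with h | h | h
    · simp [h, h.le, h.ne]
    · simp [h]
    · simp [h.le, h]
  · exact inp i

/-- A predicate in which constants are added to a variable. -/
theorem add_const_left {P : ℕ → List Bool → ℕ → (ℕ → ℕ) → Prop} (i d : ℕ)
    (h : Definable B fun K x e => P K x (e 0) fun i => e (i + 1)) :
    Definable B fun K x e => e i + d < univ K x.length ∧ P K x (e i + d) e :=
  (ex (P := fun K x b e => e i + d = b ∧ P K x b e) ((add_const (i + 1) d 0).and h)).congr
    fun _ _ _ _ => ⟨fun ⟨h1, h2⟩ => ⟨_, h1, rfl, h2⟩, by rintro ⟨_, h1, rfl, h2⟩; exact ⟨h1, h2⟩⟩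

theorem add_const_eq_univ (c d i : ℕ) :
    Definable B fun K x e => c * e i + d + 1 = univ K x.length := by
  refine ((ex (P := fun _ _ b e => c * e i + d = b) (affine c d (i + 1) 0)).and
    (ex (P := fun _ _ b e => c * e i + (d + 1) = b) (affine c (d + 1) (i + 1) 0)).not).congr
    fun K x e _ => ?_
  simp only [exists_eq_right', ← add_assoc]
  omega

end Definable

/-! ### Straight-line programs and their codes -/

namespace SLP

variable {α : Type} {code : α → List Bool}

theorem codeString_cons (b : Bool) (w : List Bool) :
    codeString (b :: w) = false :: b :: codeString w := rfl

theorem codeString_append (v w : List Bool) :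
    codeString (v ++ w) = codeString v ++ codeString w := by
  simp [codeString]

theorem length_codeString (w : List Bool) : (codeString w).length = 2 * w.length := by
  induction w with
  | nil => rfl
  | cons b w ih =>
    rw [codeString_cons, List.length_cons, List.length_cons, ih, List.length_cons]
    ring

theorem codeString_injective : Function.Injective codeString := by
  intro v
  induction v with
  | nil =>
    rintro (_ | ⟨b, w⟩) h
    · rfl
    · cases h
  | cons b v ih =>
    rintro (_ | ⟨c, w⟩) h
    · cases h
    · rw [codeString_cons, codeString_cons, List.cons_inj_right, List.cons.injEq] at h
      rw [h.1, ih h.2]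

/-- The end of a coded string is marked by the bit `1` that follows. -/
theorem codeString_append_inj {v w s t : List Bool}
    (h : codeString v ++ true :: s = codeString w ++ true :: t) : v = w ∧ s = t := by
  induction v generalizing w with
  | nil =>
    rcases w with _ | ⟨c, w⟩
    · simpa using h
    · cases h
  | cons b v ih =>
    rcases w with _ | ⟨c, w⟩
    · cases h
    · simp only [codeString_cons, List.cons_append, List.cons.injEq, true_and] at h
      obtain ⟨rfl, h⟩ := h
      obtain ⟨rfl, rfl⟩ := ih h
      exact ⟨rfl, rfl⟩

theorem codeString_append_true_ne (v w s : List Bool) :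
    codeString v ++ true :: s ≠ codeString w := by
  induction v generalizing w with
  | nil => rcases w with _ | ⟨c, w⟩ <;> exact nofun
  | cons b v ih =>
    rcases w with _ | ⟨c, w⟩
    · exact nofun
    · intro h
      simp only [codeString_cons, List.cons_append, List.cons.injEq, true_and] at h
      exact ih w h.2

theorem codeRule_letter_append (A : List Bool) (a : α) (t : List Bool) :
    codeRule code (A, .letter a) ++ t =
      codeString A ++ true :: false :: (codeString (code a) ++ true :: true :: t) := by
  simp [codeRule]

theorem codeRule_pair_append (A B C t : List Bool) :
    codeRule code (A, .pair B C) ++ t = codeString A ++ true :: false ::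
      (codeString B ++ true :: false :: (codeString C ++ true :: true :: t)) := by
  simp [codeRule]

theorem codeRule_append (r : List Bool × SLPRhs α) (t : List Bool) :
    ∃ s, codeRule code r ++ t = codeString r.1 ++ true :: false :: s := by
  obtain ⟨A, a | ⟨B, C⟩⟩ := r
  · exact ⟨_, codeRule_letter_append A a t⟩
  · exact ⟨_, codeRule_pair_append A B C t⟩

theorem codeRule_append_inj (hcode : Function.Injective code) {r r' : List Bool × SLPRhs α}
    {t t' : List Bool} (h : codeRule code r ++ t = codeRule code r' ++ t') : r = r' ∧ t = t' := by
  obtain ⟨A, a | ⟨B, C⟩⟩ := r <;> obtain ⟨A', a' | ⟨B', C'⟩⟩ := r' <;>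
    simp only [codeRule_letter_append, codeRule_pair_append] at h <;>
    obtain ⟨rfl, h2⟩ := codeString_append_inj h <;>
    obtain ⟨h3, h4⟩ := codeString_append_inj (List.cons.inj h2).2
  · obtain rfl := hcode h3
    exact ⟨rfl, (List.cons.inj h4).2⟩
  · simp at h4
  · simp at h4
  · obtain ⟨h5, h6⟩ := codeString_append_inj (List.cons.inj h4).2
    subst h3 h5
    exact ⟨rfl, (List.cons.inj h6).2⟩

theorem codeRule_append_ne (r : List Bool × SLPRhs α) (t w : List Bool) :
    codeRule code r ++ t ≠ codeString w := by
  obtain ⟨s, hs⟩ := codeRule_append (code := code) r t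
  rw [hs]
  exact codeString_append_true_ne _ _ _

theorem encode_injective (hcode : Function.Injective code) :
    Function.Injective (encode (α := α) code) := by
  rintro ⟨R, S⟩ ⟨R', S'⟩ h
  simp only [encode] at h
  induction R generalizing R' with
  | nil =>
    rcases R' with _ | ⟨r', R'⟩
    · rw [codeString_injective h]
    · rw [List.flatMap_cons, List.append_assoc] at h
      exact absurd h.symm (codeRule_append_ne _ _ _)
  | cons r R ih =>
    rcases R' with _ | ⟨r', R'⟩
    · rw [List.flatMap_cons, List.append_assoc] at h
      exact absurd h (codeRule_append_ne _ _ _)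
    · simp only [List.flatMap_cons, List.append_assoc] at h
      obtain ⟨rfl, h'⟩ := codeRule_append_inj hcode h
      have := ih R' h'
      cases this
      rfl

/-- The rule evaluation that is folded over the rules of a program. -/
def evalRule (val : List Bool → List α) (r : List Bool × SLPRhs α) : List Bool → List α :=
  Function.update val r.1 <|
    match r.2 with
    | SLPRhs.letter a => [a]
    | SLPRhs.pair B C => val B ++ val C

theorem foldl_evalRule_of_notMem (l : List (List Bool × SLPRhs α)) (val : List Bool → List α)
    {A : List Bool} (hA : A ∉ l.map Prod.fst) : l.foldl evalRule val A = val A := by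
  induction l generalizing val with
  | nil => rfl
  | cons r l ih =>
    rw [List.map_cons, List.mem_cons, not_or] at hA
    rw [List.foldl_cons, ih _ hA.2, evalRule, Function.update_of_ne hA.1]

theorem WellFormed.values_eq {P : SLP α} (hP : P.WellFormed) {l₁ l₂ : List (List Bool × SLPRhs α)}
    {A : List Bool} {rhs : SLPRhs α} (h : P.rules = l₁ ++ (A, rhs) :: l₂) :
    (∀ a, rhs = .letter a → P.values A = [a]) ∧
      ∀ B C, rhs = .pair B C → P.values A = P.values B ++ P.values C := by
  have hval : P.values = ((A, rhs) :: l₂).foldl evalRule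
      (l₁.foldl evalRule fun _ => []) := by
    rw [← List.foldl_append, ← h]
    rfl
  have hnd := hP.nodup
  rw [h, List.map_append, List.nodup_append] at hnd
  obtain ⟨-, hnd2, hdis⟩ := hnd
  rw [List.map_cons, List.nodup_cons] at hnd2
  have hlow : ∀ B ∈ l₁.map Prod.fst, P.values B = l₁.foldl evalRule (fun _ => []) B := by
    intro B hB
    rw [hval]
    exact foldl_evalRule_of_notMem _ _ fun h => hdis B hB B h rfl
  have hA : P.values A = evalRule (l₁.foldl evalRule fun _ => []) (A, rhs) A := by
    rw [hval, List.foldl_cons]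
    exact foldl_evalRule_of_notMem _ _ hnd2.1
  rw [hA, evalRule, Function.update_self]
  constructor
  · rintro a rfl
    rfl
  · rintro B C rfl
    obtain ⟨hB, hC⟩ := hP.smaller _ _ _ _ _ h
    simp only
    rw [hlow B hB, hlow C hC]

end SLP

theorem GenLetter.code_injective {r : ℕ} : Function.Injective (GenLetter.code (r := r)) := by
  rintro ⟨i, b⟩ ⟨j, c⟩ h
  simp only [GenLetter.code, List.cons.injEq] at h
  obtain ⟨rfl, h⟩ := h
  have := congrArg List.length h
  simp only [List.length_replicate] at this
  rw [Fin.ext this]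

theorem evalWord_append {G : Type*} [Group G] {r : ℕ} (σ : Fin r → G) (v w : List (GenLetter r)) :
    evalWord σ (v ++ w) = evalWord σ v * evalWord σ w := by
  simp [evalWord]

theorem encode_mem_CWP {G : Type*} [Group G] {r : ℕ} (σ : Fin r → G) {P : SLP (GenLetter r)}
    (hP : P.WellFormed) : P.encode GenLetter.code ∈ CWP σ ↔ evalWord σ P.val = 1 := by
  constructor
  · rintro ⟨P', -, h, h1⟩
    rwa [SLP.encode_injective GenLetter.code_injective h]
  · exact fun h => ⟨P, hP, rfl, h⟩

/-! ### Straight-line programs with codes of a fixed shape -/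

theorem flatMap_range_add {α : Type*} (a b : ℕ) (f : ℕ → List α) :
    (List.range (a + b)).flatMap f =
      (List.range a).flatMap f ++ (List.range b).flatMap fun h => f (a + h) := by
  rw [List.range_add, List.flatMap_append, List.flatMap_map]

theorem flatMap_range_mul {α : Type*} (a b : ℕ) (f : ℕ → ℕ → List α) :
    (List.range a).flatMap (fun i => (List.range b).flatMap (f i)) =
      (List.range (a * b)).flatMap fun p => f (p / b) (p % b) := by
  induction a with
  | zero => simp
  | succ a ih =>
    rw [flatMap_range_add, ih, add_one_mul, flatMap_range_add]
    congr 1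
    rw [List.range_one, List.flatMap_singleton]
    refine List.flatMap_congr fun h hh => ?_
    rw [List.mem_range] at hh
    rw [mul_comm a b, Nat.mul_add_div (by omega), Nat.mul_add_mod, Nat.mod_eq_of_lt hh,
      Nat.div_eq_of_lt hh, add_zero]

theorem flatMap_range_eq_codeString {a : ℕ} {f : ℕ → List Bool} {g : ℕ → Bool}
    (h : ∀ i < a, f i = [false, g i]) :
    (List.range a).flatMap f = SLP.codeString ((List.range a).map g) := by
  rw [SLP.codeString, List.flatMap_map]
  exact List.flatMap_congr fun i hi => h i (List.mem_range.1 hi)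

theorem map_range_false (a : ℕ) : (List.range a).map (fun _ => false) = List.replicate a false := by
  simp

/-- The string of length `a` with a single `1`, at position `j`. -/
def oneHot (a j : ℕ) : List Bool := (List.range a).map fun h => decide (h = j)

theorem length_oneHot (a j : ℕ) : (oneHot a j).length = a := by simp [oneHot]

theorem oneHot_inj {a i j : ℕ} (hi : i < a) (h : oneHot a i = oneHot a j) : i = j := by
  have := congrArg (·[i]?) h
  simpa [oneHot, hi] using this

/-- The data of a straight-line program with `J - 1` variables, named by the numbers `j < J - 1`.
The variable `j` derives the letter `ltr j` if `j < c`, and otherwise the variables `l j` and `r j`.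
The letter `a₀` is used to fill gaps. -/
structure Query (s : ℕ) where
  J : ℕ
  c : ℕ
  ltr : ℕ → GenLetter s
  a₀ : GenLetter s
  l : ℕ → ℕ
  r : ℕ → ℕ
  st : ℕ

namespace Query

variable {s : ℕ} (q : Query s)

/-- The conditions on the data of a query under which it yields a straight-line program. -/
structure Ok : Prop where
  a₀ : q.a₀.code = [false]
  three_le : 3 ≤ q.J
  code_le : ∀ j < q.c, (q.ltr j).code.length + 4 ≤ 2 * q.J
  l_lt : ∀ j, q.c ≤ j → j + 1 < q.J → q.l j < j
  r_lt : ∀ j, q.c ≤ j → j + 1 < q.J → q.r j < j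
  st_lt : q.st + 1 < q.J

/-- The name of variable `j`. -/
def name (j : ℕ) : List Bool := oneHot (2 * q.J - 1) j

/-- The right-hand side of variable `j`. -/
def rhs (j : ℕ) : SLPRhs (GenLetter s) :=
  if j < q.c then .letter (q.ltr j) else .pair (q.name (q.l j)) (q.name (q.r j))

/-- The name of the dummy variable that fills the block of variable `j`. -/
def dummy (j : ℕ) : List Bool :=
  if j < q.c then List.replicate (2 * q.J - (q.ltr j).code.length - 1 + 2 * q.J) false ++
    oneHot (2 * q.J - 3) j else oneHot (2 * q.J - 3) j

/-- The rules of a block: one for variable `j`, and a rule that fills up four rows. -/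
def block (j : ℕ) : List (List Bool × SLPRhs (GenLetter s)) :=
  [(q.name j, q.rhs j), (q.dummy j, .letter q.a₀)]

/-- The name of the dummy variable of the last block. -/
def lastDummy : List Bool := List.replicate (2 * q.J + 2 * q.J + (2 * q.J - 2)) false

/-- The straight-line program of a query. -/
def prog : SLP (GenLetter s) where
  rules := (List.range (q.J - 1)).flatMap q.block ++ [(q.lastDummy, .letter q.a₀)]
  start := q.name q.st

variable {q} (hq : q.Ok)

include hq

theorem Ok.name_inj {i j : ℕ} (hi : i < q.J) (h : q.name i = q.name j) : i = j :=
  oneHot_inj (by have := hq.three_le; omega) h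

omit hq in
theorem dummy_inj {i j : ℕ} (hi : i + 1 < q.J) (h : q.dummy i = q.dummy j) : i = j := by
  have hd : ∀ j, ∃ v, q.dummy j = v ++ oneHot (2 * q.J - 3) j := fun j => by
    unfold dummy
    split_ifs
    exacts [⟨_, rfl⟩, ⟨[], rfl⟩]
  obtain ⟨v, hv⟩ := hd i
  obtain ⟨w, hw⟩ := hd j
  rw [hv, hw] at h
  exact oneHot_inj (by omega) (List.append_inj_right' h (by simp only [length_oneHot]))

theorem Ok.dummy_ne_name {i j : ℕ} : q.dummy i ≠ q.name j := by
  intro h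
  have hl := congrArg List.length h
  have := hq.three_le
  unfold dummy name at hl
  split_ifs at hl with hi
  · have := hq.code_le i hi
    simp only [List.length_append, List.length_replicate, length_oneHot] at hl
    omega
  · simp only [length_oneHot] at hl
    omega

theorem Ok.lastDummy_ne {j : ℕ} : q.lastDummy ≠ q.name j ∧ q.lastDummy ≠ q.dummy j := by
  have := hq.three_le
  constructor
  · intro h
    have hl := congrArg List.length h
    simp only [lastDummy, name, List.length_replicate, length_oneHot] at hl
    omega
  · intro h
    have hl := congrArg List.length h
    unfold lastDummy dummy at hl
    split_ifs at hl with hj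
    · have := hq.code_le j hj
      have h1 : 1 ≤ (q.ltr j).code.length := by simp [GenLetter.code]
      simp only [List.length_append, List.length_replicate, length_oneHot] at hl
      omega
    · simp only [List.length_replicate, length_oneHot] at hl
      omega

theorem Ok.nodup : (q.prog.rules.map Prod.fst).Nodup := by
  simp only [prog, List.map_append, List.map_flatMap, List.map_cons, List.map_nil, block]
  rw [List.nodup_append]
  refine ⟨?_, by simp, ?_⟩
  · rw [List.nodup_flatMap]
    constructor
    · intro j _
      simp [hq.dummy_ne_name.symm]
    · refine (List.nodup_range (n := q.J - 1)).pairwise_of_forall_ne fun i hi j hj hij => ?_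
      rw [List.mem_range] at hi hj
      simp only [Function.onFun, List.disjoint_cons_left, List.mem_cons, List.not_mem_nil, or_false,
        not_or, List.disjoint_nil_left, and_true]
      exact ⟨⟨fun h => hij (hq.name_inj (by omega) h), hq.dummy_ne_name.symm⟩, hq.dummy_ne_name,
        fun h => hij (dummy_inj (by omega) h)⟩
  · intro A hA A' hA'
    simp only [List.mem_flatMap, List.mem_cons, List.not_mem_nil, or_false] at hA hA'
    subst hA'
    obtain ⟨j, -, rfl | rfl⟩ := hA
    exacts [hq.lastDummy_ne.1.symm, hq.lastDummy_ne.2.symm]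

omit hq in
theorem rules_eq {j : ℕ} (hj : j + 1 < q.J) : ∃ l₂, q.prog.rules =
    (List.range j).flatMap q.block ++ (q.name j, q.rhs j) :: l₂ := by
  refine ⟨(q.dummy j, .letter q.a₀) :: ((List.range (q.J - 1 - j - 1)).flatMap
    (fun h => q.block (j + (h + 1))) ++ [(q.lastDummy, .letter q.a₀)]), ?_⟩
  rw [prog, show q.J - 1 = j + (q.J - 1 - j - 1 + 1) by omega, flatMap_range_add,
    List.range_succ_eq_map, List.flatMap_cons, List.flatMap_map]
  simp only [List.append_assoc, add_zero, Nat.succ_eq_add_one]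
  rw [show j + (q.J - 1 - j - 1 + 1) - j - 1 = q.J - 1 - j - 1 by omega]
  rfl

omit hq in
theorem name_mem {i j : ℕ} (h : i < j) :
    q.name i ∈ ((List.range j).flatMap q.block).map Prod.fst := by
  simp only [List.map_flatMap, List.mem_flatMap, List.mem_range]
  exact ⟨i, h, by simp [block]⟩

omit hq in
theorem _root_.append_cons_inj_of_nodup {α β : Type*} {f : α → β} {a b : α} {l₁ l₂ l₁' l₂' : List α}
    (h : l₁ ++ a :: l₂ = l₁' ++ b :: l₂') (hab : f a = f b) (hn : ((l₁ ++ a :: l₂).map f).Nodup) :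
    l₁ = l₁' ∧ a = b ∧ l₂ = l₂' := by
  induction l₁ generalizing l₁' with
  | nil =>
    rcases l₁' with _ | ⟨c, l₁'⟩
    · simpa using h
    · simp only [List.nil_append, List.cons_append, List.cons.injEq] at h
      obtain ⟨rfl, rfl⟩ := h
      simp [hab] at hn
  | cons c l₁ ih =>
    rcases l₁' with _ | ⟨c', l₁'⟩
    · simp only [List.nil_append, List.cons_append, List.cons.injEq] at h
      obtain ⟨rfl, rfl⟩ := h
      simp [hab] at hn
    · simp only [List.cons_append, List.cons.injEq] at h
      obtain ⟨rfl, h⟩ := h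
      rw [List.cons_append, List.map_cons, List.nodup_cons] at hn
      obtain ⟨rfl, h2, h3⟩ := ih h hn.2
      exact ⟨rfl, h2, h3⟩

theorem Ok.wellFormed : q.prog.WellFormed where
  nodup := hq.nodup
  smaller l₁ l₂ A B C h := by
    have hmem : (A, SLPRhs.pair B C) ∈ q.prog.rules := by simp [h]
    simp only [prog, List.mem_append, List.mem_flatMap, List.mem_range, block, List.mem_cons,
      List.not_mem_nil, or_false, Prod.mk.injEq, reduceCtorEq, and_false] at hmem
    obtain ⟨j, hj, rfl, hr⟩ := hmem
    obtain ⟨l₂', hl⟩ := rules_eq (q := q) (j := j) (by omega)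
    have hnd := hq.nodup
    rw [h] at hl hnd
    obtain ⟨rfl, -, -⟩ := append_cons_inj_of_nodup (f := Prod.fst) hl rfl hnd
    unfold rhs at hr
    split_ifs at hr with hjc
    cases hr
    exact ⟨name_mem (hq.l_lt j (by omega) (by omega)), name_mem (hq.r_lt j (by omega) (by omega))⟩
  start_mem := by
    have := hq.st_lt
    simp only [prog, List.map_append, List.mem_append]
    exact .inl (name_mem (by omega))

theorem Ok.evalWord_values {G : Type*} [Group G] {τ : Fin s → G} {V : ℕ → G}
    (h1 : ∀ j < q.c, V j = evalWord τ [q.ltr j])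
    (h2 : ∀ j, q.c ≤ j → j + 1 < q.J → V j = V (q.l j) * V (q.r j)) (j : ℕ) (hj : j + 1 < q.J) :
    evalWord τ (q.prog.values (q.name j)) = V j := by
  induction j using Nat.strong_induction_on with
  | _ j ih =>
    obtain ⟨l₂, hl⟩ := rules_eq hj
    rcases lt_or_ge j q.c with hjc | hjc
    · rw [(hq.wellFormed.values_eq hl).1 _ (if_pos hjc), h1 j hjc]
    · have hl' := hq.l_lt j hjc hj
      have hr' := hq.r_lt j hjc hj
      rw [(hq.wellFormed.values_eq hl).2 _ _ (if_neg hjc.not_gt), evalWord_append,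
        ih _ hl' (by omega), ih _ hr' (by omega), h2 j hjc hj]

theorem Ok.encode_mem_CWP_iff {G : Type*} [Group G] {τ : Fin s → G} {V : ℕ → G}
    (h1 : ∀ j < q.c, V j = evalWord τ [q.ltr j])
    (h2 : ∀ j, q.c ≤ j → j + 1 < q.J → V j = V (q.l j) * V (q.r j)) :
    q.prog.encode GenLetter.code ∈ CWP τ ↔ V q.st = 1 := by
  rw [encode_mem_CWP τ hq.wellFormed, SLP.val, ← hq.evalWord_values h1 h2 _ hq.st_lt]
  rfl

/-! ### The bits of the code of a query -/

omit hq

variable (q)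

/-- The code of a query consists of `J` blocks of four rows of `2 * J` pairs of bits. This is the
first bit of pair number `h` in row `ρ` of block `j`. -/
def Fst (j ρ h : ℕ) : Prop :=
  (j + 1 = q.J ∧ (ρ = 2 ∧ h + 2 = 2 * q.J ∨ ρ = 3 ∧ h = 0)) ∨
  (¬ j + 1 = q.J ∧ (ρ = 0 ∧ h + 1 = 2 * q.J ∨ ρ = 3 ∧ (h + 3 = 2 * q.J ∨ h + 1 = 2 * q.J) ∨
    (j < q.c ∧ ρ = 1 ∧ h = (q.ltr j).code.length) ∨
    (¬ j < q.c ∧ (ρ = 1 ∨ ρ = 2) ∧ h + 1 = 2 * q.J)))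

/-- The second bit of pair number `h` in row `ρ` of block `j`. -/
def Snd (j ρ h : ℕ) : Prop :=
  (j + 1 = q.J ∧ ρ = 3 ∧ (h = 0 ∨ h = q.st + 1)) ∨
  (¬ j + 1 = q.J ∧ (ρ = 0 ∧ h = j ∨ ρ = 3 ∧ (h = j ∨ h + 1 = 2 * q.J) ∨
    (j < q.c ∧ ρ = 1 ∧ ((q.ltr j).code[h]? = some true ∨ h = (q.ltr j).code.length)) ∨
    (¬ j < q.c ∧ (ρ = 1 ∧ h = q.l j ∨ ρ = 2 ∧ (h = q.r j ∨ h + 1 = 2 * q.J)))))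

open Classical in
/-- A pair of bits of the code of a query. -/
noncomputable def cell (j ρ h : ℕ) : List Bool := [decide (q.Fst j ρ h), decide (q.Snd j ρ h)]

variable {q}

theorem cell_eq {j ρ h : ℕ} {a b : Bool} (ha : q.Fst j ρ h ↔ a = true)
    (hb : q.Snd j ρ h ↔ b = true) : q.cell j ρ h = [a, b] := by
  classical
  simp [cell, ha, hb]

include hq

theorem Ok.encode_block {j : ℕ} (hj : j + 1 < q.J) :
    (q.block j).flatMap (SLP.codeRule GenLetter.code) =
      (List.range 4).flatMap fun ρ => (List.range (2 * q.J)).flatMap (q.cell j ρ) := by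
  have h3 := hq.three_le
  have hjJ : ¬ j + 1 = q.J := by omega
  have row0 : (List.range (2 * q.J)).flatMap (q.cell j 0) =
      SLP.codeString (q.name j) ++ [true, false] := by
    rw [show 2 * q.J = 2 * q.J - 1 + 1 by omega, flatMap_range_add,
      flatMap_range_eq_codeString (g := fun h => decide (h = j)) fun h hh =>
        cell_eq (by simp [Fst, hjJ]; omega) (by simp [Snd, hjJ])]
    congr 1
    rw [List.range_one, List.flatMap_singleton]
    exact cell_eq (by simp [Fst, hjJ]; omega) (by simp [Snd, hjJ]; omega)
  have row3 : (List.range (2 * q.J)).flatMap (q.cell j 3) =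
      SLP.codeString (oneHot (2 * q.J - 3) j) ++ [true, false] ++ SLP.codeString [false] ++
        [true, true] := by
    rw [show 2 * q.J = 2 * q.J - 3 + 1 + 1 + 1 by omega, flatMap_range_add, flatMap_range_add,
      flatMap_range_add,
      flatMap_range_eq_codeString (g := fun h => decide (h = j)) fun h hh =>
        cell_eq (by simp [Fst, hjJ]; omega) (by simp [Snd, hjJ]; omega)]
    simp only [List.range_one, List.flatMap_singleton]
    congr 1
    · congr 1
      · congr 1
        exact cell_eq (by simp [Fst, hjJ]; omega) (by simp [Snd, hjJ]; omega)
      · exact cell_eq (by simp [Fst, hjJ]; omega) (by simp [Snd, hjJ]; omega)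
    · exact cell_eq (by simp [Fst, hjJ]; omega) (by simp [Snd, hjJ]; omega)
  rw [show (4 : ℕ) = 1 + 1 + 1 + 1 from rfl, flatMap_range_add, flatMap_range_add,
    flatMap_range_add]
  simp only [List.range_one, List.flatMap_singleton, Nat.add_zero, Nat.reduceAdd, row0, row3]
  rcases lt_or_ge j q.c with hjc | hjc
  · have hc := hq.code_le j hjc
    set a := q.ltr j with ha
    have row1 : (List.range (2 * q.J)).flatMap (q.cell j 1) =
        SLP.codeString a.code ++ [true, true] ++
        SLP.codeString (List.replicate (2 * q.J - a.code.length - 1) false) := by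
      obtain ⟨d, hd⟩ : ∃ d, 2 * q.J = a.code.length + 1 + d :=
        ⟨2 * q.J - a.code.length - 1, by omega⟩
      rw [show 2 * q.J - a.code.length - 1 = d by omega, hd, flatMap_range_add, flatMap_range_add,
        List.range_one, List.flatMap_singleton,
        flatMap_range_eq_codeString (g := fun h => decide (a.code[h]? = some true)) fun h hh =>
          cell_eq (by simp [Fst, hjJ, hjc, ← ha]; omega) (by simp [Snd, hjJ, hjc, ← ha]; omega),
        flatMap_range_eq_codeString (g := fun _ => false) fun h hh =>
          cell_eq (by simp [Fst, hjJ, hjc, ← ha]; omega) (by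
            have := List.getElem?_eq_none (l := a.code) (i := a.code.length + 1 + h) (by omega)
            simp only [Snd, ← ha, this]
            simp [hjJ, hjc]
            omega),
        map_range_false]
      congr 1
      congr 1
      · congr 1
        refine List.ext_getElem (by simp) fun i h1 h2 => ?_
        simp [h2]
      · exact cell_eq (by simp [Fst, hjJ, hjc, ← ha]) (by simp [Snd, hjJ, hjc, ← ha])
    have row2 : (List.range (2 * q.J)).flatMap (q.cell j 2) =
        SLP.codeString (List.replicate (2 * q.J) false) := by
      rw [← map_range_false]
      exact flatMap_range_eq_codeString fun h hh =>
        cell_eq (by simp [Fst, hjJ, hjc]) (by simp [Snd, hjJ, hjc])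
    rw [row1, row2]
    simp only [block, rhs, dummy, if_pos hjc, List.flatMap_cons, List.flatMap_nil, SLP.codeRule,
      List.replicate_add, SLP.codeString_append, hq.a₀, List.append_assoc, List.append_nil, ← ha]
  · have hl := hq.l_lt j hjc hj
    have hr := hq.r_lt j hjc hj
    have row1 : (List.range (2 * q.J)).flatMap (q.cell j 1) =
        SLP.codeString (q.name (q.l j)) ++ [true, false] := by
      rw [show 2 * q.J = 2 * q.J - 1 + 1 by omega, flatMap_range_add,
        flatMap_range_eq_codeString (g := fun h => decide (h = q.l j)) fun h hh =>
          cell_eq (by simp [Fst, hjJ, hjc.not_gt]; omega) (by simp [Snd, hjJ, hjc.not_gt])]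
      congr 1
      rw [List.range_one, List.flatMap_singleton]
      exact cell_eq (by simp [Fst, hjJ, hjc.not_gt]; omega) (by simp [Snd, hjJ, hjc.not_gt]; omega)
    have row2 : (List.range (2 * q.J)).flatMap (q.cell j 2) =
        SLP.codeString (q.name (q.r j)) ++ [true, true] := by
      rw [show 2 * q.J = 2 * q.J - 1 + 1 by omega, flatMap_range_add,
        flatMap_range_eq_codeString (g := fun h => decide (h = q.r j)) fun h hh =>
          cell_eq (by simp [Fst, hjJ, hjc.not_gt]; omega) (by simp [Snd, hjJ, hjc.not_gt]; omega)]
      congr 1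
      rw [List.range_one, List.flatMap_singleton]
      exact cell_eq (by simp [Fst, hjJ, hjc.not_gt]; omega) (by simp [Snd, hjJ, hjc.not_gt]; omega)
    rw [row1, row2]
    simp only [block, rhs, dummy, if_neg hjc.not_gt, List.flatMap_cons, List.flatMap_nil,
      SLP.codeRule, hq.a₀, List.append_assoc, List.append_nil]

theorem Ok.encode_last :
    SLP.codeRule GenLetter.code (q.lastDummy, .letter q.a₀) ++ SLP.codeString (q.name q.st) =
      (List.range 4).flatMap fun ρ => (List.range (2 * q.J)).flatMap (q.cell (q.J - 1) ρ) := by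
  have h3 := hq.three_le
  have hst := hq.st_lt
  have hjJ : q.J - 1 + 1 = q.J := by omega
  have row0 : ∀ ρ < 2, (List.range (2 * q.J)).flatMap (q.cell (q.J - 1) ρ) =
      SLP.codeString (List.replicate (2 * q.J) false) := by
    intro ρ hρ
    rw [← map_range_false]
    exact flatMap_range_eq_codeString fun h hh =>
      cell_eq (by simp [Fst, hjJ]; omega) (by simp [Snd, hjJ]; omega)
  have row2 : (List.range (2 * q.J)).flatMap (q.cell (q.J - 1) 2) =
      SLP.codeString (List.replicate (2 * q.J - 2) false) ++ [true, false] ++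
        SLP.codeString [false] := by
    rw [show 2 * q.J = 2 * q.J - 2 + 1 + 1 by omega, flatMap_range_add, flatMap_range_add,
      flatMap_range_eq_codeString (g := fun h => false) fun h hh =>
        cell_eq (by simp [Fst, hjJ]; omega) (by simp [Snd, hjJ]), map_range_false]
    simp only [List.range_one, List.flatMap_singleton]
    congr 1
    · congr 1
      exact cell_eq (by simp [Fst, hjJ]; omega) (by simp [Snd, hjJ])
    · exact cell_eq (by simp [Fst, hjJ]; omega) (by simp [Snd, hjJ])
  have row3 : (List.range (2 * q.J)).flatMap (q.cell (q.J - 1) 3) =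
      [true, true] ++ SLP.codeString (q.name q.st) := by
    rw [show 2 * q.J = 1 + (2 * q.J - 1) by omega, flatMap_range_add,
      flatMap_range_eq_codeString (a := 2 * q.J - 1) (g := fun h => decide (h = q.st)) fun h hh =>
        cell_eq (by simp [Fst, hjJ]) (by simp [Snd, hjJ, Nat.add_comm 1])]
    simp only [List.range_one, List.flatMap_singleton]
    congr 1
    exact cell_eq (by simp [Fst, hjJ]) (by simp [Snd, hjJ])
  rw [show (4 : ℕ) = 1 + 1 + 1 + 1 from rfl, flatMap_range_add, flatMap_range_add,
    flatMap_range_add]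
  simp only [List.range_one, List.flatMap_singleton, Nat.add_zero, Nat.reduceAdd,
    row0 0 (by omega), row0 1 (by omega), row2, row3]
  simp only [lastDummy, SLP.codeRule, List.replicate_add, SLP.codeString_append, hq.a₀,
    List.append_assoc]

open Classical in
/-- The bit number `p` of the code of a query, in terms of the digits of `p` in base `4 * J`. -/
theorem Ok.encode_eq : q.prog.encode GenLetter.code =
    (List.range ((4 * q.J) ^ 2)).map fun p =>
      decide (p % (4 * q.J) % 2 = 0 ∧
          q.Fst (p / (4 * q.J) / 4) (p / (4 * q.J) % 4) (p % (4 * q.J) / 2) ∨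
        p % (4 * q.J) % 2 = 1 ∧
          q.Snd (p / (4 * q.J) / 4) (p / (4 * q.J) % 4) (p % (4 * q.J) / 2)) := by
  have h3 := hq.three_le
  have h1 : q.prog.encode GenLetter.code = (List.range q.J).flatMap fun j =>
      (List.range 4).flatMap fun ρ => (List.range (2 * q.J)).flatMap (q.cell j ρ) := by
    conv_rhs => rw [show q.J = q.J - 1 + 1 by omega, flatMap_range_add, List.range_one,
      List.flatMap_singleton, show q.J - 1 + 1 = q.J by omega]
    rw [add_zero, ← hq.encode_last, SLP.encode, prog, List.flatMap_append, List.flatMap_assoc,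
      List.append_assoc]
    congr 1
    · exact List.flatMap_congr fun j hj => hq.encode_block (by rw [List.mem_range] at hj; omega)
    · simp
  have h2 : ∀ j ρ h, q.cell j ρ h = (List.range 2).flatMap fun β =>
      [decide (β = 0 ∧ q.Fst j ρ h ∨ β = 1 ∧ q.Snd j ρ h)] := by
    intro j ρ h
    simp [List.range_succ, cell]
  have h4 : ∀ j ρ, (List.range (2 * q.J)).flatMap (q.cell j ρ) =
      (List.range (4 * q.J)).flatMap fun y =>
        [decide (y % 2 = 0 ∧ q.Fst j ρ (y / 2) ∨ y % 2 = 1 ∧ q.Snd j ρ (y / 2))] := by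
    intro j ρ
    rw [show q.cell j ρ = fun h => q.cell j ρ h from rfl]
    simp only [h2]
    rw [flatMap_range_mul, show 2 * q.J * 2 = 4 * q.J by ring]
  simp only [h1, h4]
  rw [flatMap_range_mul q.J 4, mul_comm q.J 4, flatMap_range_mul, ← pow_two,
    List.map_eq_flatMap]

end Query

/-! ### Oracle queries to a compressed word problem -/

theorem GenLetter.length_code_le {s : ℕ} (a : GenLetter s) : a.code.length ≤ s := by
  simp only [GenLetter.code, List.length_cons, List.length_replicate]
  exact a.1.2

theorem four_dvd_univ {K : ℕ} (hK : 2 ≤ K) (n : ℕ) : 4 * (univ K n / 4) = univ K n :=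
  Nat.mul_div_cancel' (pow_dvd_pow 2 (m := 2) (by omega))

theorem mul_le_univ_div_four (K n : ℕ) : K * (n + 1) ≤ univ (K + 2) n / 4 := by
  rw [Nat.le_div_iff_mul_le (by norm_num), univ, ← add_assoc, pow_add, pow_add,
    mul_comm (2 ^ n.size)]
  exact Nat.mul_le_mul (Nat.mul_le_mul Nat.lt_two_pow_self.le (Nat.lt_size_self n)) le_rfl

open Classical in
/-- The query that decides whether the value `V (J - 2)` is `1`, where `V j` is the value of the
letter `ltr j` for `j < c`, and otherwise it is the product of two earlier values, whose numbers
are described by definable relations `L` and `R`. -/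
theorem Definable.query {κ : ℕ} {B : Fin κ → Language Bool} {G : Type*} [Group G] {s : ℕ}
    {τ : Fin s → G} {o : Fin κ} (ho : B o = CWP τ) {c : ℕ} (ltr : ℕ → GenLetter s)
    {a₀ : GenLetter s} (ha₀ : a₀.code = [false])
    {L R : ℕ → List Bool → ℕ → ℕ → (ℕ → ℕ) → Prop}
    (hL : Definable B fun K x e => L K x (e 0) (e 1) fun i => e (i + 2))
    (hR : Definable B fun K x e => R K x (e 0) (e 1) fun i => e (i + 2))
    {V : ℕ → List Bool → (ℕ → ℕ) → ℕ → G} (K₁ : ℕ)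
    (hV₁ : ∀ K x e, ∀ j < c, V K x e j = evalWord τ [ltr j])
    (hV₂ : ∀ K ≥ K₁, ∀ x e, (∀ i, e i < univ K x.length) → ∀ j, c ≤ j →
      j + 1 < univ K x.length / 4 → ∃ l r, (l < j ∧ ∀ w < univ K x.length, L K x j w e ↔ w = l) ∧
        (r < j ∧ ∀ w < univ K x.length, R K x j w e ↔ w = r) ∧
        V K x e j = V K x e l * V K x e r) :
    Definable B fun K x e => V K x e (univ K x.length / 4 - 2) = 1 := by
  -- The conditions on `h` and `j` are multiplied by `2` or `4`, so that they refer to the size of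
  -- the universe.
  let F (ρ : Fin 4) (K : ℕ) (x : List Bool) (h j : ℕ) : Prop :=
    (4 * j + 3 + 1 = univ K x.length ∧
      (ρ.1 = 2 ∧ 2 * h + 3 + 1 = univ K x.length ∨ ρ.1 = 3 ∧ h = 0)) ∨
    (¬ 4 * j + 3 + 1 = univ K x.length ∧ (ρ.1 = 0 ∧ 2 * h + 1 + 1 = univ K x.length ∨
      ρ.1 = 3 ∧ (2 * h + 5 + 1 = univ K x.length ∨ 2 * h + 1 + 1 = univ K x.length) ∨
      (∃ i : Fin c, j = i ∧ ρ.1 = 1 ∧ h = (ltr i).code.length) ∨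
      (¬ j < c ∧ (ρ.1 = 1 ∨ ρ.1 = 2) ∧ 2 * h + 1 + 1 = univ K x.length)))
  let S (ρ : Fin 4) (K : ℕ) (x : List Bool) (h j : ℕ) (e : ℕ → ℕ) : Prop :=
    (4 * j + 3 + 1 = univ K x.length ∧ ρ.1 = 3 ∧ (h = 0 ∨ 4 * h + 3 + 1 = univ K x.length)) ∨
    (¬ 4 * j + 3 + 1 = univ K x.length ∧ (ρ.1 = 0 ∧ h = j ∨
      ρ.1 = 3 ∧ (h = j ∨ 2 * h + 1 + 1 = univ K x.length) ∨
      (∃ i : Fin c, ∃ m : Fin (s + 1), j = i ∧ h = m ∧ ρ.1 = 1 ∧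
        ((ltr i).code[(m : ℕ)]? = some true ∨ m = (ltr i).code.length)) ∨
      (¬ j < c ∧ (ρ.1 = 1 ∧ L K x j h e ∨
        ρ.1 = 2 ∧ (R K x j h e ∨ 2 * h + 1 + 1 = univ K x.length)))))
  have hF (ρ : Fin 4) : Definable B fun K x e => F ρ K x (e 0) (e 1) := by
    refine .or (.and (.add_const_eq_univ _ _ _) (.or (.and (.const _) (.add_const_eq_univ _ _ _))
      (.and (.const _) (.eq_const _ _)))) (.and (.not (.add_const_eq_univ _ _ _))
      (.or (.and (.const _) (.add_const_eq_univ _ _ _)) (.or (.and (.const _)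
        (.or (.add_const_eq_univ _ _ _) (.add_const_eq_univ _ _ _)))
        (.or (.exists_fin fun i => .and (.eq_const _ _) (.and (.const _) (.eq_const _ _)))
          (.and (.not (.lt_const _ _)) (.and (.const _) (.add_const_eq_univ _ _ _)))))))
  have hS (ρ : Fin 4) : Definable B fun K x e => S ρ K x (e 0) (e 1) fun i => e (i + 4) := by
    refine .or (.and (.add_const_eq_univ _ _ _) (.and (.const _)
      (.or (.eq_const _ _) (.add_const_eq_univ _ _ _)))) (.and (.not (.add_const_eq_univ _ _ _))
      (.or (.and (.const _) (.eq_var _ _)) (.or (.and (.const _)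
        (.or (.eq_var _ _) (.add_const_eq_univ _ _ _)))
        (.or (.exists_fin fun i => .exists_fin fun m => .and (.eq_const _ _)
            (.and (.eq_const _ _) (.and (.const _) (.const _))))
          (.and (.not (.lt_const _ _)) (.or (.and (.const _) ?_) (.and (.const _)
            (.or ?_ (.add_const_eq_univ _ _ _)))))))))
    · exact hL.rename fun a => if a = 0 then 1 else if a = 1 then 0 else a + 2
    · exact hR.rename fun a => if a = 0 then 1 else if a = 1 then 0 else a + 2
  have key := Definable.orc o (B := B) (P := fun K x y₀ y₁ e => ∃ j < univ K x.length,
    ∃ h < univ K x.length, ∃ ρ : Fin 4, 4 * j + ρ = y₁ ∧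
      (2 * h + 0 = y₀ ∧ F ρ K x h j ∨ 2 * h + 1 = y₀ ∧ S ρ K x h j e)) <|
    .ex (P := fun K x j e => ∃ h < univ K x.length, ∃ ρ : Fin 4, 4 * j + ρ = e 1 ∧
      (2 * h + 0 = e 0 ∧ F ρ K x h j ∨ 2 * h + 1 = e 0 ∧ S ρ K x h j fun i => e (i + 2))) <|
    .ex (P := fun K x h e => ∃ ρ : Fin 4, 4 * e 0 + ρ = e 2 ∧
      (2 * h + 0 = e 1 ∧ F ρ K x h (e 0) ∨
        2 * h + 1 = e 1 ∧ S ρ K x h (e 0) fun i => e (i + 3))) <|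
    .exists_fin fun ρ => .and (.affine _ _ _ _)
      (.or (.and (.affine 2 0 0 2) (hF ρ)) (.and (.affine _ _ _ _) (hS ρ)))
  refine key.congr_of_ge (max K₁ (c + s + 5 + 2)) fun K hK x e he => ?_
  obtain ⟨K', rfl⟩ := Nat.exists_eq_add_of_le' ((le_max_right _ _).trans hK)
  have hlarge := (Nat.le_mul_of_pos_right _ (Nat.succ_pos _)).trans
    (mul_le_univ_div_four (K' + (c + s + 5)) x.length)
  rw [add_assoc K'] at hlarge
  have hN := four_dvd_univ (K := K' + (c + s + 5 + 2)) (by omega) x.length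
  have hV₂ := hV₂ _ ((le_max_left _ _).trans hK) x e he
  have hV₁ := hV₁ (K' + (c + s + 5 + 2)) x e
  generalize K' + (c + s + 5 + 2) = K at *
  set J := univ K x.length / 4 with hJ
  choose! l r hl hr hlr using hV₂
  let q : Query s := ⟨J, c, ltr, a₀, l, r, J - 2⟩
  have hq : q.Ok :=
    { a₀ := ha₀
      three_le := by change 3 ≤ J; omega
      code_le := fun j _ => by
        have := (ltr j).length_code_le
        change (ltr j).code.length + 4 ≤ 2 * J
        omega
      l_lt := fun j h1 h2 => (hl j h1 h2).1
      r_lt := fun j h1 h2 => (hr j h1 h2).1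
      st_lt := by change J - 2 + 1 < J; omega }
  rw [ho]
  refine (hq.encode_mem_CWP_iff hV₁ hlr).symm.trans (iff_of_eq (congrArg (· ∈ CWP τ) ?_))
  rw [hq.encode_eq]
  change (List.range ((4 * J) ^ 2)).map _ = _
  rw [hN]
  refine List.map_congr_left fun p hp => decide_eq_decide.2 ?_
  rw [List.mem_range, pow_two] at hp
  have hy₀ : p % univ K x.length < 4 * J := by rw [hN]; exact Nat.mod_lt _ (univ_pos _ _)
  have hy₁ : p / univ K x.length < 4 * J := by rw [hN]; exact Nat.div_lt_of_lt_mul hp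
  generalize p % univ K x.length = y₀ at *
  generalize p / univ K x.length = y₁ at *
  have hF' (ρ : Fin 4) (j h : ℕ) (hj : j < J) : F ρ K x h j ↔ q.Fst j ρ h := by
    have e1 : 4 * j + 3 + 1 = univ K x.length ↔ j + 1 = J := by omega
    have e2 : 2 * h + 3 + 1 = univ K x.length ↔ h + 2 = 2 * J := by omega
    have e3 : 2 * h + 1 + 1 = univ K x.length ↔ h + 1 = 2 * J := by omega
    have e4 : 2 * h + 5 + 1 = univ K x.length ↔ h + 3 = 2 * J := by omega
    have e5 : (∃ i : Fin c, j = i ∧ ρ.1 = 1 ∧ h = (ltr i).code.length) ↔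
        j < c ∧ ρ.1 = 1 ∧ h = (ltr j).code.length :=
      ⟨by rintro ⟨i, rfl, h⟩; exact ⟨i.2, h⟩, fun ⟨h1, h2⟩ => ⟨⟨j, h1⟩, rfl, h2⟩⟩
    simp only [F, Query.Fst, e1, e2, e3, e4, e5, q]
  have hS' (ρ : Fin 4) (j h : ℕ) (hj : j < J) (hh : h < 2 * J) :
      S ρ K x h j e ↔ q.Snd j ρ h := by
    have e1 : 4 * j + 3 + 1 = univ K x.length ↔ j + 1 = J := by omega
    have e2 : 4 * h + 3 + 1 = univ K x.length ↔ h = J - 2 + 1 := by omega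
    have e3 : 2 * h + 1 + 1 = univ K x.length ↔ h + 1 = 2 * J := by omega
    have e4 : (∃ i : Fin c, ∃ m : Fin (s + 1), j = i ∧ h = m ∧ ρ.1 = 1 ∧
        ((ltr i).code[(m : ℕ)]? = some true ∨ m = (ltr i).code.length)) ↔
        j < c ∧ ρ.1 = 1 ∧ ((ltr j).code[h]? = some true ∨ h = (ltr j).code.length) := by
      constructor
      · rintro ⟨i, m, rfl, rfl, h⟩
        exact ⟨i.2, h⟩
      · rintro ⟨h1, h2, h3⟩
        have := (ltr j).length_code_le
        refine ⟨⟨j, h1⟩, ⟨h, ?_⟩, rfl, rfl, h2, h3⟩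
        rcases h3 with h3 | h3
        · have := (List.getElem?_eq_some_iff.1 h3).1
          omega
        · omega
    have e5 : ¬ j < c → ¬ j + 1 = J → ((L K x j h e ↔ h = l j) ∧ (R K x j h e ↔ h = r j)) :=
      fun h1 h2 => ⟨(hl j (by omega) (by omega)).2 h (by omega),
        (hr j (by omega) (by omega)).2 h (by omega)⟩
    simp only [S, Query.Snd, e1, e2, e3, e4, q]
    refine or_congr Iff.rfl (and_congr_right fun h2 => or_congr Iff.rfl (or_congr Iff.rfl
      (or_congr Iff.rfl (and_congr_right fun h1 => ?_))))
    rw [(e5 h1 h2).1, (e5 h1 h2).2]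
  constructor
  · intro H
    refine ⟨y₁ / 4, by omega, y₀ / 2, by omega, ⟨y₁ % 4, Nat.mod_lt _ (by omega)⟩,
      Nat.div_add_mod _ _, ?_⟩
    rw [hF' _ _ _ (by omega), hS' _ _ _ (by omega) (by omega)]
    exact H.imp (fun h => ⟨by omega, h.2⟩) fun h => ⟨by omega, h.2⟩
  · rintro ⟨j, hj, h, hh, ρ, rfl, H⟩
    have := ρ.2
    rw [hF' _ _ _ (by omega), hS' _ _ _ (by omega) (by omega)] at H
    rw [show (4 * j + ρ) / 4 = j by omega, show (4 * j + ρ) % 4 = ρ by omega]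
    rcases H with ⟨rfl, H⟩ | ⟨rfl, H⟩
    · exact .inl ⟨by omega, by rwa [show (2 * h + 0) / 2 = h by omega]⟩
    · exact .inr ⟨by omega, by rwa [show (2 * h + 1) / 2 = h by omega]⟩

/-! ### Sequences of products -/

/-- A list that arises from the list `l₀` if products of two members are appended repeatedly. -/
inductive MulChain {G : Type*} [Mul G] (l₀ : List G) : List G → Prop
  | base : MulChain l₀ l₀
  | mul {l : List G} {g h : G} (hl : MulChain l₀ l) (hg : g ∈ l) (hh : h ∈ l) :
      MulChain l₀ (l ++ [g * h])

namespace MulChain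

variable {G : Type*} {l₀ l : List G}

theorem isPrefix [Mul G] (h : MulChain l₀ l) : l₀ <+: l := by
  induction h with
  | base => exact List.prefix_rfl
  | mul _ _ _ ih => exact ih.trans (List.prefix_append _ _)

theorem exists_eq_mul [Monoid G] (h : MulChain l₀ l) {j : ℕ} (hj : l₀.length ≤ j)
    (hj' : j < l.length) :
    ∃ a b, a < j ∧ b < j ∧ l.getD j 1 = l.getD a 1 * l.getD b 1 := by
  induction h with
  | base => omega
  | @mul l g h hl hg hh ih =>
    rw [List.length_append, List.length_singleton] at hj'
    rcases Nat.lt_succ_iff_lt_or_eq.1 hj' with hj' | rfl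
    · obtain ⟨a, b, ha, hb, hab⟩ := ih hj'
      refine ⟨a, b, ha, hb, ?_⟩
      rwa [List.getD_append _ _ _ _ hj', List.getD_append _ _ _ _ (ha.trans hj'),
        List.getD_append _ _ _ _ (hb.trans hj')]
    · obtain ⟨a, ha, rfl⟩ := List.getElem_of_mem hg
      obtain ⟨b, hb, rfl⟩ := List.getElem_of_mem hh
      refine ⟨a, b, ha, hb, ?_⟩
      rw [List.getD_append _ _ _ _ ha, List.getD_append _ _ _ _ hb,
        List.getD_append_right _ _ _ _ le_rfl]
      simp [ha, hb]

theorem exists_mem [Monoid G] (h₀ : ∃ a ∈ l₀, ∃ b ∈ l₀, a * b = 1) {g : G}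
    (hg : g ∈ Submonoid.closure {g | g ∈ l₀}) (h : MulChain l₀ l) :
    ∃ l', MulChain l₀ l' ∧ l <+: l' ∧ g ∈ l' := by
  induction hg using Submonoid.closure_induction generalizing l with
  | mem g hg => exact ⟨l, h, List.prefix_rfl, h.isPrefix.subset hg⟩
  | one =>
    obtain ⟨a, ha, b, hb, hab⟩ := h₀
    exact ⟨_, h.mul (h.isPrefix.subset ha) (h.isPrefix.subset hb), List.prefix_append _ _,
      by simp [hab]⟩
  | mul g₁ g₂ _ _ ih₁ ih₂ =>
    obtain ⟨l₁, h₁, hp₁, hg₁⟩ := ih₁ h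
    obtain ⟨l₂, h₂, hp₂, hg₂⟩ := ih₂ h₁
    exact ⟨_, h₂.mul (hp₂.subset hg₁) hg₂, (hp₁.trans hp₂).trans (List.prefix_append _ _), by simp⟩

theorem exists_finset_subset [Monoid G] (h₀ : ∃ a ∈ l₀, ∃ b ∈ l₀, a * b = 1)
    (hG : Submonoid.closure {g | g ∈ l₀} = ⊤) (s : Finset G) :
    ∃ l, MulChain l₀ l ∧ ∀ g ∈ s, g ∈ l := by
  classical
  induction s using Finset.induction_on with
  | empty => exact ⟨l₀, base, by simp⟩
  | insert a s _ ih =>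
    obtain ⟨l, hl, hs⟩ := ih
    obtain ⟨l', hl', hp, ha⟩ := hl.exists_mem h₀ (g := a) (by rw [hG]; trivial)
    refine ⟨l', hl', fun g hg => ?_⟩
    rcases Finset.mem_insert.1 hg with rfl | hg
    exacts [ha, hp.subset (hs g hg)]

end MulChain

/-- Finitely many elements of a group occur in a straight-line sequence that begins with the
letters. -/
theorem exists_straightLine {G : Type*} [Group G] {s : ℕ} [NeZero s] {τ : Fin s → G}
    (hτ : Subgroup.closure (Set.range τ) = ⊤) (F : Finset G) :
    ∃ (c c₀ : ℕ) (ltr : ℕ → GenLetter s) (l r : ℕ → ℕ) (v : ℕ → G) (π : G → ℕ), c ≤ c₀ ∧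
      (∀ j < c, v j = evalWord τ [ltr j]) ∧
      (∀ j, c ≤ j → j < c₀ → l j < j ∧ r j < j ∧ v j = v (l j) * v (r j)) ∧
      ∀ g ∈ F, π g < c₀ ∧ v (π g) = g := by
  classical
  let c := Fintype.card (GenLetter s)
  let φ : Fin c ≃ GenLetter s := (Fintype.equivFin _).symm
  let ltr (j : ℕ) : GenLetter s := if h : j < c then φ ⟨j, h⟩ else (0, false)
  let l₀ : List G := List.ofFn fun i => evalWord τ [φ i]
  have hmem (a : GenLetter s) : evalWord τ [a] ∈ l₀ :=
    List.mem_ofFn.2 ⟨φ.symm a, by simp⟩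
  have h₀ : ∃ a ∈ l₀, ∃ b ∈ l₀, a * b = 1 :=
    ⟨_, hmem (0, false), _, hmem (0, true), by simp [evalWord]⟩
  have hG : Submonoid.closure {g | g ∈ l₀} = ⊤ := by
    rw [eq_top_iff, ← Subgroup.top_toSubmonoid, ← hτ, Subgroup.closure_toSubmonoid]
    refine Submonoid.closure_mono ?_
    rintro g (⟨i, rfl⟩ | ⟨i, hi⟩)
    · simpa [evalWord] using hmem (i, false)
    · obtain rfl : g = (τ i)⁻¹ := by rw [hi, inv_inv]
      simpa [evalWord] using hmem (i, true)
  obtain ⟨l, hl, hF⟩ := MulChain.exists_finset_subset h₀ hG F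
  have hlen : l₀.length = c := List.length_ofFn
  have hstep (j : ℕ) (h : c ≤ j ∧ j < l.length) := hl.exists_eq_mul (hlen.trans_le h.1) h.2
  choose! a b ha hb hab using hstep
  refine ⟨c, l.length, ltr, a, b, fun j => l.getD j 1, fun g => l.idxOf g,
    hlen.symm.trans_le hl.isPrefix.length_le, fun j hj => ?_,
    fun j h1 h2 => ⟨ha j ⟨h1, h2⟩, hb j ⟨h1, h2⟩, hab j ⟨h1, h2⟩⟩, fun g hg => ?_⟩
  · obtain ⟨l', rfl⟩ := hl.isPrefix
    change (l₀ ++ l').getD j 1 = _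
    rw [List.getD_append _ _ _ _ (by omega), List.getD_eq_getElem _ _ (by omega)]
    simp [l₀, ltr, hj]
  · have := List.idxOf_lt_length_of_mem (hF g hg)
    exact ⟨this, by simp [this]⟩

/-! ### Evaluation of straight-line programs in the input -/

/-- A system of rules in the input words, at positions of the words: a position may have a letter,
or two smaller positions, or none of these. -/
structure RuleSystem (α : Type) where
  letterAt : List Bool → ℕ → α → Prop
  pairAt : List Bool → ℕ → ℕ → ℕ → Prop
  letter_le : ∀ {x i a}, letterAt x i a → i ≤ x.length
  pair_le : ∀ {x i u v}, pairAt x i u v → i ≤ x.length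
  pair_lt : ∀ {x i u v}, pairAt x i u v → u < i ∧ v < i
  letter_inj : ∀ {x i a a'}, letterAt x i a → letterAt x i a' → a = a'
  pair_inj : ∀ {x i u v u' v'}, pairAt x i u v → pairAt x i u' v' → u = u' ∧ v = v'
  not_pair : ∀ {x i a u v}, letterAt x i a → ¬ pairAt x i u v

/-- Values in a group of the positions of a rule system, in dependence on a state. A letter in state
`q` has the value `κ q a`. A pair in state `q` has the product of the value of its first member in
state `q` and of the value of its second member in the state to which the first one leads. -/
structure RuleSystem.IsValue {α : Type} (S : RuleSystem α) {G : Type*} [Group G] {D : ℕ}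
    (κ : Fin D → α → G) (T : List Bool → ℕ → Fin D → Fin D) (W : List Bool → ℕ → Fin D → G) :
    Prop where
  letter : ∀ {x i a}, S.letterAt x i a → ∀ q, W x i q = κ q a
  pair : ∀ {x i u v}, S.pairAt x i u v → ∀ q, W x i q = W x u q * W x v (T x u q)
  none : ∀ {x i}, (∀ a, ¬ S.letterAt x i a) → (∀ u v, ¬ S.pairAt x i u v) → ∀ q, W x i q = 1

/-- The values of all positions of a rule system, in all states, are obtained with one query, if the
states are definable: in the program of the query, the blocks below `c₀` produce the values of the
letters, and block `D * i + (c₀ + q)` has the value of position `i` in state `q`. -/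
theorem Definable.lift {n : ℕ} {B : Fin n → Language Bool} {G : Type*} [Group G] {s : ℕ}
    {τ : Fin s → G} {o : Fin n} (ho : B o = CWP τ) (hτ : Subgroup.closure (Set.range τ) = ⊤)
    {α : Type} [Finite α] (S : RuleSystem α)
    (hletter : ∀ a, Definable B fun _ x e => S.letterAt x (e 0) a)
    (hpair : Definable B fun _ x e => S.pairAt x (e 0) (e 1) (e 2))
    {D : ℕ} {κ : Fin D → α → G} {T : List Bool → ℕ → Fin D → Fin D}
    {W : List Bool → ℕ → Fin D → G} (hW : S.IsValue κ T W)
    (hT : ∀ q q', Definable B fun _ x e => T x (e 0) q = q') (q₀ : Fin D) (k : G) :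
    Definable B fun _ x e => W x (e 0) q₀ * k = 1 := by
  classical
  rcases Nat.eq_zero_or_pos s with rfl | hs
  · have : Subsingleton G := by
      rw [← Subgroup.subsingleton_iff, ← subsingleton_iff_bot_eq_top, ← hτ, eq_comm,
        Subgroup.closure_eq_bot_iff]
      rintro _ ⟨i, -⟩
      exact i.elim0
    exact (Definable.const True).congr fun _ _ _ _ => iff_of_true (Subsingleton.elim _ _) trivial
  have : NeZero s := ⟨hs.ne'⟩
  have := Fintype.ofFinite α
  obtain ⟨c, c₀, ltr, l, r, v, π, hc, hv₁, hv₂, hπ⟩ := exists_straightLine hτ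
    ({1, k} ∪ Finset.univ.image fun p : Fin D × α => κ p.1 p.2)
  have hπ1 := hπ 1 (by simp)
  have hπk := hπ k (by simp)
  have hπκ (q a) := hπ (κ q a) (by simp)
  let pairU (K : ℕ) (x : List Bool) (i : ℕ) : Prop :=
    ∃ u < univ K x.length, ∃ v < univ K x.length, S.pairAt x i u v
  -- The left and the right factor of the value of position `i` in state `q`, which is computed in
  -- block `D * i + (c₀ + q)`.
  let left (q : Fin D) (K : ℕ) (x : List Bool) (i w : ℕ) : Prop :=
    (∃ a, S.letterAt x i a ∧ w = π (κ q a)) ∨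
    (∃ u < univ K x.length, ∃ v < univ K x.length, S.pairAt x i u v ∧ D * u + (c₀ + q) = w) ∨
    ((¬ ∃ a, S.letterAt x i a) ∧ (¬ pairU K x i) ∧ w = π 1)
  let right (q : Fin D) (K : ℕ) (x : List Bool) (i w : ℕ) : Prop :=
    ((∃ a, S.letterAt x i a) ∧ w = π 1) ∨
    (∃ u < univ K x.length, ∃ v < univ K x.length, S.pairAt x i u v ∧
      ∃ q', T x u q = q' ∧ D * v + (c₀ + (q' : ℕ)) = w) ∨
    ((¬ ∃ a, S.letterAt x i a) ∧ (¬ pairU K x i) ∧ w = π 1)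
  let L (K : ℕ) (x : List Bool) (j w : ℕ) (e : ℕ → ℕ) : Prop :=
    (∃ i : Fin c₀, j = i ∧ w = l i) ∨
    (¬ j < c₀ ∧ 4 * j + 7 + 1 = univ K x.length ∧
      ((e 0 ≤ x.length ∧ D * e 0 + (c₀ + q₀) = w) ∨ (¬ e 0 ≤ x.length ∧ w = π 1))) ∨
    (¬ 4 * j + 7 + 1 = univ K x.length ∧
      ∃ i < univ K x.length, ∃ q : Fin D, D * i + (c₀ + q) = j ∧ left q K x i w)
  let R (K : ℕ) (x : List Bool) (j w : ℕ) (e : ℕ → ℕ) : Prop :=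
    (∃ i : Fin c₀, j = i ∧ w = r i) ∨
    (¬ j < c₀ ∧ 4 * j + 7 + 1 = univ K x.length ∧ w = π k) ∨
    (¬ 4 * j + 7 + 1 = univ K x.length ∧
      ∃ i < univ K x.length, ∃ q : Fin D, D * i + (c₀ + q) = j ∧ right q K x i w)
  have hletterE : Definable B fun K x e => ∃ a, S.letterAt x (e 0) a := .exists_fin hletter
  have hpairU : Definable B fun K x e => pairU K x (e 0) :=
    .ex (P := fun K x u e => ∃ v < univ K x.length, S.pairAt x (e 0) u v) <|
    .ex (P := fun K x v e => S.pairAt x (e 1) (e 0) v) <| hpair.at₃ 2 1 0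
  have hleft (q) : Definable B fun K x e => left q K x (e 0) (e 1) := by
    refine .or (.exists_fin fun a => .and (hletter a) (.eq_const _ _)) (.or ?_
      (.and hletterE.not (.and hpairU.not (.eq_const _ _))))
    exact .ex (P := fun K x u e => ∃ v < univ K x.length, S.pairAt x (e 0) u v ∧
        D * u + (c₀ + q) = e 1) <|
      .ex (P := fun K x v e => S.pairAt x (e 1) (e 0) v ∧ D * e 0 + (c₀ + q) = e 2) <|
      .and (hpair.at₃ 2 1 0) (.affine _ _ 1 3)
  have hright (q) : Definable B fun K x e => right q K x (e 0) (e 1) := by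
    refine .or (.and hletterE (.eq_const _ _)) (.or ?_
      (.and hletterE.not (.and hpairU.not (.eq_const _ _))))
    exact .ex (P := fun K x u e => ∃ v < univ K x.length, S.pairAt x (e 0) u v ∧
        ∃ q', T x u q = q' ∧ D * v + (c₀ + (q' : ℕ)) = e 1) <|
      .ex (P := fun K x v e => S.pairAt x (e 1) (e 0) v ∧
        ∃ q', T x (e 0) q = q' ∧ D * v + (c₀ + (q' : ℕ)) = e 2) <|
      .and (hpair.at₃ 2 1 0) (.exists_fin fun q' =>
        .and ((hT q q').at₁ (Q := fun _ x u => T x u q = q') 1) (.affine _ _ 0 3))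
  have hL : Definable B fun K x e => L K x (e 0) (e 1) fun i => e (i + 2) := by
    refine .or (.exists_fin fun i => .and (.eq_const _ _) (.eq_const _ _)) (.or
      (.and (.not (.lt_const _ _)) (.and (.add_const_eq_univ _ _ _)
        (.or (.and (.le_len _) (.affine _ _ 2 _)) (.and (.not (.le_len _)) (.eq_const _ _)))))
      (.and (.not (.add_const_eq_univ _ _ _)) ?_))
    exact .ex (P := fun K x i e => ∃ q : Fin D, D * i + (c₀ + q) = e 0 ∧ left q K x i (e 1)) <|
      .exists_fin fun q => .and (.affine _ _ _ _) ((hleft q).at₂ 0 2)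
  have hR : Definable B fun K x e => R K x (e 0) (e 1) fun i => e (i + 2) := by
    refine .or (.exists_fin fun i => .and (.eq_const _ _) (.eq_const _ _)) (.or
      (.and (.not (.lt_const _ _)) (.and (.add_const_eq_univ _ _ _) (.eq_const _ _)))
      (.and (.not (.add_const_eq_univ _ _ _)) ?_))
    exact .ex (P := fun K x i e => ∃ q : Fin D, D * i + (c₀ + q) = e 0 ∧ right q K x i (e 1)) <|
      .exists_fin fun q => .and (.affine _ _ _ _) ((hright q).at₂ 0 2)
  have hD : 0 < D := q₀.pos
  let V (K : ℕ) (x : List Bool) (e : ℕ → ℕ) (j : ℕ) : G :=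
    if j < c₀ then v j else if 4 * j + 7 + 1 = univ K x.length then W x (e 0) q₀ * k
      else W x ((j - c₀) / D) ⟨(j - c₀) % D, Nat.mod_lt _ hD⟩
  have hV (K x e) (i : ℕ) (q : Fin D) (h : 4 * (D * i + (c₀ + q)) + 7 + 1 ≠ univ K x.length) :
      V K x e (D * i + (c₀ + q)) = W x i q := by
    have h1 : D * i + (c₀ + q) - c₀ = D * i + q := by omega
    simp only [V, if_neg h, if_neg (show ¬ D * i + (c₀ + q) < c₀ by omega), h1]
    congr
    · rw [Nat.mul_add_div hD, Nat.div_eq_of_lt q.2, add_zero]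
    · rw [Nat.mul_add_mod, Nat.mod_eq_of_lt q.2]
  have hVc (K x e j) (h : j < c₀) : V K x e j = v j := if_pos h
  have hlarge (K) (hK : K ≥ D + c₀ + 3 + 2) (n : ℕ) :
      D * n + D + c₀ + 3 ≤ univ K n / 4 ∧ 4 * (univ K n / 4) = univ K n := by
    obtain ⟨K', rfl⟩ := Nat.exists_eq_add_of_le' hK
    refine ⟨?_, four_dvd_univ (by omega) n⟩
    have := mul_le_univ_div_four (K' + (D + c₀ + 3)) n
    rw [add_assoc K'] at this
    refine le_trans ?_ this
    nlinarith
  have key := Definable.query ho (a₀ := (0, false)) (c := c) ltr rfl hL hR (V := V)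
    (D + c₀ + 3 + 2) (fun K x e j hj => by rw [hVc _ _ _ _ (hj.trans_le hc), hv₁ j hj]) ?_
  · refine key.congr_of_ge (D + c₀ + 3 + 2) fun K hK x e he => ?_
    have := hlarge K hK x.length
    simp only [V]
    rw [if_neg (by omega), if_pos (by omega)]
  intro K hK x e he j hj hjJ
  obtain ⟨h1, h2⟩ := hlarge K hK x.length
  rcases lt_or_ge j c₀ with hjc | hjc
  · obtain ⟨hl, hr, hlr⟩ := hv₂ j hj hjc
    have h3 : ∀ i q, D * i + (c₀ + q) ≠ j := fun i q => by omega
    have h4 : (f : ℕ → ℕ) → (w : ℕ) → (∃ i : Fin c₀, j = i ∧ w = f i) ↔ w = f j := fun f w =>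
      ⟨by rintro ⟨i, rfl, h⟩; exact h, fun h => ⟨⟨j, hjc⟩, rfl, h⟩⟩
    refine ⟨l j, r j, ⟨hl, fun w _ => ?_⟩, ⟨hr, fun w _ => ?_⟩, ?_⟩
    · simp [L, h3, h4, hjc]
    · simp [R, h3, h4, hjc]
    · rw [hVc _ _ _ _ hjc, hVc _ _ _ _ (by omega), hVc _ _ _ _ (by omega), hlr]
  have h4 : (f : ℕ → ℕ) → (w : ℕ) → ¬ (∃ i : Fin c₀, j = i ∧ w = f i) := by
    rintro f w ⟨i, rfl, -⟩
    omega
  by_cases hj2 : 4 * j + 7 + 1 = univ K x.length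
  · by_cases he0 : e 0 ≤ x.length
    · have h5 : D * e 0 ≤ D * x.length := Nat.mul_le_mul_left _ he0
      refine ⟨D * e 0 + (c₀ + q₀), π k, ⟨by omega, fun w _ => ?_⟩, ⟨by omega, fun w _ => ?_⟩, ?_⟩
      · simp [L, h4, hj2, hjc, he0, eq_comm]
      · simp [R, h4, hj2, hjc]
      · rw [hV _ _ _ _ _ (by omega), hVc _ _ _ _ hπk.1, hπk.2]
        simp only [V, if_pos hj2, if_neg hjc.not_gt]
    · refine ⟨π 1, π k, ⟨by omega, fun w _ => ?_⟩, ⟨by omega, fun w _ => ?_⟩, ?_⟩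
      · simp [L, h4, hj2, hjc, not_le.1 he0]
      · simp [R, h4, hj2, hjc]
      · rw [hVc _ _ _ _ hπ1.1, hVc _ _ _ _ hπk.1, hπk.2, hπ1.2]
        simp only [V, if_pos hj2, if_neg hjc.not_gt]
        rw [hW.none (fun a h => he0 (S.letter_le h)) (fun u v h => he0 (S.pair_le h))]
  obtain ⟨i, q, rfl⟩ : ∃ (i : ℕ) (q : Fin D), D * i + (c₀ + q) = j := by
    refine ⟨(j - c₀) / D, ⟨(j - c₀) % D, Nat.mod_lt _ hD⟩, ?_⟩
    have := Nat.div_add_mod (j - c₀) D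
    simp only
    omega
  have hiq : ∀ (i' : ℕ) (q' : Fin D), D * i' + (c₀ + q') = D * i + (c₀ + q) ↔ i' = i ∧ q' = q := by
    refine fun i' q' => ⟨fun h => ?_, by rintro ⟨rfl, rfl⟩; rfl⟩
    have h' : D * i' + q' = D * i + q := by omega
    have h5 := congrArg (· / D) h'
    have h6 := congrArg (· % D) h'
    simp only [Nat.mul_add_div hD, Nat.mul_add_mod, Nat.mod_eq_of_lt q.2, Nat.mod_eq_of_lt q'.2,
      Nat.div_eq_of_lt q.2, Nat.div_eq_of_lt q'.2] at h5 h6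
    exact ⟨by omega, Fin.ext h6⟩
  have hi : i < univ K x.length := by
    have := Nat.le_mul_of_pos_left i hD
    omega
  suffices ∃ l r, (l < D * i + (c₀ + q) ∧ ∀ w < univ K x.length, left q K x i w ↔ w = l) ∧
      (r < D * i + (c₀ + q) ∧ ∀ w < univ K x.length, right q K x i w ↔ w = r) ∧
      V K x e (D * i + (c₀ + q)) = V K x e l * V K x e r by
    obtain ⟨l, r, hl, hr, hlr⟩ := this
    refine ⟨l, r, ⟨hl.1, fun w hw => ?_⟩, ⟨hr.1, fun w hw => ?_⟩, hlr⟩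
    · rw [← hl.2 w hw]
      simp only [L, h4, hj2, hiq]
      simp [hi]
    · rw [← hr.2 w hw]
      simp only [R, h4, hj2, hiq]
      simp [hi]
  rw [hV _ _ _ _ _ hj2]
  by_cases hletter : ∃ a, S.letterAt x i a
  · obtain ⟨a, ha⟩ := hletter
    have h5 (a') : S.letterAt x i a' ↔ a' = a := ⟨fun h => S.letter_inj h ha, fun h => h ▸ ha⟩
    refine ⟨π (κ q a), π 1, ⟨by have := (hπκ q a).1; omega, fun w _ => ?_⟩,
      ⟨by omega, fun w _ => ?_⟩, ?_⟩
    · simp [left, h5, S.not_pair ha]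
    · simp [right, h5, S.not_pair ha]
    · rw [hVc _ _ _ _ (hπκ q a).1, hVc _ _ _ _ hπ1.1, (hπκ q a).2, hπ1.2, hW.letter ha, mul_one]
  by_cases hp : ∃ u v, S.pairAt x i u v
  · obtain ⟨u, v, huv⟩ := hp
    have h5 (u' v') : S.pairAt x i u' v' ↔ u' = u ∧ v' = v :=
      ⟨fun h => S.pair_inj h huv, by rintro ⟨rfl, rfl⟩; exact huv⟩
    obtain ⟨hu, hv⟩ := S.pair_lt huv
    have hu' : D * u + D ≤ D * i := by rw [← mul_add_one]; exact Nat.mul_le_mul_left _ hu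
    have hv' : D * v + D ≤ D * i := by rw [← mul_add_one]; exact Nat.mul_le_mul_left _ hv
    have hq := q.2
    have hT' := (T x u q).2
    refine ⟨D * u + (c₀ + q), D * v + (c₀ + T x u q), ⟨by omega, fun w _ => ?_⟩,
      ⟨by omega, fun w _ => ?_⟩, ?_⟩
    · have : pairU K x i := ⟨u, by omega, v, by omega, huv⟩
      simp only [left, hletter, this]
      constructor
      · rintro (⟨a, ha, -⟩ | ⟨u', -, v', -, h, rfl⟩ | h)
        · exact absurd ⟨a, ha⟩ hletter
        · rw [((h5 _ _).1 h).1]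
        · exact absurd trivial h.2.1
      · rintro rfl
        exact .inr (.inl ⟨u, by omega, v, by omega, huv, rfl⟩)
    · have : pairU K x i := ⟨u, by omega, v, by omega, huv⟩
      simp only [right, hletter, this]
      constructor
      · rintro (h | ⟨u', -, v', -, h, q', rfl, rfl⟩ | h)
        · exact h.1.elim
        · rw [((h5 _ _).1 h).1, ((h5 _ _).1 h).2]
        · exact absurd trivial h.2.1
      · rintro rfl
        exact .inr (.inl ⟨u, by omega, v, by omega, huv, _, rfl, rfl⟩)
    · rw [hV _ _ _ _ _ (by omega), hV _ _ _ _ _ (by omega), hW.pair huv]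
  · have hpU : ¬ pairU K x i := fun ⟨u, _, v, _, h⟩ => hp ⟨u, v, h⟩
    push Not at hletter hp
    refine ⟨π 1, π 1, ⟨by omega, fun w _ => ?_⟩, ⟨by omega, fun w _ => ?_⟩, ?_⟩
    · simp [left, hletter, hp, hpU]
    · simp [right, hletter, hp, hpU]
    · rw [hVc _ _ _ _ hπ1.1, hπ1.2, hW.none hletter hp, mul_one]

/-! ### Definability of names and rules in codes -/

theorem List.append_prefix_iff {α : Type*} {u v l : List α} :
    u ++ v <+: l ↔ u <+: l ∧ v <+: l.drop u.length := by
  constructor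
  · rintro ⟨t, rfl⟩
    simp [List.append_assoc]
  · rintro ⟨⟨t, rfl⟩, h⟩
    rw [List.drop_left] at h
    exact (List.prefix_append_right_inj u).2 h

theorem List.cons_prefix_drop_iff {α : Type*} {b : α} {w x : List α} {i : ℕ} :
    b :: w <+: x.drop i ↔ x[i]? = some b ∧ w <+: x.drop (i + 1) := by
  rcases lt_or_ge i x.length with h | h
  · rw [List.drop_eq_getElem_cons h, List.cons_prefix_cons, List.getElem?_eq_getElem h,
      Option.some_inj, eq_comm]
  · simp [List.drop_eq_nil_of_le h, h]

theorem lt_length_of_cons_prefix_drop {α : Type*} {b : α} {w x : List α} {i : ℕ}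
    (h : b :: w <+: x.drop i) : i < x.length :=
  (List.getElem?_eq_some_iff.1 (List.cons_prefix_drop_iff.1 h).1).1

/-- The same coded string of length `d` begins at the positions `i` and `j`. -/
def SameName (x : List Bool) (i j d : ℕ) : Prop :=
  ∃ w : List Bool, w.length = d ∧ SLP.codeString w <+: x.drop i ∧ SLP.codeString w <+: x.drop j

theorem sameName_iff {x : List Bool} {i j d : ℕ} : SameName x i j d ↔ ∀ a < d, ∃ b : Bool,
    [false, b] <+: x.drop (2 * a + i) ∧ [false, b] <+: x.drop (2 * a + j) := by
  have hcons (b : Bool) (w : List Bool) (i : ℕ) : SLP.codeString (b :: w) <+: x.drop i ↔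
      [false, b] <+: x.drop i ∧ SLP.codeString w <+: x.drop (i + 2) := by
    rw [SLP.codeString_cons, show false :: b :: SLP.codeString w = [false, b] ++ SLP.codeString w
      from rfl, List.append_prefix_iff, List.drop_drop]
    rfl
  induction d generalizing i j with
  | zero =>
    refine iff_of_true ⟨[], rfl, ?_, ?_⟩ (by simp) <;> exact List.nil_prefix
  | succ d ih =>
    constructor
    · rintro ⟨_ | ⟨b, w⟩, hw, h1, h2⟩ a ha
      · cases hw
      rw [hcons] at h1 h2
      rcases a with _ | a
      · exact ⟨b, by simpa using h1.1, by simpa using h2.1⟩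
      · have := ih.1 ⟨w, Nat.succ_injective hw, h1.2, h2.2⟩ a (by omega)
        rwa [show 2 * a + (i + 2) = 2 * (a + 1) + i by ring,
          show 2 * a + (j + 2) = 2 * (a + 1) + j by ring] at this
    · intro h
      obtain ⟨w, hw, h1, h2⟩ := (ih (i := i + 2) (j := j + 2)).2 fun a ha => by
        rw [show 2 * a + (i + 2) = 2 * (a + 1) + i by ring,
          show 2 * a + (j + 2) = 2 * (a + 1) + j by ring]
        exact h (a + 1) (by omega)
      obtain ⟨b, h3, h4⟩ := h 0 (by omega)
      rw [mul_zero, zero_add] at h3 h4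
      exact ⟨b :: w, by simp [hw], (hcons _ _ _).2 ⟨h3, h1⟩, (hcons _ _ _).2 ⟨h4, h2⟩⟩

theorem le_length_of_codeString_prefix_drop {x w : List Bool} {i : ℕ}
    (h : SLP.codeString w <+: x.drop i) : w.length ≤ x.length := by
  have := h.length_le
  rw [SLP.length_codeString, List.length_drop] at this
  omega

namespace Definable

variable {κ : ℕ} {B : Fin κ → Language Bool}

theorem prefix_drop (w : List Bool) (i : ℕ) : Definable B fun _ x e => w <+: x.drop (e i) := by
  induction w generalizing i with
  | nil => exact (const True).congr fun _ _ _ _ => by simp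
  | cons b w ih =>
    refine ((inp_const i b).and (add_const_left (P := fun _ x a _ => w <+: x.drop a) i 1
      (ih 0))).congr fun K x e _ => ?_
    rw [List.cons_prefix_drop_iff]
    refine and_congr_right fun h => (and_iff_right ?_).symm
    exact (Nat.succ_le_of_lt (List.getElem?_eq_some_iff.1 h).1).trans_lt (lt_univ _ _)

/-- A nonempty string begins at the position `2 * e i + e j`. -/
theorem cons_prefix_drop_add (b : Bool) (w : List Bool) (i j : ℕ) :
    Definable B fun _ x e => b :: w <+: x.drop (2 * e i + e j) := by
  refine (ex (P := fun K x p e => 2 * e i + 1 * e j + 0 = p ∧ b :: w <+: x.drop p)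
    ((lin 2 1 0 (i + 1) (j + 1) 0).and (prefix_drop _ 0))).congr fun K x e _ => ?_
  constructor
  · exact fun h => ⟨_, (lt_length_of_cons_prefix_drop h).trans (lt_univ _ _), by ring, h⟩
  · rintro ⟨p, -, rfl, h⟩
    simpa using h

theorem sameName (i j l : ℕ) : Definable B fun _ x e => SameName x (e i) (e j) (e l) := by
  refine (all (P := fun _ x a e => a < e l → ∃ b : Bool,
    [false, b] <+: x.drop (2 * a + e i) ∧ [false, b] <+: x.drop (2 * a + e j)) <|
    .imp (.lt _ _) <| .exists_fin fun b => .and (cons_prefix_drop_add _ _ 0 (i + 1))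
      (cons_prefix_drop_add _ _ 0 (j + 1))).congr fun K x e he => ?_
  rw [sameName_iff]
  exact ⟨fun h a _ => h a, fun h a ha => h a (ha.trans (he l)) ha⟩

end Definable

/-! ### Rules at positions of a code -/

namespace SLP

variable {α : Type} {code : α → List Bool}

/-- A semicolon ends before position `i`, or `i` is the beginning of the code. -/
def Boundary (x : List Bool) (i : ℕ) : Prop :=
  i = 0 ∨ ∃ j, i = 2 * j + 2 ∧ [true, true] <+: x.drop (2 * j)

theorem prefix_drop_codeString_append (w y : List Bool) (j : ℕ) :
    [true, true] <+: (codeString w ++ y).drop (2 * j) ↔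
      ∃ j', j = w.length + j' ∧ [true, true] <+: y.drop (2 * j') := by
  induction w generalizing j with
  | nil => simp [codeString]
  | cons b w ih =>
    rcases j with _ | j
    · simp only [codeString_cons]
      constructor
      · intro h
        simp at h
      · rintro ⟨j', h, -⟩
        simp at h
        omega
    · rw [codeString_cons, mul_add_one, List.cons_append, List.cons_append,
        List.drop_succ_cons, List.drop_succ_cons, ih]
      refine exists_congr fun j' => and_congr_left fun _ => ?_
      rw [List.length_cons]
      omega

theorem prefix_drop_comma (y : List Bool) (j : ℕ) :
    [true, true] <+: (true :: false :: y).drop (2 * j) ↔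
      ∃ j', j = j' + 1 ∧ [true, true] <+: y.drop (2 * j') := by
  rcases j with _ | j
  · simp
  · rw [mul_add_one, List.drop_succ_cons, List.drop_succ_cons]
    simp

theorem prefix_drop_semicolon (y : List Bool) (j : ℕ) :
    [true, true] <+: (true :: true :: y).drop (2 * j) ↔
      j = 0 ∨ ∃ j', j = j' + 1 ∧ [true, true] <+: y.drop (2 * j') := by
  rcases j with _ | j
  · simp
  · rw [mul_add_one, List.drop_succ_cons, List.drop_succ_cons]
    simp

theorem boundary_codeString (w : List Bool) (i : ℕ) : Boundary (codeString w) i ↔ i = 0 := by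
  have h := prefix_drop_codeString_append w []
  rw [List.append_nil] at h
  simp [Boundary, h]

theorem boundary_codeRule_append (r : List Bool × SLPRhs α) (y : List Bool) (i : ℕ) :
    Boundary (codeRule code r ++ y) i ↔
      i = 0 ∨ ∃ i', i = (codeRule code r).length + i' ∧ Boundary y i' := by
  refine or_congr_right ?_
  obtain ⟨A, a | ⟨B, C⟩⟩ := r
  · have hlen : (codeRule code (A, .letter a)).length = 2 * A.length + 2 * (code a).length + 4 := by
      simp [codeRule, length_codeString]
      ring
    simp only [codeRule_letter_append, prefix_drop_codeString_append, prefix_drop_comma,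
      prefix_drop_semicolon, hlen]
    constructor
    · rintro ⟨j, rfl, _, rfl, _, rfl, _, rfl, rfl | ⟨j, rfl, h⟩⟩
      · exact ⟨0, by ring, .inl rfl⟩
      · exact ⟨2 * j + 2, by ring, .inr ⟨j, rfl, h⟩⟩
    · rintro ⟨_, rfl, rfl | ⟨j, rfl, h⟩⟩
      · exact ⟨A.length + ((code a).length + 0 + 1), by ring, _, rfl, _, rfl, _, rfl, .inl rfl⟩
      · exact ⟨A.length + ((code a).length + (j + 1) + 1), by ring, _, rfl, _, rfl, _, rfl,
          .inr ⟨j, rfl, h⟩⟩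
  · have hlen : (codeRule code (A, .pair B C)).length =
        2 * A.length + 2 * B.length + 2 * C.length + 6 := by
      simp [codeRule, length_codeString]
      ring
    simp only [codeRule_pair_append, prefix_drop_codeString_append, prefix_drop_comma,
      prefix_drop_semicolon, hlen]
    constructor
    · rintro ⟨j, rfl, _, rfl, _, rfl, _, rfl, _, rfl, _, rfl, rfl | ⟨j, rfl, h⟩⟩
      · exact ⟨0, by ring, .inl rfl⟩
      · exact ⟨2 * j + 2, by ring, .inr ⟨j, rfl, h⟩⟩
    · rintro ⟨_, rfl, rfl | ⟨j, rfl, h⟩⟩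
      · exact ⟨A.length + (B.length + (C.length + 0 + 1) + 1), by ring, _, rfl, _, rfl, _, rfl, _,
          rfl, _, rfl, .inl rfl⟩
      · exact ⟨A.length + (B.length + (C.length + (j + 1) + 1) + 1), by ring, _, rfl, _, rfl, _,
          rfl, _, rfl, _, rfl, .inr ⟨j, rfl, h⟩⟩

theorem Boundary.le_length {x : List Bool} {i : ℕ} (h : Boundary x i) : i ≤ x.length := by
  obtain rfl | ⟨j, rfl, h⟩ := h
  · exact Nat.zero_le _
  · have := h.length_le
    rw [List.length_drop, List.length_cons, List.length_singleton] at this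
    omega

/-- The words that are codes of lists of rules followed by a name can be recognized at their
boundaries. -/
theorem exists_eq_encode_iff {x : List Bool} : (∃ P : SLP α, x = P.encode code) ↔
    ∀ i, Boundary x i → (∃ r : List Bool × SLPRhs α, codeRule code r <+: x.drop i) ∨
      ∃ w, x.drop i = codeString w := by
  constructor
  · rintro ⟨⟨R, S⟩, rfl⟩
    simp only [encode]
    induction R with
    | nil =>
      intro i hi
      obtain rfl := (boundary_codeString _ _).1 hi
      exact .inr ⟨S, rfl⟩
    | cons r R ih =>
      intro i hi
      rw [List.flatMap_cons, List.append_assoc] at hi ⊢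
      obtain rfl | ⟨i, rfl, hi'⟩ := (boundary_codeRule_append _ _ _).1 hi
      · exact .inl ⟨r, List.prefix_append _ _⟩
      · rw [List.drop_append, List.drop_eq_nil_of_le (by omega), List.nil_append,
          Nat.add_sub_cancel_left]
        exact ih i hi'
  · intro h
    induction hn : x.length using Nat.strong_induction_on generalizing x with
    | _ n ih =>
      obtain ⟨r, y, hy⟩ | ⟨w, hw⟩ := h 0 (.inl rfl)
      · rw [List.drop_zero] at hy
        subst hy
        obtain ⟨P, rfl⟩ := ih y.length (by
          obtain ⟨s, hs⟩ := codeRule_append (code := code) r []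
          have := congrArg List.length hs
          simp only [List.length_append, List.length_cons, List.length_nil] at this hn
          omega) (fun i hi => by
            have := h _ ((boundary_codeRule_append r y _).2 (.inr ⟨i, rfl, hi⟩))
            rwa [List.drop_append, List.drop_eq_nil_of_le (by omega), List.nil_append,
              Nat.add_sub_cancel_left] at this) rfl
        exact ⟨⟨r :: P.rules, P.start⟩, by simp [encode]⟩
      · exact ⟨⟨[], w⟩, hw⟩

variable (code)

/-- The rule `r` is coded at position `i`. -/
def RuleAt (x : List Bool) (i : ℕ) (r : List Bool × SLPRhs α) : Prop :=
  Boundary x i ∧ codeRule code r <+: x.drop i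

/-- The position of rule number `k` in the code of the rules `R`. -/
def rulePos (R : List (List Bool × SLPRhs α)) (k : ℕ) : ℕ :=
  ((R.take k).flatMap (codeRule code)).length

/-- A rule for the variable `A` is coded at position `i`. -/
def NameAt (x : List Bool) (i : ℕ) (A : List Bool) : Prop :=
  ∃ rhs, RuleAt code x i (A, rhs)

/-- The name of the start variable is `A`, for the code of a program. -/
def StartName (x : List Bool) (A : List Bool) : Prop :=
  ∃ i, Boundary x i ∧ x.drop i = codeString A

variable {code}

theorem ruleAt_encode (hcode : Function.Injective code) (P : SLP α) (i : ℕ)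
    (r : List Bool × SLPRhs α) :
    RuleAt code (P.encode code) i r ↔ ∃ k, P.rules[k]? = some r ∧ i = rulePos code P.rules k := by
  obtain ⟨R, S⟩ := P
  simp only [encode, RuleAt]
  induction R generalizing i with
  | nil =>
    rw [List.flatMap_nil, List.nil_append, boundary_codeString]
    refine iff_of_false ?_ (by simp)
    rintro ⟨rfl, t, h⟩
    exact codeRule_append_ne _ _ _ h
  | cons r' R ih =>
    rw [List.flatMap_cons, List.append_assoc, boundary_codeRule_append]
    constructor
    · rintro ⟨rfl | ⟨i, rfl, hi⟩, h⟩
      · obtain ⟨t, ht⟩ := h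
        exact ⟨0, by simp [(codeRule_append_inj hcode ht).1], rfl⟩
      · rw [List.drop_append, List.drop_eq_nil_of_le (by omega), List.nil_append,
          Nat.add_sub_cancel_left] at h
        obtain ⟨k, hk, rfl⟩ := (ih i).1 ⟨hi, h⟩
        exact ⟨k + 1, hk, by simp [rulePos]⟩
    · rintro ⟨_ | k, hk, rfl⟩
      · cases hk
        exact ⟨.inl rfl, List.prefix_append _ _⟩
      · obtain ⟨h1, h2⟩ := (ih (rulePos code R k)).2 ⟨k, hk, rfl⟩
        refine ⟨.inr ⟨rulePos code R k, by simp [rulePos], h1⟩, ?_⟩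
        rwa [show rulePos code (r' :: R) (k + 1) = (codeRule code r').length + rulePos code R k by
          simp [rulePos], List.drop_append, List.drop_eq_nil_of_le (by omega), List.nil_append,
          Nat.add_sub_cancel_left]

theorem startName_encode (P : SLP α) (A : List Bool) :
    StartName (P.encode code) A ↔ A = P.start := by
  obtain ⟨R, S⟩ := P
  simp only [encode, StartName]
  induction R with
  | nil =>
    simp only [List.flatMap_nil, List.nil_append, boundary_codeString, exists_eq_left,
      List.drop_zero]
    exact codeString_injective.eq_iff.trans eq_comm
  | cons r R ih =>
    simp only [List.flatMap_cons, List.append_assoc, boundary_codeRule_append]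
    rw [← ih]
    constructor
    · rintro ⟨_, rfl | ⟨i, rfl, hi⟩, h⟩
      · exact absurd h (codeRule_append_ne _ _ _)
      · rw [List.drop_append, List.drop_eq_nil_of_le (by omega), List.nil_append,
          Nat.add_sub_cancel_left] at h
        exact ⟨i, hi, h⟩
    · rintro ⟨i, hi, h⟩
      refine ⟨_, .inr ⟨i, rfl, hi⟩, ?_⟩
      rwa [List.drop_append, List.drop_eq_nil_of_le (by omega), List.nil_append,
        Nat.add_sub_cancel_left]

theorem rulePos_lt {R : List (List Bool × SLPRhs α)} {k l : ℕ} (hk : k < R.length) :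
    rulePos code R k < rulePos code R l ↔ k < l := by
  have hmono : Monotone (rulePos code R) := fun a b hab => by
    refine List.Sublist.length_le ((List.take_prefix_take_left hab).sublist.flatMap _)
  have hsucc : rulePos code R k < rulePos code R (k + 1) := by
    obtain ⟨s, hs⟩ := codeRule_append (code := code) R[k] []
    have := congrArg List.length hs
    simp only [List.append_nil, List.length_append, List.length_cons] at this
    simp only [rulePos, List.take_succ_eq_append_getElem hk, List.flatMap_append,
      List.length_append, List.flatMap_singleton]
    omega
  constructor
  · intro h
    by_contra hlk
    exact absurd (hmono (not_lt.1 hlk)) (not_le.2 h)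
  · intro h
    exact hsucc.trans_le (hmono h)

theorem rulePos_inj {R : List (List Bool × SLPRhs α)} {k l : ℕ} (hk : k < R.length)
    (hl : l < R.length) (h : rulePos code R k = rulePos code R l) : k = l := by
  have h1 := rulePos_lt (code := code) (l := l) hk
  have h2 := rulePos_lt (code := code) (l := k) hl
  omega

end SLP

/-! ### Derived words at positions of a code -/

namespace SLP

variable {α : Type} (code : α → List Bool)

/-- The word is the code of a well-formed straight-line program. -/
def IsCode (x : List Bool) : Prop := ∃ P : SLP α, P.WellFormed ∧ x = P.encode code

/-- A rule at position `i` has the variables with rules at `u` and `v` on its right-hand side. -/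
def PairAt (x : List Bool) (i u v : ℕ) : Prop :=
  ∃ A B C, RuleAt code x i (A, .pair B C) ∧ NameAt code x u B ∧ NameAt code x v C

variable {code} (hcode : Function.Injective code) (P : SLP α)

include hcode

theorem nameAt_encode (i : ℕ) (A : List Bool) : NameAt code (P.encode code) i A ↔
    ∃ k rhs, P.rules[k]? = some (A, rhs) ∧ i = rulePos code P.rules k := by
  simp only [NameAt, ruleAt_encode hcode]
  exact exists_comm

theorem nodup_iff_nameAt : (P.rules.map Prod.fst).Nodup ↔
    ∀ i i' A, NameAt code (P.encode code) i A → NameAt code (P.encode code) i' A → i = i' := by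
  simp only [nameAt_encode hcode]
  constructor
  · rintro h _ _ A ⟨k, rhs, hk, rfl⟩ ⟨k', rhs', hk', rfl⟩
    have hk0 : k < (P.rules.map Prod.fst).length := by
      rw [List.length_map]
      exact (List.getElem?_eq_some_iff.1 hk).1
    rw [(List.getElem?_inj (j := k') hk0 h).1 (by simp [hk, hk'])]
  · intro h
    rw [List.nodup_iff_getElem?_ne_getElem?]
    intro k k' hkk' hk' heq
    rw [List.length_map] at hk'
    have hk : k < P.rules.length := hkk'.trans hk'
    simp only [List.getElem?_map, List.getElem?_eq_getElem hk, List.getElem?_eq_getElem hk',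
      Option.map_some, Option.some_inj] at heq
    have := h _ _ P.rules[k].1 ⟨k, P.rules[k].2, List.getElem?_eq_getElem hk, rfl⟩
      ⟨k', P.rules[k'].2, by rw [heq]; exact List.getElem?_eq_getElem hk', rfl⟩
    exact hkk'.ne (rulePos_inj hk hk' this)

omit hcode in
theorem mem_take_iff (k : ℕ) (B : List Bool) : B ∈ (P.rules.take k).map Prod.fst ↔
    ∃ l < k, ∃ rhs, P.rules[l]? = some (B, rhs) := by
  simp only [List.mem_map, List.mem_take_iff_getElem, Prod.exists, exists_and_right,
    exists_eq_right, List.getElem?_eq_some_iff]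
  constructor
  · rintro ⟨rhs, l, hl, h⟩
    exact ⟨l, by omega, rhs, by omega, h⟩
  · rintro ⟨l, hl, rhs, hl', h⟩
    exact ⟨rhs, l, by omega, h⟩

omit hcode in
theorem split_of_getElem? {k : ℕ} {r : List Bool × SLPRhs α} (h : P.rules[k]? = some r) :
    P.rules = P.rules.take k ++ r :: P.rules.drop (k + 1) := by
  obtain ⟨hk, rfl⟩ := List.getElem?_eq_some_iff.1 h
  rw [List.getElem_cons_drop, List.take_append_drop]

/-- The smaller variables of a program are those with rules at smaller positions. -/
theorem smaller_iff_nameAt : (∀ l₁ l₂ A B C, P.rules = l₁ ++ (A, SLPRhs.pair B C) :: l₂ →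
      B ∈ l₁.map Prod.fst ∧ C ∈ l₁.map Prod.fst) ↔
    ∀ i A B C, RuleAt code (P.encode code) i (A, .pair B C) →
      (∃ u < i, NameAt code (P.encode code) u B) ∧ ∃ v < i, NameAt code (P.encode code) v C := by
  simp only [ruleAt_encode hcode, nameAt_encode hcode]
  have key (k : ℕ) (hk : k < P.rules.length) (B : List Bool) :
      B ∈ (P.rules.take k).map Prod.fst ↔ ∃ u < rulePos code P.rules k,
        ∃ l rhs, P.rules[l]? = some (B, rhs) ∧ u = rulePos code P.rules l := by
    rw [mem_take_iff]
    constructor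
    · rintro ⟨l, hl, rhs, h⟩
      exact ⟨_, (rulePos_lt (hl.trans hk)).2 hl, l, rhs, h, rfl⟩
    · rintro ⟨_, hl, l, rhs, h, rfl⟩
      exact ⟨l, (rulePos_lt (List.getElem?_eq_some_iff.1 h).1).1 hl, rhs, h⟩
  constructor
  · rintro h _ A B C ⟨k, hk, rfl⟩
    have hk' := (List.getElem?_eq_some_iff.1 hk).1
    rw [← key k hk', ← key k hk']
    exact h _ _ A B C (split_of_getElem? P hk)
  · intro h l₁ l₂ A B C hl
    have hk : l₁.length < P.rules.length := by simp [hl]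
    have := h _ A B C ⟨l₁.length, by simp [hl], rfl⟩
    rwa [← key _ hk, ← key _ hk, hl, List.take_left] at this

/-- Well-formedness in terms of positions: the rules define distinct names, the right-hand sides use
names defined at smaller positions, and the start variable is defined. -/
theorem wellFormed_iff : P.WellFormed ↔
    (∀ i i' A, NameAt code (P.encode code) i A → NameAt code (P.encode code) i' A → i = i') ∧
    (∀ i A B C, RuleAt code (P.encode code) i (A, .pair B C) →
      (∃ u < i, NameAt code (P.encode code) u B) ∧ ∃ v < i, NameAt code (P.encode code) v C) ∧
    ∃ u A, StartName (P.encode code) A ∧ NameAt code (P.encode code) u A := by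
  have h3 : P.start ∈ P.rules.map Prod.fst ↔
      ∃ u A, StartName (P.encode code) A ∧ NameAt code (P.encode code) u A := by
    simp only [startName_encode, exists_eq_left, nameAt_encode hcode]
    rw [← P.rules.take_length, mem_take_iff, List.take_length]
    constructor
    · rintro ⟨l, -, rhs, h⟩
      exact ⟨_, l, rhs, h, rfl⟩
    · rintro ⟨_, l, rhs, h, rfl⟩
      exact ⟨l, (List.getElem?_eq_some_iff.1 h).1, rhs, h⟩
  rw [← nodup_iff_nameAt hcode, ← smaller_iff_nameAt hcode, ← h3]
  exact ⟨fun h => ⟨h.nodup, h.smaller, h.start_mem⟩, fun h => ⟨h.1, h.2.1, h.2.2⟩⟩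

theorem RuleAt.inj {x : List Bool} {i : ℕ} {r r' : List Bool × SLPRhs α} (h : RuleAt code x i r)
    (h' : RuleAt code x i r') : r = r' := by
  obtain ⟨-, t, ht⟩ := h
  obtain ⟨-, t', ht'⟩ := h'
  exact (codeRule_append_inj hcode (ht.trans ht'.symm)).1

omit hcode in
variable (code) in
open Classical in
/-- The word that is derived from the variable with a rule at position `i`. It is empty if there is
no such variable. -/
noncomputable def wordAt (x : List Bool) (i : ℕ) : List α :=
  if h : ∃ (P : SLP α) (A : List Bool), P.WellFormed ∧ x = P.encode code ∧ NameAt code x i A then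
    h.choose.values h.choose_spec.choose
  else []

variable {P}

theorem WellFormed.wordAt_encode (hP : P.WellFormed) {i : ℕ} {A : List Bool}
    (h : NameAt code (P.encode code) i A) : wordAt code (P.encode code) i = P.values A := by
  have H : ∃ (P' : SLP α) (A : List Bool), P'.WellFormed ∧ P.encode code = P'.encode code ∧
      NameAt code (P.encode code) i A := ⟨P, A, hP, rfl, h⟩
  rw [wordAt, dif_pos H]
  obtain ⟨-, h2, rhs', h3⟩ := H.choose_spec.choose_spec
  obtain ⟨rhs, h⟩ := h
  exact (congrArg _ (Prod.mk.inj (RuleAt.inj hcode h3 h)).1).trans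
    (congrFun (congrArg values (encode_injective hcode h2).symm) A)

theorem WellFormed.wordAt_letter (hP : P.WellFormed) {i : ℕ} {A : List Bool} {a : α}
    (h : RuleAt code (P.encode code) i (A, .letter a)) : wordAt code (P.encode code) i = [a] := by
  rw [hP.wordAt_encode hcode ⟨_, h⟩]
  obtain ⟨k, hk, rfl⟩ := (ruleAt_encode hcode P _ _).1 h
  exact (hP.values_eq (split_of_getElem? P hk)).1 a rfl

theorem WellFormed.wordAt_pair (hP : P.WellFormed) {i u v : ℕ}
    (h : PairAt code (P.encode code) i u v) : wordAt code (P.encode code) i =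
      wordAt code (P.encode code) u ++ wordAt code (P.encode code) v := by
  obtain ⟨A, B, C, h, hB, hC⟩ := h
  rw [hP.wordAt_encode hcode ⟨_, h⟩, hP.wordAt_encode hcode hB, hP.wordAt_encode hcode hC]
  obtain ⟨k, hk, rfl⟩ := (ruleAt_encode hcode P _ _).1 h
  exact (hP.values_eq (split_of_getElem? P hk)).2 B C rfl

/-- The rules in the codes of straight-line programs. -/
def ruleSystem : RuleSystem α where
  letterAt x i a := IsCode code x ∧ ∃ A, RuleAt code x i (A, .letter a)
  pairAt x i u v := IsCode code x ∧ PairAt code x i u v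
  letter_le := fun ⟨_, _, h⟩ => h.1.le_length
  pair_le := fun ⟨_, _, _, _, h, _⟩ => h.1.le_length
  pair_lt := by
    rintro _ i u v ⟨⟨P, hP, rfl⟩, A, B, C, h, hB, hC⟩
    obtain ⟨h1, h2, -⟩ := (wellFormed_iff hcode P).1 hP
    obtain ⟨⟨u', hu', hB'⟩, v', hv', hC'⟩ := h2 _ _ _ _ h
    rw [h1 _ _ _ hB hB', h1 _ _ _ hC hC']
    exact ⟨hu', hv'⟩
  letter_inj := by
    rintro x i a a' ⟨-, A, h⟩ ⟨-, A', h'⟩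
    cases RuleAt.inj hcode h h'
    rfl
  pair_inj := by
    rintro _ i u v u' v' ⟨⟨P, hP, rfl⟩, A, B, C, h, hB, hC⟩ ⟨-, A', B', C', h', hB', hC'⟩
    cases RuleAt.inj hcode h h'
    obtain ⟨h1, -⟩ := (wellFormed_iff hcode P).1 hP
    exact ⟨h1 _ _ _ hB hB', h1 _ _ _ hC hC'⟩
  not_pair := by
    rintro x i a u v ⟨-, A, h⟩ ⟨-, A', B', C', h', -⟩
    cases RuleAt.inj hcode h h'

theorem wordAt_of_letterAt {x : List Bool} {i : ℕ} {a : α}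
    (h : (ruleSystem hcode).letterAt x i a) : wordAt code x i = [a] := by
  obtain ⟨⟨P, hP, rfl⟩, A, h⟩ := h
  exact hP.wordAt_letter hcode h

theorem wordAt_of_pairAt {x : List Bool} {i u v : ℕ} (h : (ruleSystem hcode).pairAt x i u v) :
    wordAt code x i = wordAt code x u ++ wordAt code x v := by
  obtain ⟨⟨P, hP, rfl⟩, h⟩ := h
  exact hP.wordAt_pair hcode h

theorem wordAt_of_forall_not {x : List Bool} {i : ℕ}
    (h1 : ∀ a, ¬ (ruleSystem hcode).letterAt x i a)
    (h2 : ∀ u v, ¬ (ruleSystem hcode).pairAt x i u v) : wordAt code x i = [] := by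
  rw [wordAt, dif_neg]
  rintro ⟨P, A, hP, rfl, a | ⟨B, C⟩, h⟩
  · exact h1 a ⟨⟨P, hP, rfl⟩, A, h⟩
  · obtain ⟨-, h3, -⟩ := (wellFormed_iff hcode P).1 hP
    obtain ⟨⟨u, -, hu⟩, v, -, hv⟩ := h3 _ _ _ _ h
    exact h2 u v ⟨⟨P, hP, rfl⟩, A, B, C, h, hu, hv⟩

end SLP

theorem mem_CWP_iff {G : Type*} [Group G] {r : ℕ} (σ : Fin r → G) (x : List Bool) :
    x ∈ CWP σ ↔ SLP.IsCode (GenLetter.code (r := r)) x ∧ ∃ u A, SLP.StartName x A ∧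
      SLP.NameAt (GenLetter.code (r := r)) x u A ∧
        evalWord σ (SLP.wordAt GenLetter.code x u) = 1 := by
  have hc := GenLetter.code_injective (r := r)
  have h : ∀ P : SLP (GenLetter r), P.WellFormed → (P.encode GenLetter.code ∈ CWP σ ↔
      ∃ u A, SLP.StartName (P.encode GenLetter.code) A ∧
      SLP.NameAt (GenLetter.code (r := r)) (P.encode GenLetter.code) u A ∧
        evalWord σ (SLP.wordAt GenLetter.code (P.encode GenLetter.code) u) = 1) := by
    intro P hP
    rw [encode_mem_CWP σ hP]
    constructor
    · intro h
      obtain ⟨-, -, u, A, hA, hu⟩ := (SLP.wellFormed_iff hc P).1 hP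
      refine ⟨u, A, hA, hu, ?_⟩
      rwa [hP.wordAt_encode hc hu, (SLP.startName_encode P A).1 hA]
    · rintro ⟨u, A, hA, hu, h⟩
      rwa [hP.wordAt_encode hc hu, (SLP.startName_encode P A).1 hA] at h
  constructor
  · rintro ⟨P, hP, rfl, h'⟩
    exact ⟨⟨P, hP, rfl⟩, (h P hP).1 ⟨P, hP, rfl, h'⟩⟩
  · rintro ⟨⟨P, hP, rfl⟩, h'⟩
    exact (h P hP).2 h'

/-! ### Definability of rules and of the set of codes -/

namespace SLP

theorem codeString_append_prefix_drop_iff {w t x : List Bool} {i : ℕ} :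
    codeString w ++ t <+: x.drop i ↔
      codeString w <+: x.drop i ∧ t <+: x.drop (2 * w.length + i) := by
  rw [List.append_prefix_iff, List.drop_drop, length_codeString, add_comm i]

/-- The coded string at position `i`, which is followed by `t`, is the coded string at position
`j`, which is followed by `t'`. -/
def SameTerm (t t' x : List Bool) (i j : ℕ) : Prop :=
  ∃ w, codeString w ++ t <+: x.drop i ∧ codeString w ++ t' <+: x.drop j

theorem sameTerm_iff {t t' x : List Bool} {i j : ℕ} : SameTerm t t' x i j ↔
    ∃ d ≤ x.length, SameName x i j d ∧ t <+: x.drop (2 * d + i) ∧ t' <+: x.drop (2 * d + j) := by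
  simp only [SameTerm, codeString_append_prefix_drop_iff]
  constructor
  · rintro ⟨w, ⟨h1, h2⟩, h3, h4⟩
    exact ⟨w.length, le_length_of_codeString_prefix_drop h1, ⟨w, rfl, h1, h3⟩, h2, h4⟩
  · rintro ⟨_, -, ⟨w, rfl, h1, h3⟩, h2, h4⟩
    exact ⟨w, ⟨h1, h2⟩, h3, h4⟩

/-- A coded string that is followed by a comma begins at position `i`, and `p` is the position after
the comma. -/
def CommaBefore (x : List Bool) (i p : ℕ) : Prop :=
  ∃ w, codeString w ++ [true, false] <+: x.drop i ∧ p = 2 * w.length + i + 2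

theorem CommaBefore.le_length {x : List Bool} {i p : ℕ} (h : CommaBefore x i p) :
    p ≤ x.length := by
  obtain ⟨w, h, rfl⟩ := h
  have := (codeString_append_prefix_drop_iff.1 h).2.length_le
  rw [List.length_drop, List.length_cons, List.length_singleton] at this
  omega

theorem commaBefore_iff {x : List Bool} {i p : ℕ} : CommaBefore x i p ↔
    ∃ d ≤ x.length, SameName x i i d ∧ [true, false] <+: x.drop (2 * d + i) ∧
      p = 2 * d + i + 2 := by
  simp only [CommaBefore, codeString_append_prefix_drop_iff]
  constructor
  · rintro ⟨w, ⟨h1, h2⟩, h3⟩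
    exact ⟨w.length, le_length_of_codeString_prefix_drop h1, ⟨w, rfl, h1, h1⟩, h2, h3⟩
  · rintro ⟨_, -, ⟨w, rfl, h1, -⟩, h2, h3⟩
    exact ⟨w, ⟨h1, h2⟩, h3⟩

theorem eq_of_codeString_append_prefix {v w s t l : List Bool}
    (h : codeString v ++ true :: s <+: l) (h' : codeString w ++ true :: t <+: l) : v = w := by
  obtain ⟨u, rfl⟩ := h
  obtain ⟨u', h'⟩ := h'
  simp only [List.append_assoc, List.cons_append] at h'
  exact (codeString_append_inj h').1.symm

variable {α : Type} {code : α → List Bool}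

theorem codeRule_letter_prefix_iff {x A : List Bool} {i : ℕ} {a : α} :
    codeRule code (A, .letter a) <+: x.drop i ↔
      codeString A ++ true :: false :: (codeString (code a) ++ [true, true]) <+: x.drop i := by
  simp [codeRule]

theorem codeRule_pair_prefix_iff {x A B C : List Bool} {i : ℕ} :
    codeRule code (A, .pair B C) <+: x.drop i ↔ codeString A ++ [true, false] <+: x.drop i ∧
      codeString B ++ [true, false] <+: x.drop (2 * A.length + i + 2) ∧
      codeString C ++ [true, true] <+: x.drop (2 * B.length + (2 * A.length + i + 2) + 2) := by
  rw [show codeRule code (A, .pair B C) = (codeString A ++ [true, false]) ++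
    ((codeString B ++ [true, false]) ++ (codeString C ++ [true, true])) by simp [codeRule]]
  rw [List.append_prefix_iff, List.append_prefix_iff (u := codeString B ++ _)]
  simp only [List.drop_drop, List.length_append, length_codeString, List.length_cons,
    List.length_nil]
  ring_nf

variable (code)

/-- Some rule is coded at position `i`. -/
def IsRuleAt (x : List Bool) (i : ℕ) : Prop := ∃ r, RuleAt code x i r

/-- A rule with two variables on its right-hand side is coded at position `i`. -/
def IsPairAt (x : List Bool) (i : ℕ) : Prop := ∃ A B C, RuleAt code x i (A, .pair B C)

variable {code}

theorem isPairAt_iff {x : List Bool} {i : ℕ} : IsPairAt code x i ↔ Boundary x i ∧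
    ∃ p ≤ x.length, ∃ q ≤ x.length, CommaBefore x i p ∧ CommaBefore x p q ∧
      SameTerm [true, true] [true, true] x q q := by
  simp only [IsPairAt, RuleAt, codeRule_pair_prefix_iff]
  constructor
  · rintro ⟨A, B, C, h, hA, hB, hC⟩
    have hp : CommaBefore x i _ := ⟨A, hA, rfl⟩
    have hq : CommaBefore x _ _ := ⟨B, hB, rfl⟩
    exact ⟨h, _, hp.le_length, _, hq.le_length, hp, hq, C, hC, hC⟩
  · rintro ⟨h, _, -, _, -, ⟨A, hA, rfl⟩, ⟨B, hB, rfl⟩, C, hC, -⟩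
    exact ⟨A, B, C, h, hA, hB, hC⟩

theorem isRuleAt_iff {x : List Bool} {i : ℕ} : IsRuleAt code x i ↔
    (∃ a A, RuleAt code x i (A, .letter a)) ∨ IsPairAt code x i := by
  constructor
  · rintro ⟨⟨A, a | ⟨B, C⟩⟩, h⟩
    exacts [.inl ⟨a, A, h⟩, .inr ⟨A, B, C, h⟩]
  · rintro (⟨a, A, h⟩ | ⟨A, B, C, h⟩)
    exacts [⟨_, h⟩, ⟨_, h⟩]

theorem nameAt_iff {x A : List Bool} {i : ℕ} : NameAt code x i A ↔
    IsRuleAt code x i ∧ codeString A ++ [true, false] <+: x.drop i := by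
  have h (r : List Bool × SLPRhs α) (h : codeRule code r <+: x.drop i) :
      codeString r.1 ++ [true, false] <+: x.drop i := by
    obtain ⟨s, hs⟩ := codeRule_append (code := code) r []
    refine List.IsPrefix.trans ⟨s, ?_⟩ h
    rw [List.append_nil] at hs
    simp [hs]
  constructor
  · rintro ⟨rhs, h'⟩
    exact ⟨⟨_, h'⟩, h _ h'.2⟩
  · rintro ⟨⟨⟨A', rhs⟩, h'⟩, hA⟩
    obtain rfl := eq_of_codeString_append_prefix hA (h _ h'.2)
    exact ⟨rhs, h'⟩

theorem pairAt_iff {x : List Bool} {i u v : ℕ} : PairAt code x i u v ↔ Boundary x i ∧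
    ∃ p ≤ x.length, ∃ q ≤ x.length, CommaBefore x i p ∧ CommaBefore x p q ∧
      (IsRuleAt code x u ∧ SameTerm [true, false] [true, false] x p u) ∧
      IsRuleAt code x v ∧ SameTerm [true, true] [true, false] x q v := by
  simp only [PairAt, RuleAt, codeRule_pair_prefix_iff, nameAt_iff]
  constructor
  · rintro ⟨A, B, C, ⟨h, hA, hB, hC⟩, ⟨hu, hu'⟩, hv, hv'⟩
    have hp : CommaBefore x i _ := ⟨A, hA, rfl⟩
    have hq : CommaBefore x _ _ := ⟨B, hB, rfl⟩
    exact ⟨h, _, hp.le_length, _, hq.le_length, hp, hq, ⟨hu, B, hB, hu'⟩, hv, C, hC, hv'⟩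
  · rintro ⟨h, _, -, _, -, ⟨A, hA, rfl⟩, ⟨B, hB, rfl⟩, ⟨hu, B', hB', hu'⟩, hv, C, hC, hv'⟩
    obtain rfl := eq_of_codeString_append_prefix hB hB'
    exact ⟨A, B, C, ⟨h, hA, hB, hC⟩, ⟨hu, hu'⟩, hv, hv'⟩

theorem startName_nameAt_iff {x : List Bool} {u : ℕ} :
    (∃ A, StartName x A ∧ NameAt code x u A) ↔ IsRuleAt code x u ∧ ∃ i ≤ x.length, Boundary x i ∧
      ∃ d ≤ x.length, SameName x i u d ∧ 2 * d + i = x.length ∧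
        [true, false] <+: x.drop (2 * d + u) := by
  simp only [StartName, nameAt_iff, codeString_append_prefix_drop_iff]
  constructor
  · rintro ⟨A, ⟨i, hi, h⟩, hu, h1, h2⟩
    refine ⟨hu, i, hi.le_length, hi, A.length, le_length_of_codeString_prefix_drop h1,
      ⟨A, rfl, h ▸ List.prefix_rfl, h1⟩, ?_, h2⟩
    have := congrArg List.length h
    rw [List.length_drop, length_codeString] at this
    have := hi.le_length
    omega
  · rintro ⟨hu, i, -, hi, _, -, ⟨A, rfl, h, h1⟩, h3, h2⟩
    refine ⟨A, ⟨i, hi, (h.eq_of_length ?_).symm⟩, hu, h1, h2⟩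
    rw [List.length_drop, length_codeString]
    omega

theorem drop_eq_codeString_iff {x : List Bool} {i : ℕ} (hi : i ≤ x.length) :
    (∃ w, x.drop i = codeString w) ↔ ∃ d ≤ x.length, SameName x i i d ∧ 2 * d + i = x.length := by
  constructor
  · rintro ⟨w, h⟩
    have hw : codeString w <+: x.drop i := h ▸ List.prefix_rfl
    refine ⟨w.length, le_length_of_codeString_prefix_drop hw, ⟨w, rfl, hw, hw⟩, ?_⟩
    have := congrArg List.length h
    rw [List.length_drop, length_codeString] at this
    omega
  · rintro ⟨_, -, ⟨w, rfl, h, -⟩, h3⟩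
    refine ⟨w, (h.eq_of_length ?_).symm⟩
    rw [List.length_drop, length_codeString]
    omega

/-- Being the code of a well-formed program, with bounded quantifiers over positions and without
reference to the program. -/
theorem isCode_iff (hcode : Function.Injective code) {x : List Bool} : IsCode code x ↔
    (∀ i ≤ x.length, Boundary x i → IsRuleAt code x i ∨
      ∃ d ≤ x.length, SameName x i i d ∧ 2 * d + i = x.length) ∧
    (∀ i ≤ x.length, ∀ j ≤ x.length, IsRuleAt code x i → IsRuleAt code x j →
      SameTerm [true, false] [true, false] x i j → i = j) ∧
    (∀ i ≤ x.length, IsPairAt code x i → ∃ u ≤ x.length, ∃ v ≤ x.length,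
      u < i ∧ v < i ∧ PairAt code x i u v) ∧
    ∃ u ≤ x.length, ∃ A, StartName x A ∧ NameAt code x u A := by
  have hle {i} (h : IsRuleAt code x i) : i ≤ x.length := h.choose_spec.1.le_length
  have h0 : (∃ P : SLP α, x = P.encode code) ↔ ∀ i ≤ x.length, Boundary x i →
      IsRuleAt code x i ∨ ∃ d ≤ x.length, SameName x i i d ∧ 2 * d + i = x.length := by
    rw [exists_eq_encode_iff]
    constructor
    · intro h i hi hb
      rw [← drop_eq_codeString_iff hi]
      exact (h i hb).imp_left fun ⟨r, hr⟩ => ⟨r, hb, hr⟩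
    · intro h i hb
      have := h i hb.le_length hb
      rw [← drop_eq_codeString_iff hb.le_length] at this
      exact this.imp_left fun ⟨r, hr⟩ => ⟨r, hr.2⟩
  rw [← h0]
  have h1 : (∀ i i' A, NameAt code x i A → NameAt code x i' A → i = i') ↔
      ∀ i ≤ x.length, ∀ j ≤ x.length, IsRuleAt code x i → IsRuleAt code x j →
        SameTerm [true, false] [true, false] x i j → i = j := by
    simp only [nameAt_iff]
    exact ⟨fun h i _ j _ hi hj ⟨A, h1, h2⟩ => h i j A ⟨hi, h1⟩ ⟨hj, h2⟩,
      fun h i j A hi hj => h i (hle hi.1) j (hle hj.1) hi.1 hj.1 ⟨A, hi.2, hj.2⟩⟩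
  have h2 : (∀ i A B C, RuleAt code x i (A, .pair B C) →
        (∃ u < i, NameAt code x u B) ∧ ∃ v < i, NameAt code x v C) ↔
      ∀ i ≤ x.length, IsPairAt code x i → ∃ u ≤ x.length, ∃ v ≤ x.length,
        u < i ∧ v < i ∧ PairAt code x i u v := by
    constructor
    · rintro h i hi ⟨A, B, C, hr⟩
      obtain ⟨⟨u, hu, hB⟩, v, hv, hC⟩ := h i A B C hr
      exact ⟨u, hu.le.trans hi, v, hv.le.trans hi, hu, hv, A, B, C, hr, hB, hC⟩
    · intro h i A B C hr
      obtain ⟨u, -, v, -, hu, hv, A', B', C', hr', hB, hC⟩ := h i hr.1.le_length ⟨A, B, C, hr⟩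
      cases RuleAt.inj hcode hr hr'
      exact ⟨⟨u, hu, hB⟩, v, hv, hC⟩
  have h3 : (∃ u A, StartName x A ∧ NameAt code x u A) ↔
      ∃ u ≤ x.length, ∃ A, StartName x A ∧ NameAt code x u A :=
    ⟨fun ⟨u, A, h, h'⟩ => ⟨u, hle (nameAt_iff.1 h').1, A, h, h'⟩, fun ⟨u, _, h⟩ => ⟨u, h⟩⟩
  rw [← h1, ← h2, ← h3]
  constructor
  · rintro ⟨P, hP, rfl⟩
    exact ⟨⟨P, rfl⟩, (wellFormed_iff hcode P).1 hP⟩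
  · rintro ⟨⟨P, rfl⟩, h⟩
    exact ⟨P, (wellFormed_iff hcode P).2 h, rfl⟩

end SLP

namespace Definable

open SLP

variable {κ : ℕ} {B : Fin κ → Language Bool} {α : Type} {code : α → List Bool}

theorem ex_le {P : ℕ → List Bool → ℕ → (ℕ → ℕ) → Prop}
    (h : Definable B fun K x e => P K x (e 0) fun i => e (i + 1)) :
    Definable B fun K x e => ∃ b ≤ x.length, P K x b e :=
  (ex (P := fun K x b e => b ≤ x.length ∧ P K x b e) ((le_len 0).and h)).congr fun _ _ _ _ =>
    exists_congr fun _ => ⟨fun h => ⟨h.1.trans_lt (lt_univ _ _), h⟩, fun h => h.2⟩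

theorem all_le {P : ℕ → List Bool → ℕ → (ℕ → ℕ) → Prop}
    (h : Definable B fun K x e => P K x (e 0) fun i => e (i + 1)) :
    Definable B fun K x e => ∀ b ≤ x.length, P K x b e :=
  (ex_le (P := fun K x b e => ¬ P K x b e) h.not).not.congr fun _ _ _ _ => by push Not; rfl

theorem boundary (i : ℕ) : Definable B fun _ x e => Boundary x (e i) := by
  refine ((eq_const i 0).or (ex_le (P := fun _ x j e => ∃ p ≤ x.length, 2 * j + 0 = p ∧
    p + 2 = e i ∧ [true, true] <+: x.drop p) <| ex_le (P := fun _ x p e => 2 * e 0 + 0 = p ∧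
    p + 2 = e (i + 1) ∧ [true, true] <+: x.drop p) <|
    .and (affine _ _ 1 0) (.and (add_const 0 _ (i + 2)) (prefix_drop _ 0)))).congr fun K x e _ => ?_
  refine or_congr_right ⟨?_, ?_⟩
  · rintro ⟨j, h, hj⟩
    have := lt_length_of_cons_prefix_drop hj
    exact ⟨j, by omega, 2 * j, by omega, rfl, h.symm, hj⟩
  · rintro ⟨j, -, _, -, rfl, h, hj⟩
    exact ⟨j, h.symm, hj⟩

theorem sameTerm (b b' : Bool) (t t' : List Bool) (i j : ℕ) :
    Definable B fun _ x e => SameTerm (b :: t) (b' :: t') x (e i) (e j) :=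
  (ex_le (P := fun _ x d e => SameName x (e i) (e j) d ∧ b :: t <+: x.drop (2 * d + e i) ∧
    b' :: t' <+: x.drop (2 * d + e j)) <| .and (sameName (i + 1) (j + 1) 0)
    (.and (cons_prefix_drop_add _ _ 0 (i + 1)) (cons_prefix_drop_add _ _ 0 (j + 1)))).congr
    fun _ _ _ _ => sameTerm_iff

theorem commaBefore (i j : ℕ) : Definable B fun _ x e => CommaBefore x (e i) (e j) :=
  (ex_le (P := fun _ x d e => SameName x (e i) (e i) d ∧ [true, false] <+: x.drop (2 * d + e i) ∧
    2 * d + 1 * e i + 2 = e j) <| .and (sameName (i + 1) (i + 1) 0)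
    (.and (cons_prefix_drop_add _ _ 0 (i + 1)) (lin 2 1 2 0 (i + 1) (j + 1)))).congr
    fun _ _ _ _ => by simp only [commaBefore_iff, one_mul, eq_comm]

theorem add_eq_len (i j : ℕ) : Definable B fun _ x e => 2 * e i + e j = x.length :=
  (ex_le (P := fun _ x p e => 2 * e i + 1 * e j + 0 = p ∧ p = x.length) <|
    .and (lin 2 1 0 (i + 1) (j + 1) 0) (len 0)).congr fun _ _ _ _ =>
      ⟨fun h => ⟨_, h.le, by ring, h⟩, by rintro ⟨_, -, rfl, h⟩; simpa using h⟩

theorem letterAt (a : α) (i : ℕ) :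
    Definable B fun _ x e => ∃ A, RuleAt code x (e i) (A, .letter a) :=
  ((boundary i).and (sameTerm true true (false :: (codeString (code a) ++ [true, true]))
    (false :: (codeString (code a) ++ [true, true])) i i)).congr fun _ _ _ _ => by
      simp [RuleAt, SameTerm, codeRule_letter_prefix_iff]

theorem isPairAt (i : ℕ) : Definable B fun _ x e => IsPairAt code x (e i) :=
  ((boundary i).and <| ex_le (P := fun _ x p e => ∃ q ≤ x.length, CommaBefore x (e i) p ∧
      CommaBefore x p q ∧ SameTerm [true, true] [true, true] x q q) <|
    ex_le (P := fun _ x q e => CommaBefore x (e (i + 1)) (e 0) ∧ CommaBefore x (e 0) q ∧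
      SameTerm [true, true] [true, true] x q q) <|
    .and (commaBefore (i + 2) 1) (.and (commaBefore 1 0) (sameTerm _ _ _ _ 0 0))).congr
    fun _ _ _ _ => isPairAt_iff

variable [Finite α]

theorem isRuleAt (i : ℕ) : Definable B fun _ x e => IsRuleAt code x (e i) :=
  ((exists_fin fun a => letterAt (code := code) a i).or (isPairAt i)).congr
    fun _ _ _ _ => isRuleAt_iff

theorem pairAt (i j l : ℕ) : Definable B fun _ x e => PairAt code x (e i) (e j) (e l) :=
  ((boundary i).and <| ex_le (P := fun _ x p e => ∃ q ≤ x.length, CommaBefore x (e i) p ∧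
      CommaBefore x p q ∧ (IsRuleAt code x (e j) ∧ SameTerm [true, false] [true, false] x p (e j)) ∧
      IsRuleAt code x (e l) ∧ SameTerm [true, true] [true, false] x q (e l)) <|
    ex_le (P := fun _ x q e => CommaBefore x (e (i + 1)) (e 0) ∧ CommaBefore x (e 0) q ∧
      (IsRuleAt code x (e (j + 1)) ∧ SameTerm [true, false] [true, false] x (e 0) (e (j + 1))) ∧
      IsRuleAt code x (e (l + 1)) ∧ SameTerm [true, true] [true, false] x q (e (l + 1))) <|
    .and (commaBefore (i + 2) 1) (.and (commaBefore 1 0) (.and (.and (isRuleAt (j + 2))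
      (sameTerm _ _ _ _ 1 (j + 2))) (.and (isRuleAt (l + 2)) (sameTerm _ _ _ _ 0 (l + 2)))))).congr
    fun _ _ _ _ => pairAt_iff

theorem startName_nameAt (i : ℕ) :
    Definable B fun _ x e => ∃ A, StartName x A ∧ NameAt code x (e i) A :=
  ((isRuleAt i).and <| ex_le (P := fun _ x j e => Boundary x j ∧ ∃ d ≤ x.length,
      SameName x j (e i) d ∧ 2 * d + j = x.length ∧ [true, false] <+: x.drop (2 * d + e i)) <|
    .and (boundary 0) <| ex_le (P := fun _ x d e => SameName x (e 0) (e (i + 1)) d ∧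
      2 * d + e 0 = x.length ∧ [true, false] <+: x.drop (2 * d + e (i + 1))) <|
    .and (sameName 1 (i + 2) 0) (.and (add_eq_len 0 1) (cons_prefix_drop_add _ _ 0 (i + 2)))).congr
    fun _ _ _ _ => startName_nameAt_iff

theorem isCode (hcode : Function.Injective code) : Definable B fun _ x _ => IsCode code x := by
  refine Definable.congr (.and ?_ (.and ?_ (.and ?_ ?_))) fun _ _ _ _ => isCode_iff hcode
  · exact all_le (P := fun _ x i _ => Boundary x i → IsRuleAt code x i ∨
      ∃ d ≤ x.length, SameName x i i d ∧ 2 * d + i = x.length) <|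
      .imp (boundary 0) <| .or (isRuleAt 0) <| ex_le (P := fun _ x d e => SameName x (e 0) (e 0) d ∧
        2 * d + e 0 = x.length) <| .and (sameName 1 1 0) (add_eq_len 0 1)
  · exact all_le (P := fun _ x i _ => ∀ j ≤ x.length, IsRuleAt code x i → IsRuleAt code x j →
      SameTerm [true, false] [true, false] x i j → i = j) <|
      all_le (P := fun _ x j e => IsRuleAt code x (e 0) → IsRuleAt code x j →
        SameTerm [true, false] [true, false] x (e 0) j → e 0 = j) <|
      .imp (isRuleAt 1) (.imp (isRuleAt 0) (.imp (sameTerm _ _ _ _ 1 0) (eq_var 1 0)))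
  · exact all_le (P := fun _ x i _ => IsPairAt code x i → ∃ u ≤ x.length, ∃ v ≤ x.length,
      u < i ∧ v < i ∧ PairAt code x i u v) <| .imp (isPairAt 0) <|
      ex_le (P := fun _ x u e => ∃ v ≤ x.length, u < e 0 ∧ v < e 0 ∧ PairAt code x (e 0) u v) <|
      ex_le (P := fun _ x v e => e 0 < e 1 ∧ v < e 1 ∧ PairAt code x (e 1) (e 0) v) <|
      .and (lt 1 2) (.and (lt 0 2) (pairAt 2 1 0))
  · exact ex_le (P := fun _ x u _ => ∃ A, StartName x A ∧ NameAt code x u A) (startName_nameAt 0)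

end Definable

/-! ### Cocycle of a normal subgroup of finite index -/

section Cocycle

variable {G : Type*} [Group G] {H : Subgroup G} [H.Normal]

/-- The element of the normal subgroup `H` by which `q.out * g` differs from the representative of
its coset. -/
noncomputable def cosetCocycle (q : G ⧸ H) (g : G) : H :=
  ⟨q.out * g * (q * (g : G ⧸ H)).out⁻¹, (QuotientGroup.eq_one_iff _).1 (by simp)⟩

theorem coe_cosetCocycle (q : G ⧸ H) (g : G) :
    (cosetCocycle q g : G) = q.out * g * (q * (g : G ⧸ H)).out⁻¹ := rfl

theorem cosetCocycle_mul (q : G ⧸ H) (g h : G) :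
    cosetCocycle q (g * h) = cosetCocycle q g * cosetCocycle (q * (g : G ⧸ H)) h := by
  ext
  simp only [Subgroup.coe_mul, coe_cosetCocycle, QuotientGroup.mk_mul, mul_assoc,
    inv_mul_cancel_left]

theorem cosetCocycle_one (q : G ⧸ H) : cosetCocycle q 1 = 1 := by
  ext
  simp [coe_cosetCocycle]

theorem eq_one_iff_cosetCocycle (g : G) :
    g = 1 ↔ (g : G ⧸ H) = 1 ∧ cosetCocycle (1 : G ⧸ H) g = 1 := by
  constructor
  · rintro rfl
    exact ⟨rfl, cosetCocycle_one _⟩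
  · rintro ⟨h1, h2⟩
    rw [Subtype.ext_iff, coe_cosetCocycle, h1, mul_one, Subgroup.coe_one, mul_inv_eq_one] at h2
    exact mul_eq_left.1 h2

end Cocycle

theorem evalWord_nil {G : Type*} [Group G] {r : ℕ} (σ : Fin r → G) : evalWord σ [] = 1 := rfl

/-- The cosets of the values of all positions are found with queries to `CWP ρ`. They serve as the
states in which the cocycle is evaluated with a query to `CWP τ`. -/
theorem definable_mem_CWP {G : Type*} [Group G] (H : Subgroup G) [H.Normal] [H.FiniteIndex]
    {r s t : ℕ} (σ : Fin r → G) {τ : Fin s → H} {ρ : Fin t → G ⧸ H}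
    (hτ : Subgroup.closure (Set.range τ) = ⊤) (hρ : Subgroup.closure (Set.range ρ) = ⊤) :
    Definable ![CWP τ, CWP ρ] fun _ x _ => x ∈ CWP σ := by
  have hc := GenLetter.code_injective (r := r)
  let S := SLP.ruleSystem hc
  let val (x : List Bool) (i : ℕ) : G := evalWord σ (SLP.wordAt GenLetter.code x i)
  have val_letter {x i a} (h : S.letterAt x i a) : val x i = evalWord σ [a] := by
    simp only [val, SLP.wordAt_of_letterAt hc h]
  have val_pair {x i u v} (h : S.pairAt x i u v) : val x i = val x u * val x v := by
    simp only [val, SLP.wordAt_of_pairAt hc h, evalWord_append]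
  have val_none {x i} (h : ∀ a, ¬ S.letterAt x i a) (h' : ∀ u v, ¬ S.pairAt x i u v) :
      val x i = 1 := by
    simp only [val, SLP.wordAt_of_forall_not hc h h', evalWord_nil]
  have hletter (a) : Definable ![CWP τ, CWP ρ] fun _ x e => S.letterAt x (e 0) a :=
    (Definable.isCode hc).and (.letterAt a 0)
  have hpair : Definable ![CWP τ, CWP ρ] fun _ x e => S.pairAt x (e 0) (e 1) (e 2) :=
    (Definable.isCode hc).and (.pairAt 0 1 2)
  -- The cosets of the values can be computed with queries to the second oracle.
  have hcoset (k : G ⧸ H) : Definable ![CWP τ, CWP ρ] fun _ x e => (val x (e 0) : G ⧸ H) = k := by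
    refine (Definable.lift (o := 1) rfl hρ S hletter hpair (D := 1)
      (κ := fun _ a => ((evalWord σ [a] : G) : G ⧸ H)) (T := fun _ _ q => q)
      (W := fun x i _ => (val x i : G ⧸ H)) ?_ (fun q q' => .const _) 0 k⁻¹).congr
      fun _ _ _ _ => mul_inv_eq_one.symm
    refine ⟨fun h _ => by rw [val_letter h], fun h _ => ?_, fun h h' _ => by
      rw [val_none h h', QuotientGroup.mk_one]⟩
    rw [val_pair h, QuotientGroup.mk_mul]
  -- The value of the cocycle is computed with queries to the first oracle.
  let ε : (G ⧸ H) ≃ Fin (Nat.card (G ⧸ H)) := Finite.equivFin _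
  have hcocycle : Definable ![CWP τ, CWP ρ] fun _ x e =>
      cosetCocycle (1 : G ⧸ H) (val x (e 0)) = 1 := by
    refine (Definable.lift (o := 0) rfl hτ S hletter hpair
      (κ := fun q a => cosetCocycle (ε.symm q) (evalWord σ [a]))
      (T := fun x u q => ε (ε.symm q * (val x u : G ⧸ H)))
      (W := fun x i q => cosetCocycle (ε.symm q) (val x i)) ?_ (fun q q' => ?_) (ε 1) 1).congr
      fun _ _ _ _ => by simp
    · refine ⟨fun h _ => by rw [val_letter h], fun h _ => ?_, fun h h' _ => by
        rw [val_none h h', cosetCocycle_one]⟩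
      rw [val_pair h, cosetCocycle_mul, ε.symm_apply_apply]
    · refine (hcoset ((ε.symm q)⁻¹ * ε.symm q')).congr fun _ _ _ _ => ?_
      rw [← ε.eq_symm_apply, eq_inv_mul_iff_mul_eq]
  refine ((Definable.isCode hc).and <| .ex_le (P := fun _ x u _ =>
    (∃ A, SLP.StartName x A ∧ SLP.NameAt (GenLetter.code (r := r)) x u A) ∧
      (val x u : G ⧸ H) = 1 ∧ cosetCocycle (1 : G ⧸ H) (val x u) = 1) <|
    (Definable.startName_nameAt 0).and ((hcoset 1).and hcocycle)).congr fun _ x _ _ => ?_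
  rw [mem_CWP_iff]
  refine and_congr_right fun _ => ⟨?_, ?_⟩
  · rintro ⟨u, A, hA, hu, h⟩
    exact ⟨u, hu.choose_spec.1.le_length, ⟨A, hA, hu⟩, (eq_one_iff_cosetCocycle _).1 h⟩
  · rintro ⟨u, -, ⟨A, hA, hu⟩, h⟩
    exact ⟨u, A, hA, hu, (eq_one_iff_cosetCocycle (H := H) _).2 h⟩

theorem mainTheorem5 {G : Type*} [Group G] [Group.FG G] (H : Subgroup G) [H.Normal]
    [H.FiniteIndex] :
    Group.FG H ∧ Group.FG (G ⧸ H) ∧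
      ∀ (r s t : ℕ) (σ : Fin r → G) (τ : Fin s → H) (ρ : Fin t → G ⧸ H),
        Subgroup.closure (Set.range σ) = ⊤ →
        Subgroup.closure (Set.range τ) = ⊤ →
        Subgroup.closure (Set.range ρ) = ⊤ →
          AC0Reducible (CWP σ) ![CWP τ, CWP ρ] :=
  ⟨inferInstance, inferInstance, fun _ _ _ σ _ _ _ hτ hρ =>
    (definable_mem_CWP H σ hτ hρ).ac0Reducible⟩
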